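/- **Conventions.** All manifolds, bundles and maps are smooth. An *abstract Jacobi manifold* $(M,L,J)$ is a (Hausdorff, second countable) manifold $M$ with a line bundle $L\to M$ and a Lie bracket $J=\{-,-\}$ on $\Gamma(L)$ which is a first order differential operator in each entry. Let $i:S\hookrightarrow M$ be a closed submanifold (an embedding with closed image), $\ell=L|_S$, $NS=TM|_S/TS$, $N_\ell S=NS\otimes\ell^*$ and $N_\ell{}^*S=\mathrm{Hom}(NS,\ell)$. For sections $\lambda,\mu$ of $L$ vanishing at $x$, $\{\lambda,\mu\}(x)$ depends only on $d_x\lambda,d_x\mu\in T_x^*M\otimes L_x$; $S$ is *coisotropic* if $\{\lambda,\mu\}(x)=0$ whenever $x\in S$, $\lambda(x)=\mu(x)=0$ and $d_x\lambda,d_x\mu$ vanish on $T_xS$. A *fat tubular neighborhood* of $S$ is an embedding $\tau_0:NS\to M$ with $\tau_0(0_x)=i(x)$, together with a smooth bundle map $\tau:L_{NS}:=\pi^*\ell\to L$ over $\tau_0$ ($\pi:NS\to S$ the projection) which is an isomorphism on each fibre and is the canonical inclusion $\ell\to L$ over the zero section. For a line bundle $V$ let $\mathrm{Der}^kV$ be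 the space of alternating $\mathbb R$-multilinear maps $\Gamma(V)^k\to\Gamma(V)$ that are first order differential operators in each entry ($\mathrm{Der}^0V=\Gamma(V)$); elements of $\mathrm{Der}^kV$ get degree $k-1$. For $\square\in\mathrm{Der}^{a}V$, $\square'\in\mathrm{Der}^{b}V$ put $$[\square,\square']^{SJ}=(-1)^{(a-1)(b-1)}\square\circ\square'-\square'\circ\square,\qquad (\square\circ\square')(\lambda_1,\dots,\lambda_{a+b-1})=\sum_{\sigma}\mathrm{sgn}(\sigma)\,\square\big(\square'(\lambda_{\sigma(1)},\dots,\lambda_{\sigma(b)}),\lambda_{\sigma(b+1)},\dots,\lambda_{\sigma(a+b-1)}\big),$$ the sum being over $(b,a-1)$-unshuffles (and $\square\circ\square'=0$ if $a=0$). A section $\varphi$ of $N_\ell{}^*S$ defines the fibrewise linear section $\mathrm{lin}(\varphi)$ of $L_{NS}$, $\mathrm{lin}(\varphi)(p)=\varphi_{\pi(p)}(p)$. For $s\in\Gamma(L_{NS})$ let $d^v s(p)\in\mathrm{Hom}(N_{\pi(p)}S,\ell_{\pi(p)})$ be its derivative at $p$ along the fibre of $\pi$ (on which $L_{NS}$ is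 trivial, with fibre $\ell_{\pi(p)}$). A section $\xi$ of $\wedge^kN_\ell S\otimes\ell$ is regarded as a family of alternating maps $\xi_x:\mathrm{Hom}(N_xS,\ell_x)^k\to\ell_x$. Define $$P:\mathrm{Der}^kL_{NS}\to\Gamma(\wedge^kN_\ell S\otimes\ell),\quad P(\square)(\varphi_1,\dots,\varphi_k)=\square(\mathrm{lin}\,\varphi_1,\dots,\mathrm{lin}\,\varphi_k)|_S,$$ $$I:\Gamma(\wedge^kN_\ell S\otimes\ell)\to\mathrm{Der}^kL_{NS},\quad I(\xi)(s_1,\dots,s_k)(p)=\xi_{\pi(p)}(d^vs_1(p),\dots,d^vs_k(p)).$$ A *Jacobi algebroid* structure on $(N_\ell{}^*S,\ell)$ is a Lie algebroid structure $([-,-],\rho)$ on $N_\ell{}^*S$ with a flat representation $\nabla$ on $\ell$. Its de Rham differential on $\Gamma(\wedge^\bullet N_\ell S\otimes\ell)$ is $$(d\xi)(\varphi_0,\dots,\varphi_k)=\sum_a(-1)^a\nabla_{\varphi_a}\big(\xi(\dots,\widehat{\varphi_a},\dots)\big)+\sum_{a<b}(-1)^{a+b}\xi([\varphi_a,\varphi_b],\dots,\widehat{\varphi_a},\dots,\widehat{\varphi_b},\dots).$$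 An *$L_\infty$-structure* on a graded vector space $W$ means here multilinear graded symmetric brackets $m_k:W^k\to W$, $k\ge0$, of degree $1$, with $m_0=0$, such that for all $n$ and all homogeneous $x_1,\dots,x_n$ $$\sum_{k+l=n}\ \sum_{\sigma}\epsilon(\sigma)\,m_{l+1}\big(m_k(x_{\sigma(1)},\dots,x_{\sigma(k)}),x_{\sigma(k+1)},\dots,x_{\sigma(n)}\big)=0,$$ with $\sigma$ running over $(k,l)$-unshuffles and $\epsilon(\sigma)$ the Koszul sign. **Proposition 3.6.** Let $S$ be a closed coisotropic submanifold of an abstract Jacobi manifold $(M,L,J)$ with a fat tubular neighborhood $(\tau_0,\tau)$. 1. There is a unique Jacobi structure on $L_{NS}\to NS$, again denoted $J$, for which $(\tau_0,\tau)$ is a Jacobi map, i.e. the pullback along $(\tau_0,\tau)$ of sections preserves brackets. 2. The graded vector space $\Gamma(\wedge^\bullet N_\ell S\otimes\ell)[1]$ (with $\Gamma(\wedge^kN_\ell S\otimes\ell)$ in degree $k-1$) carries an $L_\infty$-structure $\{m_k\}$ given by the higher derived brackets $$m_k(\xi_1,\dots,\xi_k)=P\big[\cdots\big[[J,I(\xi_1)]^{SJ},I(\xi_2)\big]^{SJ}\cdots,I(\xi_k)\big]^{SJ}.$$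 3. The unary bracket $m_1$ is the de Rham differential of the Jacobi subalgebroid $(N_\ell{}^*S,\ell)$ of $S$. That is, there is a Jacobi algebroid structure on $(N_\ell{}^*S,\ell)$ with $m_1=d$ such that, whenever $s,t\in\Gamma(L_{NS})$ vanish on the zero section and $\varphi=d^vs|_S$, $\psi=d^vt|_S$, one has for all $u\in\Gamma(L_{NS})$, $f\in C^\infty(NS)$ $$\rho(\varphi)(f|_S)\,u|_S=\big(\{s,fu\}-f\{s,u\}\big)|_S,\qquad \nabla_\varphi(u|_S)=\{s,u\}|_S,\qquad \{s,t\}|_S=0,\quad d^v\{s,t\}|_S=[\varphi,\psi].$$ If moreover the normal component of $d\tau_0$ along the zero section is the identity, i.e. $\frac{d}{dt}\big|_{t=0}\tau_0(tw)\equiv w$ modulo $TS$ for all $w\in NS$, then this structure is the one induced by $S\subset (M,L,J)$: the same formulas hold for $s,t,u\in\Gamma(L)$, $f\in C^\infty(M)$ with $s,t$ vanishing on $S$ and $\varphi,\psi\in\Gamma(N_\ell{}^*S)$ the sections induced by $ds|_S,dt|_S$. -/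

import Mathlib

open Bundle Manifold DirectSum
open scoped ContDiff

set_option linter.unusedSectionVars false

noncomputable section

namespace JacobiGeometry

section PullbackInstances

variable {B B' : Type*} (f : B' → B) (E : B → Type*)

instance pullbackAddCommGroup [∀ x, AddCommGroup (E x)] (x : B') : AddCommGroup ((f *ᵖ E) x) :=
  inferInstanceAs (AddCommGroup (E (f x)))

instance pullbackIsTopologicalAddGroup [∀ x, AddCommGroup (E x)] [∀ x, TopologicalSpace (E x)]
    [∀ x, IsTopologicalAddGroup (E x)] (x : B') : IsTopologicalAddGroup ((f *ᵖ E) x) :=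
  inferInstanceAs (IsTopologicalAddGroup (E (f x)))

instance pullbackContinuousSMul [∀ x, AddCommGroup (E x)] [∀ x, Module ℝ (E x)]
    [∀ x, TopologicalSpace (E x)] [∀ x, ContinuousSMul ℝ (E x)] (x : B') :
    ContinuousSMul ℝ ((f *ᵖ E) x) :=
  inferInstanceAs (ContinuousSMul ℝ (E (f x)))

end PullbackInstances

section Algebra

/-- Alternating `ℝ`-multilinear operators with `k` entries on a real vector space `G`
(for a section space `G = Γ(L)`, the multi-differential operators `Der^k L` are among them). -/
abbrev MultiOp (G : Type*) [AddCommGroup G] [Module ℝ G] (k : ℕ) : Type _ :=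
  G [⋀^Fin k]→ₗ[ℝ] G

variable {G : Type*} [AddCommGroup G] [Module ℝ G]

/-- The operator `(v₁,…,v_{b+a}) ↦ D(D'(v₁,…,v_b), v_{b+1},…,v_{b+a})`. -/
def insertAux {a b : ℕ} (D : MultiOp G (a + 1)) (D' : MultiOp G b) :
    MultilinearMap ℝ (fun _ : Fin (b + a) => G) G :=
  (MultilinearMap.uncurrySum (N := fun _ : Fin b ⊕ Fin a => G)
    ((AlternatingMap.toMultilinearMapLM (S := ℝ) ∘ₗ D.curryLeft).compMultilinearMap
      D'.toMultilinearMap)).domDomCongr finSumFinEquiv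

/-- The Gerstenhaber composition `D ∘ D'`: the signed sum of
`D(D'(v_{σ(1)},…,v_{σ(b)}), v_{σ(b+1)},…,v_{σ(b+a)})` over the `(b,a)`-unshuffles `σ`, written as
the sum over all permutations divided by `b! a!`. -/
def insertOp {a b : ℕ} (D : MultiOp G (a + 1)) (D' : MultiOp G b) : MultiOp G (b + a) :=
  ((b.factorial : ℝ) * (a.factorial : ℝ))⁻¹ • MultilinearMap.alternatization (insertAux D D')

theorem insertAux_apply {a b : ℕ} (D : MultiOp G (a + 1)) (D' : MultiOp G b)
    (v : Fin (b + a) → G) :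
    insertAux D D' v =
      D (Matrix.vecCons (D' fun j => v (Fin.castAdd a j)) fun j => v (Fin.natAdd b j)) := by
  rfl

theorem insertOp_apply {a b : ℕ} (D : MultiOp G (a + 1)) (D' : MultiOp G b)
    (v : Fin (b + a) → G) :
    insertOp D D' v = ((b.factorial : ℝ) * (a.factorial : ℝ))⁻¹ •
      ∑ σ : Equiv.Perm (Fin (b + a)), Equiv.Perm.sign σ •
        D (Matrix.vecCons (D' fun j => v (σ (Fin.castAdd a j)))
          fun j => v (σ (Fin.natAdd b j))) := by
  simp [insertOp, MultilinearMap.alternatization_apply, insertAux_apply]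

/-- The Gerstenhaber composition as a bilinear map; the composition is zero when the first operator
has no entry. -/
def insertLin (G : Type*) [AddCommGroup G] [Module ℝ G] :
    (a b : ℕ) → MultiOp G a →ₗ[ℝ] MultiOp G b →ₗ[ℝ] (⨁ n, MultiOp G n)
  | 0, _ => 0
  | a + 1, b => LinearMap.mk₂ ℝ
      (fun D D' => DirectSum.lof ℝ ℕ (fun n => MultiOp G n) (b + a) (insertOp D D'))
      (by
        intro D₁ D₂ D'
        rw [← map_add]; congr 1; ext v
        simp [insertOp_apply, Finset.sum_add_distrib])
      (by
        intro c D D'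
        rw [← map_smul]; congr 1; ext v
        simp [insertOp_apply, Finset.smul_sum, smul_comm c])
      (by
        intro D D₁ D₂
        rw [← map_add]; congr 1; ext v
        simp only [AlternatingMap.add_apply, insertOp_apply, ← smul_add, ← Finset.sum_add_distrib]
        simp only [← D.curryLeft_apply_apply, map_add, AlternatingMap.add_apply])
      (by
        intro c D D'
        rw [← map_smul]; congr 1; ext v
        simp only [AlternatingMap.smul_apply, insertOp_apply, Finset.smul_sum, smul_comm c]
        simp only [← D.curryLeft_apply_apply, map_smul, AlternatingMap.smul_apply])

/-- `[D, D'] = (-1)^((a-1)(b-1)) D ∘ D' - D' ∘ D` for `D` with `a` entries and `D'` with `b`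
entries. -/
def bracketComp (G : Type*) [AddCommGroup G] [Module ℝ G] (a b : ℕ) :
    MultiOp G a →ₗ[ℝ] MultiOp G b →ₗ[ℝ] (⨁ n, MultiOp G n) :=
  ((-1 : ℝ) ^ (((a : ℤ) - 1) * ((b : ℤ) - 1))) • insertLin G a b +
    (-1 : ℝ) • (insertLin G b a).flip

/-- The Schouten-Jacobi bracket on the direct sum of all the alternating operators; an operator with
`a` entries has degree `a - 1`. Operators which are first order in each entry form a graded Lie
subalgebra. -/
def schoutenJacobi (G : Type*) [AddCommGroup G] [Module ℝ G] :
    (⨁ n, MultiOp G n) →ₗ[ℝ] (⨁ n, MultiOp G n) →ₗ[ℝ] (⨁ n, MultiOp G n) :=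
  DirectSum.toModule ℝ ℕ _ fun a =>
    (DirectSum.toModule ℝ ℕ _ fun b => (bracketComp G a b).flip).flip

theorem schoutenJacobi_lof (a b : ℕ) (D : MultiOp G a) (D' : MultiOp G b) :
    schoutenJacobi G (DirectSum.lof ℝ ℕ (fun n => MultiOp G n) a D)
      (DirectSum.lof ℝ ℕ (fun n => MultiOp G n) b D') = bracketComp G a b D D' := by
  simp [schoutenJacobi, DirectSum.toModule_lof]

end Algebra

section LInfinity

variable {W : Type*} [AddCommGroup W] [Module ℝ W]

/-- The Koszul sign of the unshuffle which moves the entries in `s` to the front, for entries of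
degrees `p`. -/
def koszulSign {n : ℕ} (s : Finset (Fin n)) (p : Fin n → ℤ) : ℝ :=
  ∏ i ∈ s, ∏ j ∈ sᶜ, if j < i then (-1 : ℝ) ^ (p i * p j) else 1

/-- An `L_∞`-structure on the graded vector space `W = ⨁ gr d`, in the degree `1` convention:
graded symmetric multilinear brackets of degree `1` such that, for all homogeneous `x₁,…,x_n`,
`∑ ± m_{l+1}(m_k(x_{σ(1)},…,x_{σ(k)}), x_{σ(k+1)},…,x_{σ(n)}) = 0`, the sum being over all
`k + l = n` and all `(k,l)`-unshuffles `σ`, with Koszul signs. An unshuffle is given by the subset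
`s` of the entries that it moves to the front. -/
structure LInfinityStructure (gr : ℤ → Submodule ℝ W) where
  bracket : (k : ℕ) → MultilinearMap ℝ (fun _ : Fin k => W) W
  bracket_zero : ∀ x, bracket 0 x = 0
  degree : ∀ (k : ℕ) (p : Fin k → ℤ) (x : Fin k → W), (∀ j, x j ∈ gr (p j)) →
    bracket k x ∈ gr (∑ j, p j + 1)
  symm : ∀ (k : ℕ) (p : Fin k → ℤ) (x : Fin k → W), (∀ j, x j ∈ gr (p j)) →
    ∀ i j : Fin k, (j : ℕ) = i + 1 →
      bracket k (x ∘ Equiv.swap i j) = ((-1 : ℝ) ^ (p i * p j)) • bracket k x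
  jacobi : ∀ (n : ℕ) (p : Fin n → ℤ) (x : Fin n → W), (∀ j, x j ∈ gr (p j)) →
    ∑ s : Finset (Fin n), koszulSign s p •
      bracket (sᶜ.card + 1) (Fin.cons (bracket s.card (x ∘ s.orderEmbOfFin rfl))
        (x ∘ sᶜ.orderEmbOfFin rfl)) = 0

end LInfinity
section Sections

variable {EX HX : Type*} [NormedAddCommGroup EX] [NormedSpace ℝ EX] [TopologicalSpace HX]
  {IX : ModelWithCorners ℝ EX HX} {X : Type*} [TopologicalSpace X] [ChartedSpace HX X]
  {EY HY : Type*} [NormedAddCommGroup EY] [NormedSpace ℝ EY] [TopologicalSpace HY]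
  {IY : ModelWithCorners ℝ EY HY} {Y : Type*} [TopologicalSpace Y] [ChartedSpace HY Y]
  {K : Type*} [NormedAddCommGroup K] [NormedSpace ℝ K]
  {V : X → Type*} [∀ x, AddCommGroup (V x)] [∀ x, Module ℝ (V x)] [∀ x, TopologicalSpace (V x)]
  [TopologicalSpace (TotalSpace K V)] [FiberBundle K V] [VectorBundle ℝ K V]

/-- Sections of a vector bundle multiplied by smooth functions. -/
instance sectionSMul : SMul C^∞⟮IX, X; ℝ⟯ Cₛ^∞⟮IX; K, V⟯ where
  smul f s := ⟨fun x => f x • s x, f.contMDiff.smul_section s.contMDiff⟩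

theorem section_smul_apply (f : C^∞⟮IX, X; ℝ⟯) (s : Cₛ^∞⟮IX; K, V⟯) (x : X) :
    (f • s) x = f x • s x := rfl

/-- A differential operator of order at most one: `[[D, f], g] = 0` for all smooth functions. -/
def IsFirstOrder (D : Cₛ^∞⟮IX; K, V⟯ → Cₛ^∞⟮IX; K, V⟯) : Prop :=
  ∀ (f g : C^∞⟮IX, X; ℝ⟯) (s : Cₛ^∞⟮IX; K, V⟯),
    D (f • g • s) - f • D (g • s) - g • D (f • s) + f • g • D s = 0

variable (IX K V) in
/-- An abstract Jacobi structure on the line bundle `V`: a Lie bracket on `Γ(V)` which is a first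
order differential operator in each entry (by antisymmetry, one entry is enough). -/
structure JacobiStructure where
  bracket : MultiOp Cₛ^∞⟮IX; K, V⟯ 2
  firstOrder : ∀ t, IsFirstOrder fun s => bracket ![s, t]
  jacobi : ∀ r s t, bracket ![r, bracket ![s, t]] + bracket ![s, bracket ![t, r]] +
    bracket ![t, bracket ![r, s]] = 0

theorem contMDiffAt_pullback_iff {f : C^∞⟮IY, Y; IX, X⟯} {s : ∀ y, (f *ᵖ V) y} {y : Y} :
    ContMDiffAt IY (IY.prod 𝓘(ℝ, K)) ∞ (fun y => (⟨y, s y⟩ : TotalSpace K (f *ᵖ V))) y ↔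
      ContMDiffAt IY (IX.prod 𝓘(ℝ, K)) ∞ (fun y => (⟨f y, s y⟩ : TotalSpace K V)) y := by
  rw [contMDiffAt_section, contMDiffAt_totalSpace]
  exact (and_iff_right f.contMDiff.contMDiffAt).symm

/-- A section of the pullback bundle, from a smooth map to the total space which covers `f`. -/
def pullbackSection (f : C^∞⟮IY, Y; IX, X⟯) (s : ∀ y, V (f y))
    (hs : ContMDiff IY (IX.prod 𝓘(ℝ, K)) ∞ (fun y => (⟨f y, s y⟩ : TotalSpace K V))) :
    Cₛ^∞⟮IY; K, (f *ᵖ V)⟯ :=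
  ⟨s, fun y => contMDiffAt_pullback_iff.2 (hs y)⟩

theorem pullbackSection_total {f : C^∞⟮IY, Y; IX, X⟯} (s : Cₛ^∞⟮IY; K, (f *ᵖ V)⟯) :
    ContMDiff IY (IX.prod 𝓘(ℝ, K)) ∞ (fun y => (⟨f y, s y⟩ : TotalSpace K V)) :=
  fun y => contMDiffAt_pullback_iff.1 (s.contMDiff y)

variable {K' : Type*} [NormedAddCommGroup K'] [NormedSpace ℝ K']
  {V' : X → Type*} [∀ x, AddCommGroup (V' x)] [∀ x, Module ℝ (V' x)]
  [∀ x, TopologicalSpace (V' x)] [∀ x, IsTopologicalAddGroup (V' x)]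
  [∀ x, ContinuousSMul ℝ (V' x)]
  [TopologicalSpace (TotalSpace K' V')] [FiberBundle K' V'] [VectorBundle ℝ K' V']

theorem contMDiffAt_alternating_apply {k : ℕ}
    {f : Y → X} {T : ∀ y, V (f y) [⋀^Fin k]→L[ℝ] V' (f y)} {v : Fin k → ∀ y, V (f y)} {y : Y}
    (hT : ContMDiffAt IY (IX.prod 𝓘(ℝ, K [⋀^Fin k]→L[ℝ] K')) ∞
      (fun y => (⟨f y, T y⟩ : TotalSpace (K [⋀^Fin k]→L[ℝ] K')
        fun x => V x [⋀^Fin k]→L[ℝ] V' x)) y)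
    (hv : ∀ j, ContMDiffAt IY (IX.prod 𝓘(ℝ, K)) ∞
      (fun y => (⟨f y, v j y⟩ : TotalSpace K V)) y) :
    ContMDiffAt IY (IX.prod 𝓘(ℝ, K')) ∞
      (fun y => (⟨f y, T y fun j => v j y⟩ : TotalSpace K' V')) y := by
  rw [contMDiffAt_totalSpace] at hT ⊢
  have hv' := fun j => contMDiffAt_totalSpace.1 (hv j)
  refine ⟨hT.1, ?_⟩
  set T' : Y → (K [⋀^Fin k]→L[ℝ] K') := fun y' =>
    (trivializationAt (K [⋀^Fin k]→L[ℝ] K') (fun x => V x [⋀^Fin k]→L[ℝ] V' x) (f y)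
      ⟨f y', T y'⟩).2 with hT'
  set v' : Y → Fin k → K := fun y' j => (trivializationAt K V (f y) ⟨f y', v j y'⟩).2 with hv''
  have h1 : ContMDiffAt IY 𝓘(ℝ, K') ∞ (fun y' => T' y' (v' y')) y := by
    have : ContDiff ℝ ∞ (fun q : (K [⋀^Fin k]→L[ℝ] K') × (Fin k → K) => q.1 q.2) := by
      have h := ((ContinuousAlternatingMap.toContinuousMultilinearMapCLM ℝ :
        (K [⋀^Fin k]→L[ℝ] K') →L[ℝ] _).analyticOnNhd_uncurry_of_multilinear
          (s := Set.univ)).contDiffOn (n := ∞) uniqueDiffOn_univ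
      exact contDiffOn_univ.1 h
    exact this.contMDiff.contMDiffAt.comp y
      (hT.2.prodMk_space (contMDiffAt_pi_space.2 fun j => (hv' j).2))
  refine h1.congr_of_eventuallyEq ?_
  have c := hT.1.continuousAt
  filter_upwards [c ((trivializationAt K V (f y)).open_baseSet.mem_nhds
      (mem_baseSet_trivializationAt K V (f y))),
    c ((trivializationAt K' V' (f y)).open_baseSet.mem_nhds
      (mem_baseSet_trivializationAt K' V' (f y)))] with y' h h'
  simp only [Set.mem_preimage] at h h'
  simp only [hT', hv'']
  rw [FiberBundle.trivializationAt_continuousAlternatingMap_apply]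
  rw [ContinuousAlternatingMap.inCoordinates_eq K K' h h']
  simp [Function.comp_def]
  congr 4 with j
  exact ((trivializationAt K V (f y)).symm_apply_apply_mk h (v j y')).symm

end Sections

section NormalBundleTotalSpace

variable {ES : Type*} [NormedAddCommGroup ES] [NormedSpace ℝ ES]
  {S : Type*} [TopologicalSpace S] [ChartedSpace ES S]
  [IsManifold 𝓘(ℝ, ES) ∞ S]
  {F : Type*} [NormedAddCommGroup F] [NormedSpace ℝ F]
  (N : S → Type*) [∀ x, AddCommGroup (N x)] [∀ x, Module ℝ (N x)] [∀ x, TopologicalSpace (N x)]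
  [∀ x, IsTopologicalAddGroup (N x)] [∀ x, ContinuousSMul ℝ (N x)]
  [TopologicalSpace (TotalSpace F N)] [FiberBundle F N] [VectorBundle ℝ F N]
  [ContMDiffVectorBundle ∞ F N 𝓘(ℝ, ES)]
  (ℓ : S → Type*) [∀ x, AddCommGroup (ℓ x)] [∀ x, Module ℝ (ℓ x)] [∀ x, TopologicalSpace (ℓ x)]
  [∀ x, IsTopologicalAddGroup (ℓ x)] [∀ x, ContinuousSMul ℝ (ℓ x)]
  [TopologicalSpace (TotalSpace ℝ ℓ)] [FiberBundle ℝ ℓ] [VectorBundle ℝ ℝ ℓ]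
  [ContMDiffVectorBundle ∞ ℝ ℓ 𝓘(ℝ, ES)]

variable (ES F) in
/-- The projection `π : N → S` of the total space, as a smooth map. -/
def footPoint : C^∞⟮𝓘(ℝ, ES).prod 𝓘(ℝ, F), TotalSpace F N; 𝓘(ℝ, ES), S⟯ :=
  ⟨TotalSpace.proj, contMDiff_proj N⟩

variable (ES F) in
/-- `Γ(L_NS)`, the sections of `L_NS = π*ℓ` over the total space of `N`. -/
abbrev PullbackSections : Type _ :=
  Cₛ^∞⟮𝓘(ℝ, ES).prod 𝓘(ℝ, F); ℝ, (footPoint ES F N *ᵖ ℓ)⟯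

variable (ES F) in
/-- `Γ(N_ℓ*S)`, the sections of `N_ℓ*S = N* ⊗ ℓ = Hom(N, ℓ)`. -/
abbrev ConormalSections : Type _ :=
  Cₛ^∞⟮𝓘(ℝ, ES); F →L[ℝ] ℝ, fun x => N x →L[ℝ] ℓ x⟯

variable (ES F) in
/-- `Γ(∧^k N_ℓS ⊗ ℓ)`: smooth families of alternating `k`-linear maps `Hom(N_x, ℓ_x)^k → ℓ_x`. -/
abbrev NormalForms (k : ℕ) : Type _ :=
  Cₛ^∞⟮𝓘(ℝ, ES); (F →L[ℝ] ℝ) [⋀^Fin k]→L[ℝ] ℝ, fun x => (N x →L[ℝ] ℓ x) [⋀^Fin k]→L[ℝ] ℓ x⟯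

variable {N ℓ}

/-- The fibrewise linear section of `π*ℓ` defined by a section of `Hom(N, ℓ)`. -/
def linLift : ConormalSections ES F N ℓ →ₗ[ℝ] PullbackSections ES F N ℓ where
  toFun φ := pullbackSection (footPoint ES F N) (fun p => φ p.1 p.2) <| by
    refine ContMDiff.clm_bundle_apply (F₁ := F) (F₂ := ℝ) (E₁ := N) (E₂ := ℓ)
      (b := fun p : TotalSpace F N => p.1)
      (ϕ := fun p => φ p.1) (v := fun p => p.2) ?_ ?_
    · exact φ.contMDiff.comp (contMDiff_proj N)
    · exact contMDiff_id
  map_add' _ _ := rfl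
  map_smul' _ _ := rfl

/-- Restriction to the zero section of a section of `π*ℓ`. -/
def restrictZero : PullbackSections ES F N ℓ →ₗ[ℝ] Cₛ^∞⟮𝓘(ℝ, ES); ℝ, ℓ⟯ where
  toFun s := ⟨fun x => s ⟨x, 0⟩, by
    have h : ContMDiff 𝓘(ℝ, ES) (𝓘(ℝ, ES).prod 𝓘(ℝ, F)) ∞ (zeroSection F N) :=
      contMDiff_zeroSection _ _
    exact (pullbackSection_total s).comp h⟩
  map_add' _ _ := rfl
  map_smul' _ _ := rfl

/-- The value at `w ∈ N_x` of a section of `π*ℓ`, seen as an element of `ℓ_x`. -/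
def fibreValue (s : PullbackSections ES F N ℓ) (x : S) (w : N x) : ℓ x := s ⟨x, w⟩

/-- The derivative at `p ∈ N_x`, along the fibre `N_x`, of a section of `π*ℓ`. On a fibre such a
section is a function with values in the fixed line `ℓ_x`. The derivative is computed in linear
coordinates on `N_x` and `ℓ_x` and does not depend on them. -/
def vertDeriv (s : PullbackSections ES F N ℓ) (p : TotalSpace F N) : N p.1 →L[ℝ] ℓ p.1 :=
  let e := (trivializationAt F N p.1).continuousLinearEquivAt ℝ p.1
    (mem_baseSet_trivializationAt F N p.1)
  let e' := (trivializationAt ℝ ℓ p.1).continuousLinearEquivAt ℝ p.1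
    (mem_baseSet_trivializationAt ℝ ℓ p.1)
  (e'.symm : ℝ →L[ℝ] ℓ p.1) ∘L
    (fderiv ℝ (fun w : F => e' (fibreValue s p.1 (e.symm w))) (e p.2)) ∘L (e : N p.1 →L[ℝ] F)

theorem vertDeriv_eq (s : PullbackSections ES F N ℓ) (p : TotalSpace F N)
    (e : N p.1 ≃L[ℝ] F) (e' : ℓ p.1 ≃L[ℝ] ℝ) :
    vertDeriv s p = (e'.symm : ℝ →L[ℝ] ℓ p.1) ∘L
      (fderiv ℝ (fun w : F => e' (fibreValue s p.1 (e.symm w))) (e p.2)) ∘L (e : N p.1 →L[ℝ] F) := by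
  unfold vertDeriv
  set e₀ := (trivializationAt F N p.1).continuousLinearEquivAt ℝ p.1
    (mem_baseSet_trivializationAt F N p.1)
  set e₀' := (trivializationAt ℝ ℓ p.1).continuousLinearEquivAt ℝ p.1
    (mem_baseSet_trivializationAt ℝ ℓ p.1)
  have h : (fun w : F => e' (fibreValue s p.1 (e.symm w))) =
      (e₀'.symm.trans e') ∘ ((fun w : F => e₀' (fibreValue s p.1 (e₀.symm w))) ∘ (e.symm.trans e₀)) := by
    ext w; simp
  rw [h, ContinuousLinearEquiv.comp_fderiv, ContinuousLinearEquiv.comp_right_fderiv]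
  ext v
  simp

theorem contMDiffAt_trivialized (s : PullbackSections ES F N ℓ) (x₀ : S) (q : S × F)
    (hq : q.1 ∈ (trivializationAt F N x₀).baseSet) (hq' : q.1 ∈ (trivializationAt ℝ ℓ x₀).baseSet) :
    ContMDiffAt (𝓘(ℝ, ES).prod 𝓘(ℝ, F)) 𝓘(ℝ, ℝ) ∞ (fun q : S × F =>
      (trivializationAt ℝ ℓ x₀ ⟨q.1, s ⟨q.1, (trivializationAt F N x₀).symm q.1 q.2⟩⟩).2) q := by
  have h1 : ContMDiffAt (𝓘(ℝ, ES).prod 𝓘(ℝ, F)) (𝓘(ℝ, ES).prod 𝓘(ℝ, F)) ∞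
      (fun q : S × F => (⟨q.1, (trivializationAt F N x₀).symm q.1 q.2⟩ : TotalSpace F N)) q := by
    refine (((trivializationAt F N x₀).contMDiffOn_symm (IB := 𝓘(ℝ, ES)) (n := ∞)).contMDiffAt
      ((trivializationAt F N x₀).open_target.mem_nhds ?_)).congr_of_eventuallyEq ?_
    · rw [Trivialization.mem_target]; exact hq
    · have : Prod.fst ⁻¹' (trivializationAt F N x₀).baseSet ∈ nhds q :=
        continuous_fst.continuousAt ((trivializationAt F N x₀).open_baseSet.mem_nhds hq)
      filter_upwards [this] with q' hq'
      exact (trivializationAt F N x₀).mk_symm hq' q'.2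
  have h2 := ((pullbackSection_total s).contMDiffAt).comp q h1
  exact (((trivializationAt ℝ ℓ x₀).contMDiffAt_iff (by
    rw [Trivialization.mem_source]; exact hq')).1 h2).2

theorem differentiable_fibre (s : PullbackSections ES F N ℓ) (x : S)
    (e : N x ≃L[ℝ] F) (e' : ℓ x ≃L[ℝ] ℝ) : Differentiable ℝ fun w : F => e' (fibreValue s x (e.symm w)) := by
  set e₀ := (trivializationAt F N x).continuousLinearEquivAt ℝ x
    (mem_baseSet_trivializationAt F N x) with he₀
  set e₀' := (trivializationAt ℝ ℓ x).continuousLinearEquivAt ℝ x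
    (mem_baseSet_trivializationAt ℝ ℓ x) with he₀'
  have h0 : Differentiable ℝ fun w : F => e₀' (fibreValue s x (e₀.symm w)) := by
    intro w
    have h := contMDiffAt_trivialized s x (x, w) (mem_baseSet_trivializationAt F N x)
      (mem_baseSet_trivializationAt ℝ ℓ x)
    have h' : ContMDiffAt 𝓘(ℝ, F) 𝓘(ℝ, ℝ) ∞ (fun w : F => e₀' (fibreValue s x (e₀.symm w))) w :=
      h.comp w ((contMDiffAt_const (c := x)).prodMk contMDiffAt_id)
    exact h'.contDiffAt.differentiableAt (by simp)
  have h : (fun w : F => e' (fibreValue s x (e.symm w))) =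
      (e₀'.symm.trans e') ∘ ((fun w : F => e₀' (fibreValue s x (e₀.symm w))) ∘ (e.symm.trans e₀)) := by
    ext w; simp
  rw [h]
  exact (ContinuousLinearEquiv.differentiable _).comp
    (h0.comp (ContinuousLinearEquiv.differentiable _))

theorem contMDiff_vertDeriv (s : PullbackSections ES F N ℓ) :
    ContMDiff (𝓘(ℝ, ES).prod 𝓘(ℝ, F)) (𝓘(ℝ, ES).prod 𝓘(ℝ, F →L[ℝ] ℝ)) ∞
      (fun p : TotalSpace F N =>
        (⟨p.1, vertDeriv s p⟩ : TotalSpace (F →L[ℝ] ℝ) fun x => N x →L[ℝ] ℓ x)) := by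
  intro p₀
  rw [contMDiffAt_hom_bundle]
  refine ⟨(contMDiff_proj N).contMDiffAt, ?_⟩
  have hN := mem_baseSet_trivializationAt F N p₀.1
  have hL := mem_baseSet_trivializationAt ℝ ℓ p₀.1
  set G : S × F → ℝ := fun q => (trivializationAt ℝ ℓ p₀.1
      ⟨q.1, s ⟨q.1, (trivializationAt F N p₀.1).symm q.1 q.2⟩⟩).2 with hG
  set u : TotalSpace F N → F := fun p => (trivializationAt F N p₀.1 p).2 with hu
  have hu' : ContMDiffAt (𝓘(ℝ, ES).prod 𝓘(ℝ, F)) 𝓘(ℝ, F) ∞ u p₀ :=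
    (contMDiffAt_totalSpace.1 (contMDiffAt_id (x := p₀))).2
  have hG' := contMDiffAt_trivialized s p₀.1 (p₀.1, u p₀) hN hL
  have h1 : ContMDiffAt ((𝓘(ℝ, ES).prod 𝓘(ℝ, F)).prod 𝓘(ℝ, F)) 𝓘(ℝ, ℝ) ∞
      (Function.uncurry fun (p : TotalSpace F N) (w : F) => G (p.1, w)) (p₀, u p₀) := by
    refine ContMDiffAt.comp (p₀, u p₀) (g := G)
      (f := fun q : TotalSpace F N × F => (q.1.1, q.2)) hG' ?_
    exact (((contMDiff_proj N).contMDiffAt).comp (p₀, u p₀) contMDiffAt_fst).prodMk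
      contMDiffAt_snd
  have h2 := ContMDiffAt.mfderiv (m := ∞) (fun (p : TotalSpace F N) (w : F) => G (p.1, w)) u
    h1 hu' (by simp)
  have h3 := inTangentCoordinates_model_space (I := 𝓘(ℝ, F)) (I' := 𝓘(ℝ, ℝ)) u
    (fun p : TotalSpace F N => G (p.1, u p))
    (fun p => mfderiv 𝓘(ℝ, F) 𝓘(ℝ, ℝ) (fun w => G (p.1, w)) (u p)) p₀
  rw [h3] at h2
  refine h2.congr_of_eventuallyEq ?_
  have c : Continuous (TotalSpace.proj : TotalSpace F N → S) := FiberBundle.continuous_proj F N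
  filter_upwards [c.continuousAt ((trivializationAt F N p₀.1).open_baseSet.mem_nhds hN),
    c.continuousAt ((trivializationAt ℝ ℓ p₀.1).open_baseSet.mem_nhds hL)] with p hp hp'
  simp only [Set.mem_preimage] at hp hp'
  rw [ContinuousLinearMap.inCoordinates_eq hp hp',
    vertDeriv_eq s p ((trivializationAt F N p₀.1).continuousLinearEquivAt ℝ p.1 hp)
      ((trivializationAt ℝ ℓ p₀.1).continuousLinearEquivAt ℝ p.1 hp'), mfderiv_eq_fderiv]
  ext v
  set e := (trivializationAt F N p₀.1).continuousLinearEquivAt ℝ p.1 hp with he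
  set e' := (trivializationAt ℝ ℓ p₀.1).continuousLinearEquivAt ℝ p.1 hp' with he'
  change e' (e'.symm (fderiv ℝ (fun w : F => e' (fibreValue s p.1 (e.symm w))) (e p.2)
    (e (e.symm v)))) = fderiv ℝ (fun w : F => e' (fibreValue s p.1 (e.symm w))) (e p.2) v
  rw [e'.apply_symm_apply, e.apply_symm_apply]

/-- The vertical derivative as an operator `Γ(π*ℓ) → Γ(π*Hom(N, ℓ))`. -/
def vertDerivSection : PullbackSections ES F N ℓ →ₗ[ℝ]
    Cₛ^∞⟮𝓘(ℝ, ES).prod 𝓘(ℝ, F); F →L[ℝ] ℝ, (footPoint ES F N *ᵖ fun x => N x →L[ℝ] ℓ x)⟯ where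
  toFun s := pullbackSection (footPoint ES F N) (fun p => vertDeriv s p) (contMDiff_vertDeriv s)
  map_add' s t := by
    refine ContMDiffSection.ext fun p => ?_
    change vertDeriv (s + t) p = vertDeriv s p + vertDeriv t p
    set e := (trivializationAt F N p.1).continuousLinearEquivAt ℝ p.1
      (mem_baseSet_trivializationAt F N p.1)
    set e' := (trivializationAt ℝ ℓ p.1).continuousLinearEquivAt ℝ p.1
      (mem_baseSet_trivializationAt ℝ ℓ p.1)
    have h : (fun w : F => e' (fibreValue (s + t) p.1 (e.symm w))) =
        (fun w : F => e' (fibreValue s p.1 (e.symm w))) +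
          fun w : F => e' (fibreValue t p.1 (e.symm w)) := by
      ext w
      exact map_add e' (fibreValue s p.1 (e.symm w)) (fibreValue t p.1 (e.symm w))
    rw [vertDeriv_eq _ p e e', vertDeriv_eq s p e e', vertDeriv_eq t p e e', h,
      fderiv_add (differentiable_fibre s p.1 e e' _) (differentiable_fibre t p.1 e e' _)]
    ext v
    simp
  map_smul' c s := by
    refine ContMDiffSection.ext fun p => ?_
    change vertDeriv (c • s) p = c • vertDeriv s p
    set e := (trivializationAt F N p.1).continuousLinearEquivAt ℝ p.1
      (mem_baseSet_trivializationAt F N p.1)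
    set e' := (trivializationAt ℝ ℓ p.1).continuousLinearEquivAt ℝ p.1
      (mem_baseSet_trivializationAt ℝ ℓ p.1)
    have h : (fun w : F => e' (fibreValue (c • s) p.1 (e.symm w))) =
        c • fun w : F => e' (fibreValue s p.1 (e.symm w)) := by
      ext w
      exact map_smul e' c (fibreValue s p.1 (e.symm w))
    rw [vertDeriv_eq _ p e e', vertDeriv_eq s p e e', h,
      fderiv_const_smul (differentiable_fibre s p.1 e e' _)]
    ext v
    simp

theorem vertDerivSection_apply (s : PullbackSections ES F N ℓ) (p : TotalSpace F N) :
    vertDerivSection s p = vertDeriv s p := rfl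

/-- The vertical derivative at a point. -/
def vertDerivAt (p : TotalSpace F N) : PullbackSections ES F N ℓ →ₗ[ℝ] (N p.1 →L[ℝ] ℓ p.1) where
  toFun s := vertDeriv s p
  map_add' s t := congrArg (fun r => r p) (vertDerivSection.map_add s t)
  map_smul' c s := congrArg (fun r => r p) (vertDerivSection.map_smul c s)

/-- The vertical lift `I` of `ξ ∈ Γ(∧^k N_ℓS ⊗ ℓ)`, the multi-differential operator
`I(ξ)(s₁,…,s_k)(p) = ξ_{π(p)}(d^v s₁(p),…,d^v s_k(p))`. -/
def vertLift (k : ℕ) : NormalForms ES F N ℓ k →ₗ[ℝ]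
    (PullbackSections ES F N ℓ [⋀^Fin k]→ₗ[ℝ] PullbackSections ES F N ℓ) where
  toFun ξ :=
    { toFun := fun s => pullbackSection (footPoint ES F N)
        (fun p => ξ p.1 fun j => vertDerivSection (s j) p) <| by
          intro p
          refine contMDiffAt_alternating_apply (K := F →L[ℝ] ℝ) (K' := ℝ)
            (V := fun x => N x →L[ℝ] ℓ x) (V' := ℓ)
            (f := fun p : TotalSpace F N => p.1) (T := fun p => ξ p.1)
            (v := fun j p => vertDerivSection (s j) p) ?_ ?_
          · exact (ξ.contMDiff.comp (contMDiff_proj N)).contMDiffAt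
          · exact fun j => (pullbackSection_total (vertDerivSection (s j))).contMDiffAt
      map_update_add' := fun s i a b => ContMDiffSection.ext fun p =>
        ((ξ p.1).toAlternatingMap.compLinearMap (vertDerivAt p)).map_update_add s i a b
      map_update_smul' := fun s i c a => ContMDiffSection.ext fun p =>
        ((ξ p.1).toAlternatingMap.compLinearMap (vertDerivAt p)).map_update_smul s i c a
      map_eq_zero_of_eq' := fun s i j h hij => ContMDiffSection.ext fun p =>
        ((ξ p.1).toAlternatingMap.compLinearMap (vertDerivAt p)).map_eq_zero_of_eq s h hij }
  map_add' _ _ := rfl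
  map_smul' _ _ := rfl

/-- Evaluation at a point. -/
def evalAt (x : S) : ConormalSections ES F N ℓ →ₗ[ℝ] (N x →L[ℝ] ℓ x) where
  toFun φ := φ x
  map_add' _ _ := rfl
  map_smul' _ _ := rfl

/-- The embedding of `Γ(∧^k N_ℓS ⊗ ℓ)` into the alternating maps `Γ(N_ℓ*S)^k → Γ(ℓ)`. -/
def evalForm (k : ℕ) : NormalForms ES F N ℓ k →ₗ[ℝ]
    (ConormalSections ES F N ℓ [⋀^Fin k]→ₗ[ℝ] Cₛ^∞⟮𝓘(ℝ, ES); ℝ, ℓ⟯) where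
  toFun ξ :=
    { toFun := fun φ => ⟨fun x => ξ x fun j => φ j x, by
          intro x
          refine contMDiffAt_alternating_apply (K := F →L[ℝ] ℝ) (K' := ℝ)
            (V := fun x => N x →L[ℝ] ℓ x) (V' := ℓ)
            (f := fun x : S => x) (T := fun x => ξ x)
            (v := fun j x => φ j x) ?_ ?_
          · exact ξ.contMDiff.contMDiffAt
          · exact fun j => (φ j).contMDiff.contMDiffAt⟩
      map_update_add' := fun φ i a b => ContMDiffSection.ext fun x =>
        ((ξ x).toAlternatingMap.compLinearMap (evalAt x)).map_update_add φ i a b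
      map_update_smul' := fun φ i c a => ContMDiffSection.ext fun x =>
        ((ξ x).toAlternatingMap.compLinearMap (evalAt x)).map_update_smul φ i c a
      map_eq_zero_of_eq' := fun φ i j h hij => ContMDiffSection.ext fun x =>
        ((ξ x).toAlternatingMap.compLinearMap (evalAt x)).map_eq_zero_of_eq φ h hij }
  map_add' _ _ := rfl
  map_smul' _ _ := rfl


/-- The projection `P`: it evaluates an operator on fibrewise linear sections and restricts the
result to the zero section. The result is an alternating map `Γ(N_ℓ*S)^k → Γ(ℓ)`; it belongs to
`Γ(∧^k N_ℓS ⊗ ℓ)` when the operator is first order in each entry. -/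
def restrictConormal (k : ℕ) : MultiOp (PullbackSections ES F N ℓ) k →ₗ[ℝ]
    (ConormalSections ES F N ℓ [⋀^Fin k]→ₗ[ℝ] Cₛ^∞⟮𝓘(ℝ, ES); ℝ, ℓ⟯) where
  toFun D := (restrictZero.compAlternatingMap D).compLinearMap linLift
  map_add' _ _ := by ext; simp
  map_smul' _ _ := by ext; simp

variable (ES F N ℓ) in
/-- `Γ(∧^• N_ℓS ⊗ ℓ)`. -/
abbrev FormSpace : Type _ := ⨁ k, NormalForms ES F N ℓ k

variable (ES F N ℓ) in
/-- The grading of `Γ(∧^• N_ℓS ⊗ ℓ)[1]`: elements of `Γ(∧^k N_ℓS ⊗ ℓ)` have degree `k - 1`. -/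
def formGrading (d : ℤ) : Submodule ℝ (FormSpace ES F N ℓ) :=
  ⨆ k : ℕ, ⨆ _ : (k : ℤ) - 1 = d,
    LinearMap.range (DirectSum.lof ℝ ℕ (fun k => NormalForms ES F N ℓ k) k)

/-- `I` on all degrees. -/
def totalLift : FormSpace ES F N ℓ →ₗ[ℝ] ⨁ k, MultiOp (PullbackSections ES F N ℓ) k :=
  DirectSum.lmap vertLift

/-- `evalForm` on all degrees; it is injective. -/
def totalEval : FormSpace ES F N ℓ →ₗ[ℝ]
    ⨁ k, (ConormalSections ES F N ℓ [⋀^Fin k]→ₗ[ℝ] Cₛ^∞⟮𝓘(ℝ, ES); ℝ, ℓ⟯) :=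
  DirectSum.lmap evalForm

/-- `P` on all degrees. -/
def totalRestrict : (⨁ k, MultiOp (PullbackSections ES F N ℓ) k) →ₗ[ℝ]
    ⨁ k, (ConormalSections ES F N ℓ [⋀^Fin k]→ₗ[ℝ] Cₛ^∞⟮𝓘(ℝ, ES); ℝ, ℓ⟯) :=
  DirectSum.lmap restrictConormal

/-- `[…[[J, I(ξ₁)], I(ξ₂)],…, I(ξ_k)]`. -/
def iteratedBracket (J : JacobiStructure (𝓘(ℝ, ES).prod 𝓘(ℝ, F)) ℝ (footPoint ES F N *ᵖ ℓ))
    {k : ℕ} (ξ : Fin k → FormSpace ES F N ℓ) : ⨁ k, MultiOp (PullbackSections ES F N ℓ) k :=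
  (List.ofFn ξ).foldl (fun D η => schoutenJacobi _ D (totalLift η))
    (DirectSum.lof ℝ ℕ (fun k => MultiOp (PullbackSections ES F N ℓ) k) 2 J.bracket)

variable (ES F N ℓ) in
/-- A Jacobi algebroid structure on `(N_ℓ*S, ℓ)`: a Lie algebroid structure on `N_ℓ*S = Hom(N, ℓ)`
together with a flat representation on the line bundle `ℓ`. -/
structure JacobiAlgebroid where
  bracket : MultiOp (ConormalSections ES F N ℓ) 2
  jacobi : ∀ φ ψ χ, bracket ![φ, bracket ![ψ, χ]] + bracket ![ψ, bracket ![χ, φ]] +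
    bracket ![χ, bracket ![φ, ψ]] = 0
  anchor : ConormalSections ES F N ℓ →ₗ[ℝ]
    Derivation ℝ C^∞⟮𝓘(ℝ, ES), S; ℝ⟯ C^∞⟮𝓘(ℝ, ES), S; ℝ⟯
  anchor_smul : ∀ f φ g, anchor (f • φ) g = f * anchor φ g
  anchor_bracket : ∀ φ ψ, anchor (bracket ![φ, ψ]) = ⁅anchor φ, anchor ψ⁆
  leibniz : ∀ φ (f : C^∞⟮𝓘(ℝ, ES), S; ℝ⟯) ψ,
    bracket ![φ, f • ψ] = f • bracket ![φ, ψ] + anchor φ f • ψ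
  conn : ConormalSections ES F N ℓ →ₗ[ℝ] Cₛ^∞⟮𝓘(ℝ, ES); ℝ, ℓ⟯ →ₗ[ℝ] Cₛ^∞⟮𝓘(ℝ, ES); ℝ, ℓ⟯
  conn_smul : ∀ (f : C^∞⟮𝓘(ℝ, ES), S; ℝ⟯) φ s, conn (f • φ) s = f • conn φ s
  conn_leibniz : ∀ φ (f : C^∞⟮𝓘(ℝ, ES), S; ℝ⟯) s,
    conn φ (f • s) = f • conn φ s + anchor φ f • s
  conn_flat : ∀ φ ψ s, conn (bracket ![φ, ψ]) s = conn φ (conn ψ s) - conn ψ (conn φ s)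

/-- The de Rham differential of `(N_ℓ*S, ℓ)`, given by the Koszul formula: the value of `d ξ` on
`φ₀,…,φ_k` is `∑ (-1)^a ∇_{φ_a} ξ(…,φ̂_a,…) + ∑_{a<b} (-1)^(a+b) ξ([φ_a,φ_b],…,φ̂_a,…,φ̂_b,…)`. -/
def JacobiAlgebroid.deRham (𝒜 : JacobiAlgebroid ES F N ℓ) : (k : ℕ) → NormalForms ES F N ℓ k →
    (Fin (k + 1) → ConormalSections ES F N ℓ) → Cₛ^∞⟮𝓘(ℝ, ES); ℝ, ℓ⟯
  | 0, ξ, φ => 𝒜.conn (φ 0) (evalForm 0 ξ ![])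
  | k + 1, ξ, φ =>
      ∑ a : Fin (k + 2), (-1 : ℝ) ^ (a : ℕ) •
        𝒜.conn (φ a) (evalForm (k + 1) ξ (φ ∘ a.succAbove)) +
      ∑ b : Fin (k + 2), ∑ a : Fin (k + 1), if a.castSucc < b then
        (-1 : ℝ) ^ ((a : ℕ) + (b : ℕ)) • evalForm (k + 1) ξ
          (Fin.cons (𝒜.bracket ![φ a.castSucc, φ b]) (φ ∘ b.succAbove ∘ a.succAbove))
        else 0

/-- The Jacobi algebroid structure `𝒜` on `(N_ℓ*S, ℓ)` is the restriction of the Jacobi algebroid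
`(J¹V, V)` of the Jacobi manifold `(X, V, J)`, which is determined by `ρ(j¹s) f • t = {s, f t} - f {s, t}`,
`∇_{j¹s} t = {s, t}` and `[j¹s, j¹t] = j¹{s, t}`. Here `j : S → X` is the inclusion, `res` restricts
sections to `S`, and `jet s φ` says that `s` vanishes along `S` and that `j¹s|_S`
is the section `φ` of `N_ℓ*S ⊆ J¹V|_S`. -/
structure JacobiAlgebroid.IsInducedBy (𝒜 : JacobiAlgebroid ES F N ℓ)
    {EX HX : Type*} [NormedAddCommGroup EX] [NormedSpace ℝ EX] [TopologicalSpace HX]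
    {IX : ModelWithCorners ℝ EX HX} {X : Type*} [TopologicalSpace X] [ChartedSpace HX X]
    {V : X → Type*} [∀ x, AddCommGroup (V x)] [∀ x, Module ℝ (V x)] [∀ x, TopologicalSpace (V x)]
    [TopologicalSpace (TotalSpace ℝ V)] [FiberBundle ℝ V] [VectorBundle ℝ ℝ V]
    (J : JacobiStructure IX ℝ V) (j : C^∞⟮𝓘(ℝ, ES), S; IX, X⟯)
    (res : Cₛ^∞⟮IX; ℝ, V⟯ → Cₛ^∞⟮𝓘(ℝ, ES); ℝ, ℓ⟯)
    (jet : Cₛ^∞⟮IX; ℝ, V⟯ → ConormalSections ES F N ℓ → Prop) : Prop where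
  anchor_eq : ∀ s φ, jet s φ → ∀ (f : C^∞⟮IX, X; ℝ⟯) (t : Cₛ^∞⟮IX; ℝ, V⟯),
    𝒜.anchor φ (f.comp j) • res t = res (J.bracket ![s, f • t] - f • J.bracket ![s, t])
  conn_eq : ∀ s φ, jet s φ → ∀ t, 𝒜.conn φ (res t) = res (J.bracket ![s, t])
  bracket_eq : ∀ s φ t ψ, jet s φ → jet t ψ → jet (J.bracket ![s, t]) (𝒜.bracket ![φ, ψ])

/-- The inclusion of `S` as the zero section of `N`. -/
def zeroSectionMap : C^∞⟮𝓘(ℝ, ES), S; 𝓘(ℝ, ES).prod 𝓘(ℝ, F), TotalSpace F N⟯ :=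
  ⟨zeroSection F N, contMDiff_zeroSection ℝ N⟩

/-- `s` vanishes along the zero section, with conormal derivative `φ`. -/
structure IsConormalJetAtZero (s : PullbackSections ES F N ℓ) (φ : ConormalSections ES F N ℓ) :
    Prop where
  vanish : ∀ x, s ⟨x, 0⟩ = 0
  deriv_eq : ∀ x, vertDeriv s ⟨x, 0⟩ = φ x

end NormalBundleTotalSpace

section Submanifold

variable {EM : Type*} [NormedAddCommGroup EM] [NormedSpace ℝ EM]
  {M : Type*} [TopologicalSpace M] [ChartedSpace EM M] [IsManifold 𝓘(ℝ, EM) ∞ M]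
  {L : M → Type*} [∀ x, AddCommGroup (L x)] [∀ x, Module ℝ (L x)] [∀ x, TopologicalSpace (L x)]
  [∀ x, IsTopologicalAddGroup (L x)] [∀ x, ContinuousSMul ℝ (L x)]
  [TopologicalSpace (TotalSpace ℝ L)] [FiberBundle ℝ L] [VectorBundle ℝ ℝ L]
  [ContMDiffVectorBundle ∞ ℝ L 𝓘(ℝ, EM)]
  {ES : Type*} [NormedAddCommGroup ES] [NormedSpace ℝ ES]
  {S : Type*} [TopologicalSpace S] [ChartedSpace ES S] [IsManifold 𝓘(ℝ, ES) ∞ S]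
  {F : Type*} [NormedAddCommGroup F] [NormedSpace ℝ F]
  {N : S → Type*} [∀ x, AddCommGroup (N x)] [∀ x, Module ℝ (N x)] [∀ x, TopologicalSpace (N x)]
  [∀ x, IsTopologicalAddGroup (N x)] [∀ x, ContinuousSMul ℝ (N x)]
  [TopologicalSpace (TotalSpace F N)] [FiberBundle F N] [VectorBundle ℝ F N]
  [ContMDiffVectorBundle ∞ F N 𝓘(ℝ, ES)]

/-- Restriction to the submanifold of a section of `L`. -/
def restrictSection (i : C^∞⟮𝓘(ℝ, ES), S; 𝓘(ℝ, EM), M⟯) (s : Cₛ^∞⟮𝓘(ℝ, EM); ℝ, L⟯) :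
    Cₛ^∞⟮𝓘(ℝ, ES); ℝ, (i *ᵖ L)⟯ :=
  pullbackSection i (fun x => s (i x)) (s.contMDiff.comp i.contMDiff)

/-- The derivative at `x` of a section of `L`, in a local trivialization. It is only used for
sections which vanish at `x`, and then it does not depend on the trivialization. -/
def sectionDeriv (s : Cₛ^∞⟮𝓘(ℝ, EM); ℝ, L⟯) (x : M) : TangentSpace 𝓘(ℝ, EM) x →L[ℝ] L x :=
  (trivializationAt ℝ L x).symmL ℝ x ∘L
    mfderiv 𝓘(ℝ, EM) 𝓘(ℝ, ℝ) (fun y => (trivializationAt ℝ L x ⟨y, s y⟩).2) x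

/-- `S` is coisotropic: for each `x ∈ S` the subspace `(T_xS)⁰ ⊗ L_x` of `T_x*M ⊗ L_x` is isotropic
for the bi-symbol of `J`, whose value on the derivatives at `x` of two sections `s, t` vanishing
at `x` is `{s, t}(x)`. -/
def JacobiStructure.IsCoisotropic (J : JacobiStructure 𝓘(ℝ, EM) ℝ L)
    (i : C^∞⟮𝓘(ℝ, ES), S; 𝓘(ℝ, EM), M⟯) : Prop :=
  ∀ (x : S) (s t : Cₛ^∞⟮𝓘(ℝ, EM); ℝ, L⟯), s (i x) = 0 → t (i x) = 0 →
    (∀ v, sectionDeriv s (i x) (mfderiv 𝓘(ℝ, ES) 𝓘(ℝ, EM) i x v) = 0) →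
    (∀ v, sectionDeriv t (i x) (mfderiv 𝓘(ℝ, ES) 𝓘(ℝ, EM) i x v) = 0) →
    J.bracket ![s, t] (i x) = 0

variable (F N) in
/-- The vector bundle `N` is the normal bundle `TM|_S / TS`: a smooth surjective bundle map
`TM|_S → N` with kernel `TS`. -/
structure NormalBundle (i : C^∞⟮𝓘(ℝ, ES), S; 𝓘(ℝ, EM), M⟯) where
  quot : Cₛ^∞⟮𝓘(ℝ, ES); EM →L[ℝ] F,
    fun x => (i *ᵖ (TangentSpace 𝓘(ℝ, EM) : M → Type _)) x →L[ℝ] N x⟯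
  surjective : ∀ x, Function.Surjective (quot x)
  ker_eq : ∀ (x : S) (v : TangentSpace 𝓘(ℝ, EM) (i x)),
    quot x v = 0 ↔ ∃ u, mfderiv 𝓘(ℝ, ES) 𝓘(ℝ, EM) i x u = v

/-- `s` vanishes along `S`, with conormal derivative `φ`. -/
structure IsConormalJet {i : C^∞⟮𝓘(ℝ, ES), S; 𝓘(ℝ, EM), M⟯} (ν : NormalBundle F N i)
    (s : Cₛ^∞⟮𝓘(ℝ, EM); ℝ, L⟯) (φ : ConormalSections ES F N (i *ᵖ L)) : Prop where
  vanish : ∀ x, s (i x) = 0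
  deriv_eq : ∀ (x : S) (v : TangentSpace 𝓘(ℝ, EM) (i x)),
    φ x (ν.quot x v) = sectionDeriv s (i x) v

variable (L F N) in
/-- A fat tubular neighbourhood: an embedding `base : NS → M` which is the inclusion on the zero
section, and a smooth map of line bundles `L_NS = π*ℓ → L` over it, isomorphic on fibres, which is
the canonical map `ℓ → L` on the zero section. -/
structure FatTubularNeighborhood (i : C^∞⟮𝓘(ℝ, ES), S; 𝓘(ℝ, EM), M⟯) where
  base : C^∞⟮𝓘(ℝ, ES).prod 𝓘(ℝ, F), TotalSpace F N; 𝓘(ℝ, EM), M⟯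
  isSmoothEmbedding : IsSmoothEmbedding (𝓘(ℝ, ES).prod 𝓘(ℝ, F)) 𝓘(ℝ, EM) ∞ base
  base_zero : ∀ x : S, base ⟨x, 0⟩ = i x
  fib : ∀ p : TotalSpace F N, (footPoint ES F N *ᵖ (i *ᵖ L)) p ≃ₗ[ℝ] L (base p)
  contMDiff_total : ContMDiff ((𝓘(ℝ, ES).prod 𝓘(ℝ, F)).prod 𝓘(ℝ, ℝ)) (𝓘(ℝ, EM).prod 𝓘(ℝ, ℝ)) ∞
    fun v : TotalSpace ℝ (footPoint ES F N *ᵖ (i *ᵖ L)) =>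
      (⟨base v.1, fib v.1 v.2⟩ : TotalSpace ℝ L)
  fib_zero : ∀ (x : S) (v : L (i x)),
    (⟨base ⟨x, 0⟩, fib ⟨x, 0⟩ v⟩ : TotalSpace ℝ L) = ⟨i x, v⟩

namespace FatTubularNeighborhood

variable {i : C^∞⟮𝓘(ℝ, ES), S; 𝓘(ℝ, EM), M⟯} (τ : FatTubularNeighborhood L F N i)

/-- `s'` is the pullback of `s` along the fat tubular neighbourhood. -/
def Related (s : Cₛ^∞⟮𝓘(ℝ, EM); ℝ, L⟯) (s' : PullbackSections ES F N (i *ᵖ L)) : Prop :=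
  ∀ p, τ.fib p (s' p) = s (τ.base p)

/-- `J'` is the Jacobi structure induced by `J` on `L_NS`, that is, `NS → M` with the map
`L_NS → L` is a Jacobi map. -/
def IsPullback (J : JacobiStructure 𝓘(ℝ, EM) ℝ L)
    (J' : JacobiStructure (𝓘(ℝ, ES).prod 𝓘(ℝ, F)) ℝ (footPoint ES F N *ᵖ (i *ᵖ L))) : Prop :=
  ∀ s s' t t', τ.Related s s' → τ.Related t t' →
    τ.Related (J.bracket ![s, t]) (J'.bracket ![s', t'])

/-- The normal component of the derivative of `base` along the zero section is the identity of
`N`. -/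
def IsNormalized (ν : NormalBundle F N i) : Prop :=
  ∀ (x : S) (w : N x),
    ν.quot x (mfderiv 𝓘(ℝ, ℝ) 𝓘(ℝ, EM) (fun t : ℝ => τ.base ⟨x, t • w⟩) 0 (1 : ℝ)) = w

end FatTubularNeighborhood

end Submanifold
end JacobiGeometry

end

open JacobiGeometry

noncomputable section

namespace JacobiGeometry

/-! ### Composition of alternating operators and evaluation of the first entry. -/

section Contraction

variable {G : Type*} [AddCommGroup G] [Module ℝ G]

/-! The `L_∞`-structure is an instance of Voronov's derived brackets, for the graded Lie algebra of
multi-differential operators on `π*ℓ` and the vertical lifts `I(ξ)`. Suppose that the lifts commute,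
that `[J, J] = 0` and `P J = 0`, and that `P[X, Y] = P[I P X, Y] + P[X, I P Y]`. Then the iterated
Leibniz rule (`nestedBracket_leibniz`) expands `P` of the nested bracket of `[J, J]` into twice the
sum in the higher Jacobi identity (`derivedBracket_jacobi`). The work consists in verifying these
hypotheses.

The graded Jacobi identity of the Schouten-Jacobi bracket is pure algebra and holds for all
alternating operators on a vector space. It is proved without comparing unshuffles: an operator is
zero as soon as its component without entries and all its contractions vanish, and contraction with
a vector is a derivation of the composition (`contract_comp_opOf`). Induction on the total number of
entries then gives the graded pre-Lie identity (`associator_swap`), hence `schoutenJacobi_leibniz`.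
The same induction shows that operators which are first order in each entry are closed under the
bracket (`schoutenJacobi_mem_unaryIn`). The analytic input is that commutators of first order
operators on a line bundle are first order, because their symbols are scalar derivations
(`IsFirstOrder.exists_symbol`).

The remaining hypotheses are statements about one-jets. By Hadamard's lemma a first order operator
sees at a point only the one-jet of a section. Along the zero section a section may therefore be
replaced by the pullback of its restriction plus the linear section of its vertical derivative
(`IsFirstOrder.restrictZero_apply`). Applied to the value of the inner operator in a composition,
this splitting is exactly the projection identity (`restrictConormal_insertOp`). At an arbitrary
point of the total space every one-jet is that of a fibrewise affine section
(`IsFirstOrder.apply_eq_zero_of_affine`). On affine sections `I(η)` produces sections which are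
constant along the fibres, and `I(ξ)` kills these; so the lifts commute. Coisotropy says that
brackets of sections vanishing on `S` vanish on `S`, which gives `P J = 0`.

The structure on `NS` exists because `τ₀` is an immersion into a manifold of no larger dimension,
hence a local diffeomorphism, and because brackets of first order are local: entries are transported
to `M` near each point and bracketed there (`LineBundleLocalIso.pullJacobi`).

For the algebroid, the bracket with a section `s` that vanishes on the zero section depends, after
restriction, only on `d^v s|_S` (`restrictZero_ad`, `conormalPart_ad`). The algebroid identities are
then the Jacobi identity and the Leibniz rule for linear sections, restricted to `S`, and `[J,
I(ξ)]` evaluated on linear sections is the Koszul formula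
(`restrictConormal_schoutenJacobi_eq_deRham`). When the tubular neighbourhood is normalized,
conormal derivatives on `NS` and on `M` correspond to each other
(`FatTubularNeighborhood.IsNormalized.isConormalJetAtZero_iff`), so the same algebroid is induced by
`S ⊂ M`. -/

theorem sum_perm_succ {H : Type*} [AddCommGroup H] [Module ℝ H] {n : ℕ} (v₀ : G) (w : Fin n → G)
    (f : (Fin (n + 1) → G) → H) :
    ∑ σ : Equiv.Perm (Fin (n + 1)), Equiv.Perm.sign σ •
        f (fun i => Matrix.vecCons v₀ w (σ i)) =
      ∑ j : Fin (n + 1), (-1 : ℝ) ^ (j : ℕ) • ∑ τ : Equiv.Perm (Fin n),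
        Equiv.Perm.sign τ • f (j.insertNth v₀ fun i => w (τ i)) := by
  -- `g (j, τ)` sends `j` to `0` and acts by `τ` on the other indices, kept in order. Its sign is
  -- `(-1)^j sign τ`.
  let g : Fin (n + 1) × Equiv.Perm (Fin n) → Equiv.Perm (Fin (n + 1)) := fun q =>
    Equiv.Perm.decomposeFin.symm (0, q.2) * q.1.cycleRange
  have hg0 : ∀ q, g q q.1 = 0 := by
    intro q
    simp [g]
  have hinj : Function.Injective g := by
    intro q q' h
    have h1 : q.1 = q'.1 := (g q).injective (by rw [hg0, h, hg0])
    have h2 : Equiv.Perm.decomposeFin.symm ((0 : Fin (n + 1)), q.2) =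
        Equiv.Perm.decomposeFin.symm (0, q'.2) := by
      have h' := h
      simp only [g, h1] at h'
      exact mul_right_cancel h'
    have h3 := Equiv.Perm.decomposeFin.symm.injective h2
    exact Prod.ext h1 (Prod.ext_iff.1 h3).2
  have hbij : Function.Bijective g :=
    (Fintype.bijective_iff_injective_and_card g).2 ⟨hinj, by
      simp [Fintype.card_perm, Nat.factorial_succ]⟩
  rw [← (Equiv.ofBijective g hbij).sum_comp, Fintype.sum_prod_type]
  refine Finset.sum_congr rfl fun j _ => ?_
  rw [Finset.smul_sum]
  refine Finset.sum_congr rfl fun τ _ => ?_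
  have hv : (fun i => Matrix.vecCons v₀ w (g (j, τ) i)) = j.insertNth v₀ fun i => w (τ i) := by
    rw [← Fin.cons_comp_cycleRange]
    funext i
    simp only [g, Equiv.Perm.coe_mul, Function.comp_apply]
    refine Fin.cases ?_ (fun k => ?_) (j.cycleRange i)
    · simp
    · simp
  have hs : Equiv.Perm.sign (g (j, τ)) = (-1) ^ (j : ℕ) * Equiv.Perm.sign τ := by
    simp [g, mul_comm]
  simp only [Equiv.ofBijective_apply, hv, hs, mul_smul]
  rcases neg_one_pow_eq_or ℝ (j : ℕ) with h | h <;> rcases neg_one_pow_eq_or ℤˣ (j : ℕ) with h' | h'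
  · simp [h, h']
  · exact absurd (h.symm.trans ((Odd.neg_one_pow (by
      by_contra hh; rw [Nat.not_odd_iff_even] at hh; rw [hh.neg_one_pow] at h'
      exact absurd h' (by decide))) )) (by norm_num)
  · exact absurd (h.symm.trans ((Even.neg_one_pow (by
      by_contra hh; rw [Nat.not_even_iff_odd] at hh; rw [hh.neg_one_pow] at h'
      exact absurd h' (by decide))) )) (by norm_num)
  · simp [h, h']

/-- `insertOp` with a free number of entries for the result. -/
def insertAt {a b n : ℕ} (h : b + a = n) (D : MultiOp G (a + 1)) (D' : MultiOp G b) :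
    MultiOp G n :=
  (insertOp D D').domDomCongr (finCongr h)

theorem insertAt_apply {a b n : ℕ} (h : b + a = n) (D : MultiOp G (a + 1)) (D' : MultiOp G b)
    (v : Fin n → G) :
    insertAt h D D' v = ((b.factorial : ℝ) * (a.factorial : ℝ))⁻¹ •
      ∑ σ : Equiv.Perm (Fin n), Equiv.Perm.sign σ •
        D (Matrix.vecCons (D' fun j => v (σ ⟨j, by omega⟩))
          fun j => v (σ ⟨b + j, by omega⟩)) := by
  subst h
  exact insertOp_apply D D' v

theorem lof_insertAt {a b n : ℕ} (h : b + a = n) (D : MultiOp G (a + 1)) (D' : MultiOp G b) :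
    DirectSum.lof ℝ ℕ (fun n => MultiOp G n) n (insertAt h D D') = insertLin G (a + 1) b D D' := by
  subst h
  rfl

/-- This and the next three lemmas locate a vector inserted at position `j`: it falls either among
the first entries, which the inner operator reads, or among the last ones, which the outer operator
reads. -/
theorem insertNth_initial {b n : ℕ} (h : b ≤ n) (j : Fin (b + 1)) (x : G) (u : Fin n → G) :
    (fun i : Fin (b + 1) => (Fin.insertNth (α := fun _ => G) (⟨j, by omega⟩ : Fin (n + 1)) x u)
      ⟨i, by omega⟩) =
    j.insertNth x fun i : Fin b => u ⟨i, by omega⟩ := by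
  funext i
  rcases Fin.eq_self_or_eq_succAbove j i with rfl | ⟨k, rfl⟩
  · rw [Fin.insertNth_apply_same, Fin.insertNth_apply_same]
  · rw [Fin.insertNth_apply_succAbove]
    have : (⟨(j.succAbove k : ℕ), by omega⟩ : Fin (n + 1)) =
        (⟨j, by omega⟩ : Fin (n + 1)).succAbove ⟨k, by omega⟩ := by
      ext
      simp only [Fin.succAbove, Fin.lt_def, Fin.val_castSucc]
      split_ifs <;> simp
    rw [this, Fin.insertNth_apply_succAbove]

theorem insertNth_initial_of_le {b n : ℕ} (h : b ≤ n) (j : ℕ) (hb : b ≤ j) (hj : j < n + 1) (x : G)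
    (u : Fin n → G) (i : ℕ) (hi : i < b) :
    (Fin.insertNth (α := fun _ => G) (⟨j, hj⟩ : Fin (n + 1)) x u) ⟨i, by omega⟩ =
      u ⟨i, by omega⟩ := by
  have : (⟨i, by omega⟩ : Fin (n + 1)) = (⟨j, hj⟩ : Fin (n + 1)).succAbove ⟨i, by omega⟩ := by
    ext
    simp only [Fin.succAbove, Fin.lt_def, Fin.val_castSucc]
    split_ifs <;> simp <;> omega
  rw [this, Fin.insertNth_apply_succAbove]

theorem insertNth_final {a b n : ℕ} (h : b + a = n) (j : Fin (a + 1)) (x : G) (u : Fin n → G) :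
    (fun i : Fin (a + 1) => (Fin.insertNth (α := fun _ => G) (⟨b + j, by omega⟩ : Fin (n + 1)) x u)
      ⟨b + i, by omega⟩) =
    j.insertNth x fun i : Fin a => u ⟨b + i, by omega⟩ := by
  funext i
  rcases Fin.eq_self_or_eq_succAbove j i with rfl | ⟨k, rfl⟩
  · rw [Fin.insertNth_apply_same, Fin.insertNth_apply_same]
  · rw [Fin.insertNth_apply_succAbove]
    have : (⟨b + (j.succAbove k : ℕ), by omega⟩ : Fin (n + 1)) =
        (⟨b + j, by omega⟩ : Fin (n + 1)).succAbove ⟨b + k, by omega⟩ := by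
      ext
      simp only [Fin.succAbove, Fin.lt_def, Fin.val_castSucc]
      split_ifs <;> simp <;> omega
    rw [this, Fin.insertNth_apply_succAbove]

theorem insertNth_final_of_lt {a b n : ℕ} (h : b + a = n + 1) (j : ℕ) (hb : j < b) (x : G)
    (u : Fin n → G) (i : ℕ) (hi : i < a) :
    (Fin.insertNth (α := fun _ => G) (⟨j, by omega⟩ : Fin (n + 1)) x u) ⟨b + i, by omega⟩ =
      u ⟨b + i - 1, by omega⟩ := by
  have : (⟨b + i, by omega⟩ : Fin (n + 1)) =
      (⟨j, by omega⟩ : Fin (n + 1)).succAbove ⟨b + i - 1, by omega⟩ := by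
    ext
    simp only [Fin.succAbove, Fin.lt_def, Fin.val_castSucc]
    split_ifs <;> simp <;> omega
  rw [this, Fin.insertNth_apply_succAbove]

/-- The contribution to a Gerstenhaber composition of the permutations which put the first entry
into the inner operator. -/
theorem insert_inner_term {a b n : ℕ} (h : b + a = n) (D : MultiOp G (a + 1))
    (D' : MultiOp G (b + 1)) (v₀ : G) (u : Fin n → G) (j : Fin (b + 1)) :
    (-1 : ℝ) ^ (j : ℕ) • D (Matrix.vecCons
        (D' fun i : Fin (b + 1) =>
          (Fin.insertNth (α := fun _ => G) (⟨j, by omega⟩ : Fin (n + 1)) v₀ u) ⟨i, by omega⟩)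
        fun i : Fin a => (Fin.insertNth (α := fun _ => G) (⟨j, by omega⟩ : Fin (n + 1)) v₀ u)
          ⟨b + 1 + i, by omega⟩) =
      D (Matrix.vecCons (D'.curryLeft v₀ fun i => u ⟨i, by omega⟩) fun i => u ⟨b + i, by omega⟩) := by
  rw [insertNth_initial (by omega)]
  have h2 : (fun i : Fin a => (Fin.insertNth (α := fun _ => G) (⟨j, by omega⟩ : Fin (n + 1)) v₀ u)
      ⟨b + 1 + i, by omega⟩) = fun i : Fin a => u ⟨b + i, by omega⟩ := by
    funext i
    rw [insertNth_final_of_lt (by omega) j j.2 v₀ u i i.2]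
    congr 2; omega
  rw [h2, AlternatingMap.map_insertNth]
  rw [← D.curryLeft_apply_apply, ← D.curryLeft_apply_apply]
  rcases neg_one_pow_eq_or ℝ (j : ℕ) with h' | h'
  · have := (neg_one_pow_eq_one_iff_even (R := ℝ) (by norm_num)).1 h'
    simp [this.neg_one_pow]
  · have := (neg_one_pow_eq_neg_one_iff_odd (R := ℝ) (by norm_num)).1 h'
    simp [this.neg_one_pow]

/-- The contribution to a Gerstenhaber composition of the permutations which put the first entry
into the outer operator. -/
theorem insert_outer_term {a b n : ℕ} (h : b + a = n) (D : MultiOp G (a + 2))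
    (D' : MultiOp G b) (v₀ : G) (u : Fin n → G) (j : Fin (a + 1)) :
    (-1 : ℝ) ^ (b + j : ℕ) • D (Matrix.vecCons
        (D' fun i : Fin b =>
          (Fin.insertNth (α := fun _ => G) (⟨b + j, by omega⟩ : Fin (n + 1)) v₀ u) ⟨i, by omega⟩)
        fun i : Fin (a + 1) => (Fin.insertNth (α := fun _ => G) (⟨b + j, by omega⟩ : Fin (n + 1)) v₀ u)
          ⟨b + i, by omega⟩) =
      (-1 : ℝ) ^ (b + 1) • D.curryLeft v₀
        (Matrix.vecCons (D' fun i => u ⟨i, by omega⟩) fun i => u ⟨b + i, by omega⟩) := by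
  rw [insertNth_final h]
  have h2 : (fun i : Fin b => (Fin.insertNth (α := fun _ => G) (⟨b + j, by omega⟩ : Fin (n + 1)) v₀ u)
      ⟨i, by omega⟩) = fun i : Fin b => u ⟨i, by omega⟩ := by
    funext i
    exact insertNth_initial_of_le (by omega) _ (by omega) _ _ _ _ i.2
  rw [h2]
  set X := D' fun i => u ⟨i, by omega⟩
  rw [← D.curryLeft_apply_apply, AlternatingMap.map_insertNth]
  -- Besides the other outer entries, `v₀` has to pass the slot of the inner value; this turns
  -- `(-1)^b` into `(-1)^(b + 1)`.
  have h3 : D.curryLeft X (Matrix.vecCons v₀ fun i => u ⟨b + i, by omega⟩) =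
      - D.curryLeft v₀ (Matrix.vecCons X fun i => u ⟨b + i, by omega⟩) := by
    rw [D.curryLeft_apply_apply, D.curryLeft_apply_apply]
    have := D.map_swap (Matrix.vecCons X (Matrix.vecCons v₀ fun i => u ⟨b + i, by omega⟩))
      (i := 0) (j := 1) (by simp)
    rw [← neg_eq_iff_eq_neg, ← this]
    congr 1
    funext i
    refine Fin.cases ?_ (fun i => Fin.cases ?_ (fun i => ?_) i) i
    · simp
    · simp
    · have : Equiv.swap (0 : Fin (a + 2)) 1 i.succ.succ = i.succ.succ :=
        Equiv.swap_apply_of_ne_of_ne (by simp [Fin.ext_iff]) (by simp [Fin.ext_iff])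
      simp [this]
  rw [h3, pow_add, pow_succ]
  rcases neg_one_pow_eq_or ℝ (j : ℕ) with h' | h'
  · have := (neg_one_pow_eq_one_iff_even (R := ℝ) (by norm_num)).1 h'
    simp [this.neg_one_pow]
  · have := (neg_one_pow_eq_neg_one_iff_odd (R := ℝ) (by norm_num)).1 h'
    simp [this.neg_one_pow]

/-- In the sum over permutations the first entry has an inner or an outer position. All `b + 1`
inner positions contribute equally, and so do all `a + 1` outer ones; these multiplicities cancel
against the factorials of the normalization. -/
theorem curryLeft_insertAt {a b n : ℕ} (h : (b + 1) + (a + 1) = n + 1) (D : MultiOp G (a + 2))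
    (D' : MultiOp G (b + 1)) (v : G) :
    (insertAt h D D').curryLeft v =
      insertAt (by omega) D (D'.curryLeft v) +
        (-1 : ℝ) ^ b • insertAt (by omega) (D.curryLeft v) D' := by
  ext u
  simp only [AlternatingMap.curryLeft_apply_apply, AlternatingMap.add_apply,
    AlternatingMap.smul_apply, insertAt_apply]
  rw [sum_perm_succ v u fun w => D (Matrix.vecCons (D' fun j : Fin (b + 1) => w ⟨j, by omega⟩)
          fun j : Fin (a + 1) => w ⟨b + 1 + j, by omega⟩)]
  have e : n + 1 = (b + 1) + (a + 1) := by omega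
  rw [← (finCongr e).symm.sum_comp, Fin.sum_univ_add, smul_add]
  congr 1
  · have : ∀ j : Fin (b + 1), (-1 : ℝ) ^ (((finCongr e).symm (Fin.castAdd (a + 1) j) : Fin (n + 1)) : ℕ) •
        ∑ τ : Equiv.Perm (Fin n), Equiv.Perm.sign τ • D (Matrix.vecCons (D' fun i : Fin (b + 1) =>
          (Fin.insertNth (α := fun _ => G) ((finCongr e).symm (Fin.castAdd (a + 1) j)) v
            fun i => u (τ i)) ⟨i, by omega⟩)
          fun i : Fin (a + 1) => (Fin.insertNth (α := fun _ => G)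
            ((finCongr e).symm (Fin.castAdd (a + 1) j)) v fun i => u (τ i)) ⟨b + 1 + i, by omega⟩) =
        ∑ τ : Equiv.Perm (Fin n), Equiv.Perm.sign τ • D (Matrix.vecCons
          (D'.curryLeft v fun i => u (τ ⟨i, by omega⟩)) fun i => u (τ ⟨b + i, by omega⟩)) := by
      intro j
      rw [Finset.smul_sum]
      refine Finset.sum_congr rfl fun τ _ => ?_
      rw [smul_comm]
      congr 1
      exact insert_inner_term (n := n) (by omega) D D' v (fun i => u (τ i)) j
    rw [Finset.sum_congr rfl fun j _ => this j]
    rw [Finset.sum_const, Finset.card_univ, Fintype.card_fin, ← Nat.cast_smul_eq_nsmul ℝ, smul_smul]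
    congr 1
    rw [Nat.factorial_succ]
    have h1 : ((b.factorial : ℕ) : ℝ) ≠ 0 := by positivity
    have h2 : (((a + 1).factorial : ℕ) : ℝ) ≠ 0 := by positivity
    push_cast
    field_simp
  · have : ∀ j : Fin (a + 1), (-1 : ℝ) ^ (((finCongr e).symm (Fin.natAdd (b + 1) j) : Fin (n + 1)) : ℕ) •
        ∑ τ : Equiv.Perm (Fin n), Equiv.Perm.sign τ • D (Matrix.vecCons (D' fun i : Fin (b + 1) =>
          (Fin.insertNth (α := fun _ => G) ((finCongr e).symm (Fin.natAdd (b + 1) j)) v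
            fun i => u (τ i)) ⟨i, by omega⟩)
          fun i : Fin (a + 1) => (Fin.insertNth (α := fun _ => G)
            ((finCongr e).symm (Fin.natAdd (b + 1) j)) v fun i => u (τ i)) ⟨b + 1 + i, by omega⟩) =
        (-1 : ℝ) ^ b • ∑ τ : Equiv.Perm (Fin n), Equiv.Perm.sign τ • D.curryLeft v (Matrix.vecCons
          (D' fun i => u (τ ⟨i, by omega⟩)) fun i => u (τ ⟨b + 1 + i, by omega⟩)) := by
      intro j
      rw [Finset.smul_sum, Finset.smul_sum]
      refine Finset.sum_congr rfl fun τ _ => ?_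
      rw [smul_comm, smul_comm ((-1 : ℝ) ^ b)]
      congr 1
      have := insert_outer_term (n := n) (by omega) D D' v (fun i => u (τ i)) j
      rw [pow_succ, pow_succ, mul_assoc, neg_one_mul, neg_neg, mul_one] at this
      exact this
    rw [Finset.sum_congr rfl fun j _ => this j]
    rw [Finset.sum_const, Finset.card_univ, Fintype.card_fin, ← Nat.cast_smul_eq_nsmul ℝ, smul_smul,
      smul_smul, smul_smul]
    congr 1
    rw [Nat.factorial_succ a]
    have h1 : ((a.factorial : ℕ) : ℝ) ≠ 0 := by positivity
    have h2 : (((b + 1).factorial : ℕ) : ℝ) ≠ 0 := by positivity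
    push_cast
    field_simp

/-- A unary outer operator has no slot left for the first entry, so the second term of the
derivation rule is absent. -/
theorem curryLeft_insertAt_unary {b n : ℕ} (h : (b + 1) + 0 = n + 1) (D : MultiOp G 1)
    (D' : MultiOp G (b + 1)) (v : G) :
    (insertAt h D D').curryLeft v = insertAt (by omega) D (D'.curryLeft v) := by
  ext u
  simp only [AlternatingMap.curryLeft_apply_apply, insertAt_apply]
  rw [sum_perm_succ v u fun w => D (Matrix.vecCons (D' fun j : Fin (b + 1) => w ⟨j, by omega⟩)
          fun j : Fin 0 => w ⟨b + 1 + j, by omega⟩)]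
  have e : n = b := by omega
  subst e
  have : ∀ j : Fin (n + 1), (-1 : ℝ) ^ (j : ℕ) •
        ∑ τ : Equiv.Perm (Fin n), Equiv.Perm.sign τ • D (Matrix.vecCons (D' fun i : Fin (n + 1) =>
          (Fin.insertNth (α := fun _ => G) j v fun i => u (τ i)) ⟨i, by omega⟩)
          fun i : Fin 0 => (Fin.insertNth (α := fun _ => G) j v fun i => u (τ i))
            ⟨n + 1 + i, by omega⟩) =
        ∑ τ : Equiv.Perm (Fin n), Equiv.Perm.sign τ • D (Matrix.vecCons
          (D'.curryLeft v fun i => u (τ ⟨i, by omega⟩)) fun i => u (τ ⟨n + i, by omega⟩)) := by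
    intro j
    rw [Finset.smul_sum]
    refine Finset.sum_congr rfl fun τ _ => ?_
    rw [smul_comm]
    congr 1
    exact insert_inner_term (n := n) (by omega) D D' v (fun i => u (τ i)) j
  rw [Finset.sum_congr rfl fun j _ => this j]
  rw [Finset.sum_const, Finset.card_univ, Fintype.card_fin, ← Nat.cast_smul_eq_nsmul ℝ, smul_smul]
  congr 1
  rw [Nat.factorial_succ]
  have h1 : ((n.factorial : ℕ) : ℝ) ≠ 0 := by positivity
  push_cast
  field_simp

/-- An inner operator without entries is a vector, and inserting it is contraction; the `a!`
permutations contribute equally. -/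
theorem insertAt_nullary {a n : ℕ} (h : 0 + a = n) (D : MultiOp G (a + 1)) (D' : MultiOp G 0) :
    insertAt h D D' = (D.curryLeft (D' ![])).domDomCongr (finCongr (by omega)) := by
  have e : a = n := by omega
  subst e
  ext u
  rw [insertAt_apply]
  have : ∀ σ : Equiv.Perm (Fin a), Equiv.Perm.sign σ • D (Matrix.vecCons
        (D' fun j : Fin 0 => u (σ ⟨j, by omega⟩)) fun j => u (σ ⟨0 + j, by omega⟩)) =
      D.curryLeft (D' ![]) u := by
    intro σ
    rw [← D.curryLeft_apply_apply]
    have h1 : (fun j : Fin a => u (σ ⟨0 + (j : ℕ), by omega⟩)) = u ∘ σ := by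
      funext j
      simp
    rw [h1, AlternatingMap.map_perm, smul_smul, Int.units_mul_self, one_smul]
    rw [Subsingleton.elim (fun j : Fin 0 => u (σ ⟨j, by omega⟩)) ![]]
  rw [Finset.sum_congr rfl fun σ _ => this σ, Finset.sum_const, Finset.card_univ,
    Fintype.card_perm, Fintype.card_fin, ← Nat.cast_smul_eq_nsmul ℝ, smul_smul]
  have h1 : ((a.factorial : ℕ) : ℝ) ≠ 0 := by positivity
  rw [Nat.factorial_zero, Nat.cast_one, one_mul, inv_mul_cancel₀ h1, one_smul]
  rfl

theorem curryLeft_curryLeft_comm {n : ℕ} (D : MultiOp G (n + 2)) (v w : G) :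
    (D.curryLeft v).curryLeft w = - (D.curryLeft w).curryLeft v := by
  ext u
  simp only [AlternatingMap.neg_apply, AlternatingMap.curryLeft_apply_apply]
  have := D.map_swap (Matrix.vecCons w (Matrix.vecCons v u)) (i := 0) (j := 1) (by simp)
  rw [← this]
  congr 1
  funext i
  refine Fin.cases ?_ (fun i => Fin.cases ?_ (fun i => ?_) i) i
  · simp
  · simp
  · have : Equiv.swap (0 : Fin (n + 2)) 1 i.succ.succ = i.succ.succ :=
      Equiv.swap_apply_of_ne_of_ne (by simp [Fin.ext_iff]) (by simp [Fin.ext_iff])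
    simp [this]

end Contraction

/-! ### The graded pre-Lie identity of the Gerstenhaber composition. -/

section GerstenhaberAlgebra

variable (G : Type*) [AddCommGroup G] [Module ℝ G]

/-- All alternating operators. -/
abbrev MultiOps : Type _ := ⨁ n, MultiOp G n

variable {G}

/-- An operator with `n` entries as an element of the direct sum. -/
abbrev opOf (n : ℕ) : MultiOp G n →ₗ[ℝ] MultiOps G :=
  DirectSum.lof ℝ ℕ (fun n => MultiOp G n) n

/-- The Gerstenhaber composition on the direct sum. -/
def comp : MultiOps G →ₗ[ℝ] MultiOps G →ₗ[ℝ] MultiOps G :=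
  DirectSum.toModule ℝ ℕ _ fun a =>
    (DirectSum.toModule ℝ ℕ _ fun b => (insertLin G a b).flip).flip

theorem comp_opOf (a b : ℕ) (D : MultiOp G a) (D' : MultiOp G b) :
    comp (opOf a D) (opOf b D') = insertLin G a b D D' := by
  simp [comp, DirectSum.toModule_lof]

theorem comp_opOf_insertAt {a b n : ℕ} (h : b + a = n) (D : MultiOp G (a + 1)) (D' : MultiOp G b) :
    comp (opOf (a + 1) D) (opOf b D') = opOf n (insertAt h D D') := by
  rw [comp_opOf, lof_insertAt]

theorem comp_opOf_zero {b : ℕ} (D : MultiOp G 0) (D' : MultiOp G b) :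
    comp (opOf 0 D) (opOf b D') = 0 := by
  rw [comp_opOf]; rfl

/-- The contraction with `v`: it evaluates the first entry at `v`. -/
def contract (v : G) : MultiOps G →ₗ[ℝ] MultiOps G :=
  DirectSum.toModule ℝ ℕ _ fun
    | 0 => 0
    | n + 1 => opOf n ∘ₗ
        { toFun := fun D => D.curryLeft v
          map_add' := fun D D' => by ext; simp
          map_smul' := fun c D => by ext; simp }

theorem contract_opOf_succ (v : G) (n : ℕ) (D : MultiOp G (n + 1)) :
    contract v (opOf (n + 1) D) = opOf n (D.curryLeft v) := by
  simp [contract, DirectSum.toModule_lof]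

theorem contract_opOf_zero (v : G) (D : MultiOp G 0) : contract v (opOf 0 D) = 0 := by
  simp [contract, DirectSum.toModule_lof]

theorem opOf_domDomCongr {m n : ℕ} (h : m = n) (D : MultiOp G m) :
    opOf n (D.domDomCongr (finCongr h)) = opOf m D := by
  subst h
  rfl

theorem opOf_apply_same (n : ℕ) (D : MultiOp G n) : opOf n D n = D :=
  DirectSum.lof_apply ℝ n D

theorem opOf_apply_of_ne {m n : ℕ} (h : n ≠ m) (D : MultiOp G n) : opOf n D m = 0 :=
  DirectSum.of_eq_of_ne n m D h.symm

/-- Contraction is a derivation of the Gerstenhaber composition. -/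
theorem contract_comp_opOf (v : G) (a b : ℕ) (D : MultiOp G a) (D' : MultiOp G b) :
    contract v (comp (opOf a D) (opOf b D')) =
      comp (opOf a D) (contract v (opOf b D')) -
        (-1 : ℝ) ^ b • comp (contract v (opOf a D)) (opOf b D') := by
  rcases a with _ | a
  · rw [comp_opOf_zero, contract_opOf_zero, map_zero, map_zero, LinearMap.zero_apply, smul_zero,
      sub_zero]
    rcases b with _ | b
    · rw [contract_opOf_zero, map_zero]
    · rw [contract_opOf_succ, comp_opOf_zero]
  · rcases b with _ | b
    · rw [contract_opOf_zero, map_zero, zero_sub, pow_zero, one_smul, contract_opOf_succ,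
        comp_opOf_insertAt rfl, insertAt_nullary, opOf_domDomCongr]
      rcases a with _ | a
      · rw [contract_opOf_zero, comp_opOf_zero, neg_zero]
      -- Both sides are double contractions of `D`, and these anticommute.
      · rw [contract_opOf_succ, comp_opOf_insertAt rfl, insertAt_nullary, opOf_domDomCongr,
          curryLeft_curryLeft_comm, map_neg]
    · rw [contract_opOf_succ, contract_opOf_succ]
      rcases a with _ | a
      · rw [comp_opOf_zero, smul_zero, sub_zero, comp_opOf_insertAt (a := 0) (n := b + 1) rfl D D',
          comp_opOf_insertAt (a := 0) (n := b) rfl D, contract_opOf_succ, curryLeft_insertAt_unary]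
      · rw [comp_opOf_insertAt (n := b + a + 1 + 1) (by omega),
          comp_opOf_insertAt (n := b + a + 1) (by omega),
          comp_opOf_insertAt (n := b + a + 1) (by omega), contract_opOf_succ, curryLeft_insertAt,
          map_add, map_smul, pow_succ]
        module

theorem contract_apply (v : G) (X : MultiOps G) (n : ℕ) :
    contract v X n = (X (n + 1)).curryLeft v := by
  induction X using DirectSum.induction_on with
  | zero =>
    rw [map_zero, DirectSum.zero_apply, DirectSum.zero_apply, AlternatingMap.curryLeft_zero]
    rfl
  | of m D =>
    change (contract v (opOf m D)) n = (opOf m D (n + 1)).curryLeft v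
    rcases m with _ | m
    · rw [contract_opOf_zero, opOf_apply_of_ne (by omega), DirectSum.zero_apply,
        AlternatingMap.curryLeft_zero]
      rfl
    · rw [contract_opOf_succ]
      by_cases h : m = n
      · subst h
        rw [opOf_apply_same, opOf_apply_same]
      · rw [opOf_apply_of_ne h, opOf_apply_of_ne (by omega), AlternatingMap.curryLeft_zero]
        rfl
  | add X Y hX hY =>
    rw [map_add, DirectSum.add_apply, DirectSum.add_apply, hX, hY, AlternatingMap.curryLeft_add]
    rfl

/-- This permits induction on the number of entries: contractions lower it, and only the component
without entries has to be checked by hand. -/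
theorem eq_zero_of_contract {X : MultiOps G} (h0 : X 0 = 0) (h : ∀ v, contract v X = 0) :
    X = 0 := by
  refine DFinsupp.ext fun n => ?_
  rcases n with _ | n
  · exact h0
  · change X (n + 1) = 0
    ext u
    have h1 := contract_apply (u 0) X n
    rw [h, DirectSum.zero_apply] at h1
    have h2 := congrArg (fun D => D (Matrix.vecTail u)) h1
    simp only [AlternatingMap.curryLeft_apply_apply, AlternatingMap.zero_apply] at h2
    rw [AlternatingMap.zero_apply, h2]
    congr 1
    exact (Matrix.cons_head_tail u).symm

/-- The associator of the Gerstenhaber composition. -/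
def associator (X Y Z : MultiOps G) : MultiOps G :=
  comp (comp X Y) Z - comp X (comp Y Z)

/-- The hypothesis allows `a = 0`, where the composition is zero and every arity will do. -/
theorem comp_opOf_mem (a b n : ℕ) (h : b + a = n + 1) (D : MultiOp G a) (D' : MultiOp G b) :
    ∃ E : MultiOp G n, comp (opOf a D) (opOf b D') = opOf n E := by
  rcases a with _ | a
  · exact ⟨0, by rw [comp_opOf_zero, map_zero]⟩
  · exact ⟨_, comp_opOf_insertAt (by omega) D D'⟩

theorem comp_opOf_small {a b : ℕ} (h : b + a = 0) (D : MultiOp G a) (D' : MultiOp G b) :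
    comp (opOf a D) (opOf b D') = 0 := by
  obtain rfl : a = 0 := by omega
  exact comp_opOf_zero _ _

/-- The left composition is first written as a single operator, to which the derivation rule
applies; if neither factor has entries it is zero. -/
theorem contract_comp_comp (v : G) (a b c : ℕ) (D : MultiOp G a) (D' : MultiOp G b)
    (D'' : MultiOp G c) :
    contract v (comp (comp (opOf a D) (opOf b D')) (opOf c D'')) =
      comp (comp (opOf a D) (opOf b D')) (contract v (opOf c D'')) -
        (-1 : ℝ) ^ c • comp (contract v (comp (opOf a D) (opOf b D'))) (opOf c D'') := by
  rcases Nat.eq_zero_or_pos (b + a) with h | h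
  · rw [comp_opOf_small h]
    simp
  · obtain ⟨E, hE⟩ := comp_opOf_mem a b (b + a - 1) (by omega) D D'
    rw [hE, contract_comp_opOf]

/-- Both double compositions obey the derivation rule, and the terms with `v` in the same operator
combine into an associator. The inner composition `D' ∘ D''` has `b + c - 1` entries, which explains
the sign in `h`. -/
theorem contract_associator (v : G) (a b c : ℕ) (D : MultiOp G a) (D' : MultiOp G b)
    (D'' : MultiOp G c) :
    contract v (associator (opOf a D) (opOf b D') (opOf c D'')) =
      associator (opOf a D) (opOf b D') (contract v (opOf c D'')) -
        (-1 : ℝ) ^ c • associator (opOf a D) (contract v (opOf b D')) (opOf c D'') +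
        (-1 : ℝ) ^ (b + c) • associator (contract v (opOf a D)) (opOf b D') (opOf c D'') := by
  have h : contract v (comp (opOf a D) (comp (opOf b D') (opOf c D''))) =
      comp (opOf a D) (contract v (comp (opOf b D') (opOf c D''))) +
        (-1 : ℝ) ^ (b + c) • comp (contract v (opOf a D)) (comp (opOf b D') (opOf c D'')) := by
    rcases Nat.eq_zero_or_pos (c + b) with h | h
    · rw [comp_opOf_small h]
      simp
    · obtain ⟨E, hE⟩ := comp_opOf_mem b c (b + c - 1) (by omega) D' D''
      rw [hE, contract_comp_opOf]
      have : (-1 : ℝ) ^ (b + c) = - (-1 : ℝ) ^ (b + c - 1) := by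
        obtain ⟨m, hm⟩ : ∃ m, b + c = m + 1 := ⟨b + c - 1, by omega⟩
        rw [hm, Nat.add_sub_cancel, pow_succ]
        ring
      rw [this]
      module
  unfold associator
  rw [map_sub, contract_comp_comp, h, contract_comp_opOf, contract_comp_opOf]
  simp only [map_sub, map_smul, LinearMap.sub_apply, LinearMap.smul_apply, pow_add]
  module

/-- A result without entries can only come from a unary outer operator and an inner one without
entries. -/
theorem comp_apply_zero (X Y : MultiOps G) : comp X Y 0 ![] = X 1 ![Y 0 ![]] := by
  induction X using DirectSum.induction_on with
  | zero => simp
  | add X X' hX hX' => simp [hX, hX']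
  | of a D =>
    induction Y using DirectSum.induction_on with
    | zero =>
      rw [map_zero, DirectSum.zero_apply, AlternatingMap.zero_apply]
      exact (AlternatingMap.map_coord_zero _ (0 : Fin 1) (by simp)).symm
    | add Y Y' hY hY' =>
      rw [map_add, DirectSum.add_apply, AlternatingMap.add_apply, hY, hY', DirectSum.add_apply,
        AlternatingMap.add_apply]
      have h := ((DirectSum.of (fun n => MultiOp G n) a D) 1).map_vecCons_add ![] (Y 0 ![]) (Y' 0 ![])
      exact h.symm
    | of b D' =>
      change comp (opOf a D) (opOf b D') 0 ![] = opOf a D 1 ![opOf b D' 0 ![]]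
      rcases a with _ | a
      · rw [comp_opOf_zero, opOf_apply_of_ne (by omega)]
        simp
      rcases b with _ | b
      · rw [comp_opOf_insertAt rfl, insertAt_nullary, opOf_domDomCongr, opOf_apply_same]
        rcases a with _ | a
        · rw [opOf_apply_same, opOf_apply_same, AlternatingMap.curryLeft_apply_apply]
        · rw [opOf_apply_of_ne (by omega), opOf_apply_of_ne (by omega)]
          simp
      · rw [comp_opOf_insertAt rfl, opOf_apply_of_ne (by omega), opOf_apply_of_ne (n := b + 1) (by omega),
          AlternatingMap.zero_apply]
        exact (AlternatingMap.map_coord_zero _ (0 : Fin 1) (by simp)).symm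

theorem contract_apply_zero (v : G) (X : MultiOps G) : contract v X 0 ![] = X 1 ![v] := by
  rw [contract_apply, AlternatingMap.curryLeft_apply_apply]

/-- The term `D(D'(D''))` is common to both double compositions. What remains has `D''` and `D'` in
two different slots of `D`. -/
theorem associator_apply_zero (a b c : ℕ) (D : MultiOp G a) (D' : MultiOp G b)
    (D'' : MultiOp G c) :
    associator (opOf a D) (opOf b D') (opOf c D'') 0 ![] =
      - (-1 : ℝ) ^ b • opOf a D 2 ![opOf c D'' 0 ![], opOf b D' 0 ![]] := by
  rw [associator, DirectSum.sub_apply, AlternatingMap.sub_apply, comp_apply_zero, comp_apply_zero,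
    comp_apply_zero, ← contract_apply_zero, contract_comp_opOf, DirectSum.sub_apply,
    AlternatingMap.sub_apply, comp_apply_zero, contract_apply_zero, DirectSum.smul_apply,
    AlternatingMap.smul_apply, comp_apply_zero, contract_apply,
    AlternatingMap.curryLeft_apply_apply]
  module

theorem associator_zero_left (Y Z : MultiOps G) : associator 0 Y Z = 0 := by
  simp [associator]

theorem associator_zero_middle (X Z : MultiOps G) : associator X 0 Z = 0 := by
  simp [associator]

theorem associator_zero_right (X Y : MultiOps G) : associator X Y 0 = 0 := by
  simp [associator]

/-- The super pre-Lie identity. -/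
theorem associator_swap (a b c : ℕ) (D : MultiOp G a) (D' : MultiOp G b) (D'' : MultiOp G c) :
    associator (opOf a D) (opOf b D') (opOf c D'') =
      (-1 : ℝ) ^ ((b + 1) * (c + 1)) • associator (opOf a D) (opOf c D'') (opOf b D') := by
  suffices H : ∀ m a b c : ℕ, a + b + c ≤ m → ∀ (D : MultiOp G a) (D' : MultiOp G b)
      (D'' : MultiOp G c), associator (opOf a D) (opOf b D') (opOf c D'') =
      (-1 : ℝ) ^ ((b + 1) * (c + 1)) • associator (opOf a D) (opOf c D'') (opOf b D') from
    H _ a b c le_rfl D D' D''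
  intro m
  induction m with
  | zero =>
    intro a b c h D D' D''
    obtain ⟨rfl, rfl, rfl⟩ : a = 0 ∧ b = 0 ∧ c = 0 := by omega
    simp [associator, comp_opOf_zero]
  | succ m ih =>
    intro a b c h D D' D''
    rw [← sub_eq_zero]
    refine eq_zero_of_contract ?_ fun v => ?_
    -- For the component without entries: if `D'` or `D''` has an entry both sides vanish, otherwise
    -- the claim is the antisymmetry of the binary part of `D`.
    · have h0 : ∀ X : MultiOp G 0, X ![] = 0 → X = 0 := by
        intro X hX
        ext u
        rw [Subsingleton.elim u ![], hX, AlternatingMap.zero_apply]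
      refine h0 _ ?_
      rw [DirectSum.sub_apply, AlternatingMap.sub_apply, DirectSum.smul_apply,
        AlternatingMap.smul_apply, associator_apply_zero, associator_apply_zero]
      rcases b with _ | b
      · rcases c with _ | c
        · have h2 := (opOf a D 2).map_swap ![opOf 0 D' 0 ![], opOf 0 D'' 0 ![]]
            (i := 0) (j := 1) (by simp)
          have h3 : (![opOf 0 D' 0 ![], opOf 0 D'' 0 ![]] : Fin 2 → G) ∘ Equiv.swap (0 : Fin 2) 1 =
              ![opOf 0 D'' 0 ![], opOf 0 D' 0 ![]] := by
            funext i
            fin_cases i <;> simp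
          rw [h3] at h2
          rw [h2]
          simp
        · rw [opOf_apply_of_ne (n := c + 1) (by omega), AlternatingMap.zero_apply,
            AlternatingMap.map_coord_zero _ (0 : Fin 2) (by simp),
            AlternatingMap.map_coord_zero _ (1 : Fin 2) (by simp)]
          simp
      · rw [opOf_apply_of_ne (n := b + 1) (by omega), AlternatingMap.zero_apply,
            AlternatingMap.map_coord_zero _ (1 : Fin 2) (by simp),
            AlternatingMap.map_coord_zero _ (0 : Fin 2) (by simp)]
        simp
    -- Contraction turns the identity into a combination of the same identity for triples with one
    -- entry less.
    · rw [map_sub, map_smul, contract_associator, contract_associator]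
      have h1 : associator (contract v (opOf a D)) (opOf b D') (opOf c D'') =
          (-1 : ℝ) ^ ((b + 1) * (c + 1)) •
            associator (contract v (opOf a D)) (opOf c D'') (opOf b D') := by
        rcases a with _ | a
        · simp [contract_opOf_zero, associator_zero_left]
        · rw [contract_opOf_succ, ih _ _ _ (by omega)]
      have h2 : associator (opOf a D) (contract v (opOf b D')) (opOf c D'') =
          (-1 : ℝ) ^ (b * (c + 1)) •
            associator (opOf a D) (opOf c D'') (contract v (opOf b D')) := by
        rcases b with _ | b
        · simp [contract_opOf_zero, associator_zero_middle, associator_zero_right]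
        · rw [contract_opOf_succ, ih _ _ _ (by omega)]
      have h3 : associator (opOf a D) (opOf b D') (contract v (opOf c D'')) =
          (-1 : ℝ) ^ ((b + 1) * c) •
            associator (opOf a D) (contract v (opOf c D'')) (opOf b D') := by
        rcases c with _ | c
        · simp [contract_opOf_zero, associator_zero_middle, associator_zero_right]
        · rw [contract_opOf_succ, ih _ _ _ (by omega)]
      rw [h1, h2, h3]
      rcases Nat.even_or_odd b with hb | hb <;> rcases Nat.even_or_odd c with hc | hc <;>
        simp [pow_add, pow_mul, hb.neg_one_pow, hc.neg_one_pow, mul_add, add_mul] <;> module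

end GerstenhaberAlgebra

/-! ### The Schouten-Jacobi bracket as a graded Lie bracket, and its subalgebras. -/

section SchoutenJacobiAlgebra

variable {G : Type*} [AddCommGroup G] [Module ℝ G]

theorem neg_one_zpow_mul_self (n : ℤ) : (-1 : ℝ) ^ n * (-1 : ℝ) ^ n = 1 := by
  rcases Int.even_or_odd n with h | h
  · simp [h.neg_one_zpow]
  · simp [h.neg_one_zpow]

theorem neg_one_zpow_add (m n : ℤ) : (-1 : ℝ) ^ (m + n) = (-1 : ℝ) ^ m * (-1 : ℝ) ^ n :=
  zpow_add₀ (by norm_num) m n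

theorem schoutenJacobi_eq_comp (a b : ℕ) (D : MultiOp G a) (D' : MultiOp G b) :
    schoutenJacobi G (opOf a D) (opOf b D') =
      (-1 : ℝ) ^ (((a : ℤ) - 1) * ((b : ℤ) - 1)) • comp (opOf a D) (opOf b D') -
        comp (opOf b D') (opOf a D) := by
  rw [schoutenJacobi_lof, comp_opOf, comp_opOf, bracketComp]
  simp [sub_eq_add_neg]

variable (G) in
/-- The grading in which an operator with `n` entries has degree `n - 1`. -/
def opGrading (d : ℤ) : Submodule ℝ (MultiOps G) where
  carrier := {X | ∀ n : ℕ, (n : ℤ) ≠ d + 1 → X n = 0}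
  add_mem' hX hY n hn := by rw [DirectSum.add_apply, hX n hn, hY n hn, add_zero]
  zero_mem' n _ := rfl
  smul_mem' c X hX n hn := by rw [DirectSum.smul_apply, hX n hn, smul_zero]

theorem opOf_mem_opGrading {n : ℕ} {d : ℤ} (h : (n : ℤ) = d + 1) (D : MultiOp G n) :
    opOf n D ∈ opGrading G d := by
  intro m hm
  exact opOf_apply_of_ne (by rintro rfl; exact hm h) D

/-- Degree `-1` consists of the operators without entries; below it only zero is left, hence the
alternative. -/
theorem eq_opOf_of_mem {d : ℤ} {X : MultiOps G} (hX : X ∈ opGrading G d) :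
    X = 0 ∨ ∃ (n : ℕ) (D : MultiOp G n), (n : ℤ) = d + 1 ∧ X = opOf n D := by
  by_cases h : ∃ n : ℕ, (n : ℤ) = d + 1
  · obtain ⟨n, hn⟩ := h
    refine Or.inr ⟨n, X n, hn, DFinsupp.ext fun m => ?_⟩
    by_cases hm : n = m
    · subst hm
      exact (opOf_apply_same n (X n)).symm
    · exact (hX m (by omega)).trans (opOf_apply_of_ne hm _).symm
  · left
    exact DFinsupp.ext fun m => hX m fun hm => h ⟨m, hm⟩

theorem schoutenJacobi_mem {d e : ℤ} {X Y : MultiOps G} (hX : X ∈ opGrading G d)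
    (hY : Y ∈ opGrading G e) : schoutenJacobi G X Y ∈ opGrading G (d + e) := by
  rcases eq_opOf_of_mem hX with rfl | ⟨a, D, ha, rfl⟩
  · simp
  rcases eq_opOf_of_mem hY with rfl | ⟨b, D', hb, rfl⟩
  · simp
  rw [schoutenJacobi_eq_comp]
  rcases Nat.eq_zero_or_pos (b + a) with h | h
  · rw [comp_opOf_small h, comp_opOf_small (by omega)]
    simp
  · obtain ⟨E, hE⟩ := comp_opOf_mem a b (b + a - 1) (by omega) D D'
    obtain ⟨E', hE'⟩ := comp_opOf_mem b a (b + a - 1) (by omega) D' D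
    rw [hE, hE']
    exact sub_mem (Submodule.smul_mem _ _ (opOf_mem_opGrading (by omega) _))
      (opOf_mem_opGrading (by omega) _)

theorem schoutenJacobi_antisymm {d e : ℤ} {X Y : MultiOps G} (hX : X ∈ opGrading G d)
    (hY : Y ∈ opGrading G e) :
    schoutenJacobi G X Y = -((-1 : ℝ) ^ (d * e) • schoutenJacobi G Y X) := by
  rcases eq_opOf_of_mem hX with rfl | ⟨a, D, ha, rfl⟩
  · simp
  rcases eq_opOf_of_mem hY with rfl | ⟨b, D', hb, rfl⟩
  · simp
  obtain rfl : d = (a : ℤ) - 1 := by omega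
  obtain rfl : e = (b : ℤ) - 1 := by omega
  rw [schoutenJacobi_eq_comp, schoutenJacobi_eq_comp, mul_comm ((b : ℤ) - 1), smul_sub, smul_smul,
    neg_one_zpow_mul_self]
  module

/-- The sign of the pre-Lie identity passes to shifted degrees because `(b + 1)(c + 1)` and `(b -
1)(c - 1)` have the same parity. -/
theorem associator_swap_of_mem {e f : ℤ} {X Y Z : MultiOps G}
    (hY : Y ∈ opGrading G e) (hZ : Z ∈ opGrading G f) :
    associator X Y Z = (-1 : ℝ) ^ (e * f) • associator X Z Y := by
  rcases eq_opOf_of_mem hY with rfl | ⟨b, D', hb, rfl⟩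
  · simp [associator]
  rcases eq_opOf_of_mem hZ with rfl | ⟨c, D'', hc, rfl⟩
  · simp [associator]
  induction X using DirectSum.induction_on with
  | zero => simp [associator]
  | add X X' hX hX' =>
    have h : ∀ A B C D : MultiOps G, associator (A + B) C D = associator A C D + associator B C D := by
      intro A B C D
      simp only [associator, map_add, LinearMap.add_apply]
      abel
    rw [h, h, hX, hX', smul_add]
  | of a D =>
    refine (associator_swap a b c D D' D'').trans ?_
    congr 1
    have : e * f = ((b + 1) * (c + 1) : ℕ) - 2 * (b + c) := by
      obtain rfl : e = (b : ℤ) - 1 := by omega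
      obtain rfl : f = (c : ℤ) - 1 := by omega
      push_cast
      ring
    rw [this, zpow_sub₀ (by norm_num), zpow_natCast, zpow_mul]
    simp

/-- The Schouten-Jacobi bracket in terms of the composition, on homogeneous elements. -/
theorem schoutenJacobi_of_mem {d e : ℤ} {X Y : MultiOps G} (hX : X ∈ opGrading G d)
    (hY : Y ∈ opGrading G e) :
    schoutenJacobi G X Y = (-1 : ℝ) ^ (d * e) • comp X Y - comp Y X := by
  rcases eq_opOf_of_mem hX with rfl | ⟨a, D, ha, rfl⟩
  · simp
  rcases eq_opOf_of_mem hY with rfl | ⟨b, D', hb, rfl⟩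
  · simp
  obtain rfl : d = (a : ℤ) - 1 := by omega
  obtain rfl : e = (b : ℤ) - 1 := by omega
  exact schoutenJacobi_eq_comp a b D D'

/-- The commutator of a graded pre-Lie product is a graded Lie bracket: the twelve double
compositions regroup into six associators, which cancel in pairs by the symmetry in the last two
arguments. -/
theorem schoutenJacobi_leibniz {d e f : ℤ} {X Y Z : MultiOps G} (hX : X ∈ opGrading G d)
    (hY : Y ∈ opGrading G e) (hZ : Z ∈ opGrading G f) :
    schoutenJacobi G (schoutenJacobi G X Y) Z = schoutenJacobi G X (schoutenJacobi G Y Z) +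
      (-1 : ℝ) ^ (e * f) • schoutenJacobi G (schoutenJacobi G X Z) Y := by
  rw [schoutenJacobi_of_mem (schoutenJacobi_mem hX hY) hZ,
    schoutenJacobi_of_mem hX (schoutenJacobi_mem hY hZ),
    schoutenJacobi_of_mem (schoutenJacobi_mem hX hZ) hY, schoutenJacobi_of_mem hX hY,
    schoutenJacobi_of_mem hY hZ, schoutenJacobi_of_mem hX hZ]
  have h1 := associator_swap_of_mem (X := X) hY hZ
  have h2 := associator_swap_of_mem (X := Y) hX hZ
  have h3 := associator_swap_of_mem (X := Z) hX hY
  simp only [associator] at h1 h2 h3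
  simp only [map_sub, map_smul, LinearMap.sub_apply, LinearMap.smul_apply]
  simp only [add_mul, mul_add, neg_one_zpow_add]
  rw [sub_eq_iff_eq_add] at h1 h2 h3
  rw [h1, h2, h3]
  simp only [mul_comm f e]
  rcases Int.even_or_odd (e * f) with h | h <;> rcases Int.even_or_odd (d * f) with h' | h' <;>
    rcases Int.even_or_odd (d * e) with h'' | h'' <;>
    simp only [h.neg_one_zpow, h'.neg_one_zpow, h''.neg_one_zpow] <;> module

/-! ### Operators whose unary contractions belong to a Lie algebra of operators -/

/-- The part of an operator with one entry. -/
def unaryPart : MultiOps G →ₗ[ℝ] G →ₗ[ℝ] G where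
  toFun X :=
    { toFun := fun s => X 1 ![s]
      map_add' := fun s t => (X 1).map_vecCons_add ![] s t
      map_smul' := fun c s => (X 1).map_vecCons_smul ![] c s }
  map_add' X Y := by ext; simp
  map_smul' c X := by
    ext s
    exact congrArg (fun E => E ![s]) (DirectSum.smul_apply c X 1)

theorem unaryPart_apply (X : MultiOps G) (s : G) : unaryPart X s = X 1 ![s] := rfl

/-- A single argument goes either into `D'` or into a further slot of `D`; in the second case `D'`
has no entries and acts as a vector. -/
theorem unaryPart_comp_opOf (a b : ℕ) (D : MultiOp G a) (D' : MultiOp G b) :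
    unaryPart (comp (opOf a D) (opOf b D')) =
      unaryPart (opOf a D) ∘ₗ unaryPart (opOf b D') +
        unaryPart (contract (opOf b D' 0 ![]) (opOf a D)) := by
  ext z
  rw [unaryPart_apply, ← contract_apply_zero, contract_comp_opOf, DirectSum.sub_apply,
    AlternatingMap.sub_apply, comp_apply_zero, contract_apply_zero, DirectSum.smul_apply,
    AlternatingMap.smul_apply, comp_apply_zero, contract_apply, LinearMap.add_apply,
    LinearMap.comp_apply, unaryPart_apply, unaryPart_apply, unaryPart_apply, contract_apply,
    sub_eq_add_neg]
  congr 1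
  rcases b with _ | b
  · rw [pow_zero, one_smul, AlternatingMap.curryLeft_apply_apply,
      AlternatingMap.curryLeft_apply_apply]
    have h2 := (opOf a D 2).map_swap ![z, opOf 0 D' 0 ![]] (i := 0) (j := 1) (by simp)
    have h3 : (![z, opOf 0 D' 0 ![]] : Fin 2 → G) ∘ Equiv.swap (0 : Fin 2) 1 =
        ![opOf 0 D' 0 ![], z] := by
      funext i
      fin_cases i <;> simp
    rw [h3] at h2
    rw [h2]
  · rw [opOf_apply_of_ne (n := b + 1) (by omega), AlternatingMap.zero_apply,
      AlternatingMap.map_coord_zero _ (0 : Fin 1) (by simp), map_zero, AlternatingMap.zero_apply]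
    simp

/-- Successive contractions. -/
def contractList : List G → MultiOps G →ₗ[ℝ] MultiOps G
  | [] => LinearMap.id
  | v :: l => contractList l ∘ₗ contract v

/-- The operators all of whose unary contractions belong to `𝒟`. -/
def unaryIn (𝒟 : Submodule ℝ (G →ₗ[ℝ] G)) : Submodule ℝ (MultiOps G) :=
  ⨅ l : List G, 𝒟.comap (unaryPart ∘ₗ contractList l)

variable {𝒟 : Submodule ℝ (G →ₗ[ℝ] G)}

theorem mem_unaryIn {X : MultiOps G} :
    X ∈ unaryIn 𝒟 ↔ ∀ l, unaryPart (contractList l X) ∈ 𝒟 := by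
  simp [unaryIn, Submodule.mem_iInf]

theorem unaryPart_mem {X : MultiOps G} (h : X ∈ unaryIn 𝒟) : unaryPart X ∈ 𝒟 :=
  mem_unaryIn.1 h []

theorem contract_mem {X : MultiOps G} (h : X ∈ unaryIn 𝒟) (v : G) :
    contract v X ∈ unaryIn 𝒟 :=
  mem_unaryIn.2 fun l => mem_unaryIn.1 h (v :: l)

theorem mem_unaryIn_of_contract {X : MultiOps G} (h : unaryPart X ∈ 𝒟)
    (h' : ∀ v, contract v X ∈ unaryIn 𝒟) : X ∈ unaryIn 𝒟 :=
  mem_unaryIn.2 fun l => match l with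
    | [] => h
    | v :: l => mem_unaryIn.1 (h' v) l

theorem unaryPart_opOf_of_ne {n : ℕ} (h : n ≠ 1) (D : MultiOp G n) : unaryPart (opOf n D) = 0 := by
  ext s
  rw [unaryPart_apply, opOf_apply_of_ne h]
  simp

theorem opOf_zero_mem (D : MultiOp G 0) : opOf 0 D ∈ unaryIn 𝒟 := by
  refine mem_unaryIn_of_contract ?_ fun v => ?_
  · rw [unaryPart_opOf_of_ne (by omega)]
    exact zero_mem _
  · rw [contract_opOf_zero]
    exact zero_mem _

/-- The homogeneous components of an element of `unaryIn 𝒟` belong to it. -/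
theorem component_mem {X : MultiOps G} (h : X ∈ unaryIn 𝒟) (n : ℕ) :
    opOf n (X n) ∈ unaryIn 𝒟 := by
  induction n generalizing X with
  | zero => exact opOf_zero_mem _
  | succ n ih =>
    refine mem_unaryIn_of_contract ?_ fun v => ?_
    · rcases n with _ | n
      · have : unaryPart (opOf (0 + 1) (X (0 + 1))) = unaryPart X := by
          ext s
          rw [unaryPart_apply, unaryPart_apply, opOf_apply_same]
        rw [this]
        exact unaryPart_mem h
      · rw [unaryPart_opOf_of_ne (by omega)]
        exact zero_mem _
    · rw [contract_opOf_succ, ← contract_apply]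
      exact ih (contract_mem h v)

/-- Contraction lowers the degree by one, and the resulting change of `(-1)^((a-1)(b-1))` absorbs
the signs of the two composition rules. -/
theorem contract_schoutenJacobi (v : G) (a b : ℕ) (D : MultiOp G a) (D' : MultiOp G b) :
    contract v (schoutenJacobi G (opOf a D) (opOf b D')) =
      (-1 : ℝ) ^ (a + 1) • schoutenJacobi G (opOf a D) (contract v (opOf b D')) +
        schoutenJacobi G (contract v (opOf a D)) (opOf b D') := by
  have hc : ∀ (n : ℕ) (E : MultiOp G n), contract v (opOf n E) ∈ opGrading G (n - 2) := by
    intro n E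
    rcases n with _ | n
    · rw [contract_opOf_zero]
      exact zero_mem _
    · rw [contract_opOf_succ]
      exact opOf_mem_opGrading (by push_cast; ring) _
  rw [schoutenJacobi_eq_comp, schoutenJacobi_of_mem (opOf_mem_opGrading (d := a - 1) (by ring) D) (hc b D'),
    schoutenJacobi_of_mem (hc a D) (opOf_mem_opGrading (d := b - 1) (by ring) D'), map_sub, map_smul,
    contract_comp_opOf, contract_comp_opOf]
  have e1 : ((a : ℤ) - 1) * (b - 2) = (a - 1) * (b - 1) + (a + 1) - 2 * a := by ring
  have e2 : ((a : ℤ) - 2) * (b - 1) = (a - 1) * (b - 1) + (b + 1) - 2 * b := by ring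
  rw [e1, e2, zpow_sub₀ (by norm_num), zpow_sub₀ (by norm_num), (even_two_mul (a : ℤ)).neg_one_zpow,
    (even_two_mul (b : ℤ)).neg_one_zpow, neg_one_zpow_add _ ((a : ℤ) + 1),
    neg_one_zpow_add _ ((b : ℤ) + 1)]
  generalize (-1 : ℝ) ^ (((a : ℤ) - 1) * ((b : ℤ) - 1)) = r
  have e3 : (-1 : ℝ) ^ ((a : ℤ) + 1) = (-1) ^ (a + 1) := by exact_mod_cast zpow_natCast (-1 : ℝ) (a + 1)
  have e4 : (-1 : ℝ) ^ ((b : ℤ) + 1) = (-1) ^ (b + 1) := by exact_mod_cast zpow_natCast (-1 : ℝ) (b + 1)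
  rw [e3, e4, pow_succ, pow_succ]
  simp only [div_one]
  rcases Nat.even_or_odd a with h | h <;> rcases Nat.even_or_odd b with h' | h' <;>
    simp only [h.neg_one_pow, h'.neg_one_pow] <;> module

/-- Contractions are handled by induction, so only the unary part of the bracket needs an argument.
It is made of unary parts of contractions, plus the commutator of the unary parts when both
operators are unary. -/
theorem schoutenJacobi_opOf_mem_unaryIn (h𝒟 : ∀ A ∈ 𝒟, ∀ B ∈ 𝒟, A ∘ₗ B - B ∘ₗ A ∈ 𝒟)
    (m a b : ℕ) (hm : a + b ≤ m) (D : MultiOp G a) (D' : MultiOp G b)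
    (hD : opOf a D ∈ unaryIn 𝒟) (hD' : opOf b D' ∈ unaryIn 𝒟) :
    schoutenJacobi G (opOf a D) (opOf b D') ∈ unaryIn 𝒟 := by
  induction m generalizing a b with
  | zero =>
    obtain ⟨rfl, rfl⟩ : a = 0 ∧ b = 0 := by omega
    rw [schoutenJacobi_eq_comp, comp_opOf_zero, comp_opOf_zero]
    simp
  | succ m ih =>
    refine mem_unaryIn_of_contract ?_ fun v => ?_
    · rw [schoutenJacobi_eq_comp, map_sub, map_smul, unaryPart_comp_opOf, unaryPart_comp_opOf]
      have h1 := unaryPart_mem (contract_mem hD (opOf b D' 0 ![]))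
      have h2 := unaryPart_mem (contract_mem hD' (opOf a D 0 ![]))
      by_cases hab : a = 1 ∧ b = 1
      · obtain ⟨rfl, rfl⟩ := hab
        have h3 := h𝒟 _ (unaryPart_mem hD) _ (unaryPart_mem hD')
        have := 𝒟.add_mem h3 (𝒟.sub_mem h1 h2)
        convert this using 1
        simp only [Nat.cast_one, sub_self, mul_zero, zpow_zero, one_smul]
        abel
      · have h3 : unaryPart (opOf a D) ∘ₗ unaryPart (opOf b D') = 0 := by
          by_cases ha : a = 1
          · rw [unaryPart_opOf_of_ne (n := b) (by omega), LinearMap.comp_zero]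
          · rw [unaryPart_opOf_of_ne ha, LinearMap.zero_comp]
        have h4 : unaryPart (opOf b D') ∘ₗ unaryPart (opOf a D) = 0 := by
          by_cases ha : a = 1
          · rw [unaryPart_opOf_of_ne (n := b) (by omega), LinearMap.zero_comp]
          · rw [unaryPart_opOf_of_ne ha, LinearMap.comp_zero]
        rw [h3, h4, zero_add, zero_add]
        exact 𝒟.sub_mem (𝒟.smul_mem _ h1) h2
    · rw [contract_schoutenJacobi]
      refine add_mem (Submodule.smul_mem _ _ ?_) ?_
      · rcases b with _ | b
        · rw [contract_opOf_zero, map_zero]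
          exact zero_mem _
        · have := contract_mem hD' v
          rw [contract_opOf_succ] at this ⊢
          exact ih a b (by omega) D _ hD this
      · rcases a with _ | a
        · rw [contract_opOf_zero, map_zero, LinearMap.zero_apply]
          exact zero_mem _
        · have := contract_mem hD v
          rw [contract_opOf_succ] at this ⊢
          exact ih a b (by omega) _ D' this hD'

theorem eq_sum_opOf (X : MultiOps G) : ∃ s : Finset ℕ, X = ∑ n ∈ s, opOf n (X n) := by
  classical
  exact ⟨DFinsupp.support X, (DirectSum.sum_support_of X).symm⟩

theorem schoutenJacobi_mem_unaryIn (h𝒟 : ∀ A ∈ 𝒟, ∀ B ∈ 𝒟, A ∘ₗ B - B ∘ₗ A ∈ 𝒟)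
    {X Y : MultiOps G} (hX : X ∈ unaryIn 𝒟) (hY : Y ∈ unaryIn 𝒟) :
    schoutenJacobi G X Y ∈ unaryIn 𝒟 := by
  obtain ⟨s, hs⟩ := eq_sum_opOf X
  obtain ⟨t, ht⟩ := eq_sum_opOf Y
  rw [hs, ht, map_sum]
  refine sum_mem fun b _ => ?_
  rw [map_sum, LinearMap.sum_apply]
  exact sum_mem fun a _ => schoutenJacobi_opOf_mem_unaryIn h𝒟 _ a b le_rfl _ _
    (component_mem hX a) (component_mem hY b)

theorem map_vecCons_swap {H : Type*} [AddCommGroup H] [Module ℝ H] {n : ℕ}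
    (D : G [⋀^Fin (n + 2)]→ₗ[ℝ] H) (v w : G) (u : Fin n → G) :
    D (Matrix.vecCons v (Matrix.vecCons w u)) = -D (Matrix.vecCons w (Matrix.vecCons v u)) := by
  have := D.map_swap (Matrix.vecCons w (Matrix.vecCons v u)) (i := 0) (j := 1) (by simp)
  rw [← this]
  congr 1
  funext i
  refine Fin.cases ?_ (fun i => Fin.cases ?_ (fun i => ?_) i) i
  · simp
  · simp
  · have : Equiv.swap (0 : Fin (n + 2)) 1 i.succ.succ = i.succ.succ :=
      Equiv.swap_apply_of_ne_of_ne (by simp [Fin.ext_iff]) (by simp [Fin.ext_iff])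
    simp [this]

/-- The first entry of an operator, the other ones being fixed. -/
def headMap {n : ℕ} (D : MultiOp G (n + 1)) (w : Fin n → G) : G →ₗ[ℝ] G where
  toFun s := D (Matrix.vecCons s w)
  map_add' s t := D.map_vecCons_add w s t
  map_smul' c s := D.map_vecCons_smul w c s

theorem headMap_apply {n : ℕ} (D : MultiOp G (n + 1)) (w : Fin n → G) (s : G) :
    headMap D w s = D (Matrix.vecCons s w) := rfl

theorem headMap_curryLeft {n : ℕ} (D : MultiOp G (n + 2)) (v : G) (w : Fin n → G) :
    headMap (D.curryLeft v) w = -headMap D (Matrix.vecCons v w) := by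
  ext s
  rw [LinearMap.neg_apply, headMap_apply, headMap_apply, AlternatingMap.curryLeft_apply_apply,
    map_vecCons_swap]

theorem unaryPart_opOf_one (D : MultiOp G 1) : unaryPart (opOf 1 D) = headMap D ![] := by
  ext s
  rw [unaryPart_apply, opOf_apply_same]
  rfl

/-- Together with the next lemma this identifies `unaryIn 𝒟`, for a single operator, with the
condition that it belongs to `𝒟` as a function of its first entry, whatever the other entries are.
Every contraction exchanges two entries, which costs a sign only. -/
theorem headMap_mem {n : ℕ} (D : MultiOp G (n + 1)) (h : opOf (n + 1) D ∈ unaryIn 𝒟)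
    (w : Fin n → G) : headMap D w ∈ 𝒟 := by
  induction n with
  | zero =>
    rw [Subsingleton.elim w ![], ← unaryPart_opOf_one]
    exact unaryPart_mem h
  | succ n ih =>
    have h1 := contract_mem h (w 0)
    rw [contract_opOf_succ] at h1
    have h2 := 𝒟.neg_mem (ih _ h1 (Matrix.vecTail w))
    rw [headMap_curryLeft, neg_neg] at h2
    rwa [show Matrix.vecCons (w 0) (Matrix.vecTail w) = w from Matrix.cons_head_tail w] at h2

theorem mem_unaryIn_of_headMap {n : ℕ} (D : MultiOp G (n + 1)) (h : ∀ w, headMap D w ∈ 𝒟) :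
    opOf (n + 1) D ∈ unaryIn 𝒟 := by
  induction n with
  | zero =>
    refine mem_unaryIn_of_contract ?_ fun v => ?_
    · have := h ![]
      rwa [← unaryPart_opOf_one] at this
    · rw [contract_opOf_succ]
      exact opOf_zero_mem _
  | succ n ih =>
    refine mem_unaryIn_of_contract ?_ fun v => ?_
    · rw [unaryPart_opOf_of_ne (by omega)]
      exact zero_mem _
    · rw [contract_opOf_succ]
      refine ih _ fun w => ?_
      rw [headMap_curryLeft]
      exact 𝒟.neg_mem (h _)

end SchoutenJacobiAlgebra

/-! ### Explicit formulas for compositions with unary and binary operators. -/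

section Formulas

variable {G : Type*} [AddCommGroup G] [Module ℝ G]

/-- Peeling off the first entry in this way, together with the derivation rule, gives the signed
sums below by induction, without enumerating unshuffles. -/
theorem contract_apply_vecCons {n : ℕ} (X : MultiOps G) (v : Fin (n + 1) → G) :
    X (n + 1) v = contract (v 0) X n (Matrix.vecTail v) := by
  rw [contract_apply, AlternatingMap.curryLeft_apply_apply]
  congr 1
  exact (Matrix.cons_head_tail v).symm

theorem comp_unary_apply {b : ℕ} (A : MultiOp G 1) (D : MultiOp G b) (v : Fin b → G) :
    comp (opOf 1 A) (opOf b D) b v = A ![D v] := by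
  rw [comp_opOf_insertAt (a := 0) (n := b) rfl, opOf_apply_same, insertAt_apply]
  have : ∀ σ : Equiv.Perm (Fin b), Equiv.Perm.sign σ • A (Matrix.vecCons
        (D fun j : Fin b => v (σ ⟨j, by omega⟩))
          fun j : Fin 0 => v (σ ⟨b + j, by omega⟩)) = A ![D v] := by
    intro σ
    rw [← A.curryLeft_apply_apply, ← A.curryLeft_apply_apply]
    have h : D (fun j : Fin b => v (σ ⟨j, by omega⟩)) = Equiv.Perm.sign σ • D v :=
      D.map_perm v σ
    rw [h, Subsingleton.elim (fun j : Fin 0 => v (σ ⟨b + j, by omega⟩)) ![]]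
    rcases Int.units_eq_one_or (Equiv.Perm.sign σ) with h | h
    · simp [h]
    · simp [h]
  rw [Finset.sum_congr rfl fun σ _ => this σ, Finset.sum_const, Finset.card_univ,
    Fintype.card_perm, Fintype.card_fin, ← Nat.cast_smul_eq_nsmul ℝ, smul_smul]
  have h1 : ((b.factorial : ℕ) : ℝ) ≠ 0 := by positivity
  rw [Nat.factorial_zero, Nat.cast_one, mul_one, inv_mul_cancel₀ h1, one_smul]

/-- A `(k, 1)`-unshuffle is given by the index `a` which ends up last, and has sign `(-1)^(k + a)`.
-/
theorem comp_binary_apply {k : ℕ} (A : MultiOp G 2) (D : MultiOp G k) (v : Fin (k + 1) → G) :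
    comp (opOf 2 A) (opOf k D) (k + 1) v =
      ∑ a : Fin (k + 1), (-1 : ℝ) ^ (k + a : ℕ) • A ![D (v ∘ a.succAbove), v a] := by
  induction k with
  | zero =>
    rw [comp_opOf_insertAt (a := 1) (n := 0 + 1) rfl, opOf_apply_same, insertAt_nullary]
    simp only [Nat.reduceAdd, Finset.univ_unique, Fin.default_eq_zero, Finset.sum_singleton, Fin.val_zero,
      pow_zero, one_smul]
    change A.curryLeft (D ![]) v = _
    rw [AlternatingMap.curryLeft_apply_apply, Subsingleton.elim (v ∘ Fin.succAbove 0) ![]]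
    congr 1
    funext i
    fin_cases i <;> rfl
  | succ k ih =>
    rw [contract_apply_vecCons, contract_comp_opOf, contract_opOf_succ, contract_opOf_succ,
      DirectSum.sub_apply, AlternatingMap.sub_apply, ih, DirectSum.smul_apply,
      AlternatingMap.smul_apply, comp_unary_apply, Fin.sum_univ_succ (n := k + 1), AlternatingMap.curryLeft_apply_apply]
    have h1 : A (Matrix.vecCons (v 0) ![D (Matrix.vecTail v)]) =
        - A ![D (v ∘ (0 : Fin (k + 2)).succAbove), v 0] := by
      rw [map_vecCons_swap]
      rfl
    rw [h1, sub_eq_neg_add]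
    congr 1
    · rw [Fin.val_zero, add_zero]
      module
    · refine Finset.sum_congr rfl fun a _ => ?_
      have h2 : D.curryLeft (v 0) (Matrix.vecTail v ∘ a.succAbove) = D (v ∘ a.succ.succAbove) := by
        rw [AlternatingMap.curryLeft_apply_apply]
        congr 1
        funext i
        refine Fin.cases ?_ (fun i => ?_) i
        · simp
        · simp [Matrix.vecTail]
      rw [h2]
      congr 1
      rw [Fin.val_succ, show k + 1 + ((a : ℕ) + 1) = k + a + 2 by ring, pow_add _ (k + a) 2]
      norm_num

/-- A `(1, k)`-unshuffle is given by the index `a` which is moved to the front. -/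
theorem comp_apply_unary {k : ℕ} (D : MultiOp G (k + 1)) (U : MultiOp G 1) (v : Fin (k + 1) → G) :
    comp (opOf (k + 1) D) (opOf 1 U) (k + 1) v =
      ∑ a : Fin (k + 1), (-1 : ℝ) ^ (a : ℕ) • D (Matrix.vecCons (U ![v a]) (v ∘ a.succAbove)) := by
  induction k with
  | zero =>
    rw [comp_unary_apply]
    simp only [Nat.reduceAdd, Finset.univ_unique, Fin.default_eq_zero, Finset.sum_singleton,
      Fin.val_zero, pow_zero, one_smul]
    rw [Subsingleton.elim (v ∘ Fin.succAbove 0) ![]]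
    congr 3
    funext i
    fin_cases i
    rfl
  | succ k ih =>
    rw [contract_apply_vecCons, contract_comp_opOf, contract_opOf_succ, contract_opOf_succ,
      DirectSum.sub_apply, AlternatingMap.sub_apply, DirectSum.smul_apply,
      AlternatingMap.smul_apply, ih, Fin.sum_univ_succ (n := k + 1), comp_opOf_insertAt (n := k + 1) (by omega),
      opOf_apply_same, insertAt_nullary, sub_eq_add_neg]
    congr 1
    · rw [Fin.val_zero, pow_zero, one_smul]
      change D.curryLeft (U.curryLeft (v 0) ![]) (Matrix.vecTail v) = _
      rw [AlternatingMap.curryLeft_apply_apply]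
      rfl
    · rw [pow_one, neg_smul, neg_neg, one_smul]
      refine Finset.sum_congr rfl fun a _ => ?_
      rw [AlternatingMap.curryLeft_apply_apply, map_vecCons_swap, Fin.val_succ, pow_succ, mul_neg,
        mul_one, neg_smul, smul_neg]
      congr 4
      funext i
      refine Fin.cases ?_ (fun i => ?_) i
      · simp
      · simp [Matrix.vecTail]

/-- A `(2, k)`-unshuffle is given by the pair `a < b` moved to the front, and has sign `(-1)^(a + b
- 1)`. Since `a < b`, the index `a` keeps its position when `b` is removed; this is why it ranges
over `Fin (k + 1)`. -/
theorem comp_apply_binary {k : ℕ} (D : MultiOp G (k + 1)) (A : MultiOp G 2) (v : Fin (k + 2) → G) :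
    comp (opOf (k + 1) D) (opOf 2 A) (k + 2) v =
      -∑ b : Fin (k + 2), ∑ a : Fin (k + 1), if a.castSucc < b then
        (-1 : ℝ) ^ ((a : ℕ) + (b : ℕ)) • D (Matrix.vecCons (A ![v a.castSucc, v b])
          (v ∘ b.succAbove ∘ a.succAbove)) else 0 := by
  induction k with
  | zero =>
    rw [comp_unary_apply, Fin.sum_univ_two]
    simp only [Nat.reduceAdd, Finset.univ_unique, Fin.default_eq_zero, Finset.sum_singleton,
      Fin.val_zero]
    simp only [Fin.castSucc_zero, lt_self_iff_false, if_false, zero_lt_one, if_true, Fin.val_one,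
      zero_add, pow_one, neg_smul, one_smul, neg_neg]
    rw [Subsingleton.elim (v ∘ Fin.succAbove 1 ∘ Fin.succAbove 0) ![]]
    congr 3
    funext i
    fin_cases i <;> rfl
  | succ k ih =>
    rw [contract_apply_vecCons, contract_comp_opOf, contract_opOf_succ, contract_opOf_succ,
      DirectSum.sub_apply, AlternatingMap.sub_apply, DirectSum.smul_apply,
      AlternatingMap.smul_apply, comp_apply_unary, ih, Fin.sum_univ_succ (n := k + 2)]
    simp only [Fin.not_lt_zero, if_false, Finset.sum_const_zero, zero_add]
    -- The pairs which contain the index `0` give the contraction of `A`, the other ones the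
    -- contraction of `D`.
    have h1 : ∀ b : Fin (k + 2), (∑ a : Fin (k + 2), if a.castSucc < b.succ then
        (-1 : ℝ) ^ ((a : ℕ) + (b.succ : ℕ)) • D (Matrix.vecCons (A ![v a.castSucc, v b.succ])
          (v ∘ b.succ.succAbove ∘ a.succAbove)) else 0) =
        -((-1 : ℝ) ^ (b : ℕ) • D (Matrix.vecCons (A.curryLeft (v 0) ![Matrix.vecTail v b])
          (Matrix.vecTail v ∘ b.succAbove))) +
        -∑ a : Fin (k + 1), if a.castSucc < b then (-1 : ℝ) ^ ((a : ℕ) + (b : ℕ)) •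
          (D.curryLeft (v 0)) (Matrix.vecCons
            (A ![Matrix.vecTail v a.castSucc, Matrix.vecTail v b])
            (Matrix.vecTail v ∘ b.succAbove ∘ a.succAbove)) else 0 := by
      intro b
      rw [Fin.sum_univ_succ]
      congr 1
      · rw [if_pos (by simp), Fin.val_zero, zero_add, Fin.val_succ, pow_succ, mul_neg, mul_one,
          neg_smul, AlternatingMap.curryLeft_apply_apply]
        congr 4
        funext i
        simp [Matrix.vecTail]
      · rw [← Finset.sum_neg_distrib]
        refine Finset.sum_congr rfl fun a _ => ?_
        by_cases h : a.castSucc < b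
        · rw [if_pos h, if_pos (by
            rw [← Fin.succ_castSucc]; exact Fin.succ_lt_succ_iff.2 h),
            AlternatingMap.curryLeft_apply_apply,
            map_vecCons_swap D (v 0), smul_neg, neg_neg]
          congr 1
          · rw [Fin.val_succ, Fin.val_succ, show (a : ℕ) + 1 + ((b : ℕ) + 1) = a + b + 2 by ring,
              pow_add _ (a + b : ℕ) 2]
            norm_num
          · congr 2
            funext i
            refine Fin.cases ?_ (fun i => ?_) i
            · simp
            · simp [Matrix.vecTail]
        · rw [if_neg h, if_neg (by
            rw [← Fin.succ_castSucc]; exact fun h' => h (Fin.succ_lt_succ_iff.1 h')), neg_zero]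
    rw [Finset.sum_congr rfl fun b _ => h1 b, Finset.sum_add_distrib, neg_add,
      Finset.sum_neg_distrib, Finset.sum_neg_distrib, neg_neg, neg_neg]
    module

end Formulas

/-! ### Koszul signs and subsets of the entries. -/

section KoszulSigns

theorem prod_neg_one_zpow {ι : Type*} (s : Finset ι) (f : ι → ℤ) :
    ∏ i ∈ s, (-1 : ℝ) ^ f i = (-1 : ℝ) ^ ∑ i ∈ s, f i := by
  classical
  induction s using Finset.induction_on with
  | empty => simp
  | insert a s ha ih => rw [Finset.prod_insert ha, Finset.sum_insert ha, ih, neg_one_zpow_add]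

theorem sort_map_succ {n : ℕ} (s : Finset (Fin n)) :
    (s.map (Fin.succEmb n)).sort = (s.sort).map Fin.succ := by
  rw [← Finset.listMap_orderEmbOfFin_finRange (s.map (Fin.succEmb n)) (Finset.card_map _),
    ← Finset.listMap_orderEmbOfFin_finRange s rfl, List.map_map]
  congr 1
  refine (Finset.orderEmbOfFin_unique (Finset.card_map _) (fun x => ?_) ?_).symm
  · exact Finset.mem_map_of_mem (Fin.succEmb n) (Finset.orderEmbOfFin_mem s rfl x)
  · exact (Fin.strictMono_succ).comp (s.orderEmbOfFin rfl).strictMono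

theorem zero_notMem_map_succ {n : ℕ} (s : Finset (Fin n)) : (0 : Fin (n + 1)) ∉ s.map (Fin.succEmb n) := by
  simp [Fin.succ_ne_zero]

theorem sort_insert_zero {n : ℕ} (s : Finset (Fin n)) :
    (insert 0 (s.map (Fin.succEmb n))).sort = 0 :: (s.sort).map Fin.succ := by
  rw [Finset.sort_insert _ (fun b _ => Fin.zero_le b) (zero_notMem_map_succ s), sort_map_succ]

theorem compl_map_succ {n : ℕ} (s : Finset (Fin n)) :
    (s.map (Fin.succEmb n))ᶜ = insert 0 (sᶜ.map (Fin.succEmb n)) := by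
  ext i
  refine Fin.cases ?_ (fun i => ?_) i
  · simp [Fin.succ_ne_zero]
  · simp [Fin.succ_ne_zero]

theorem compl_insert_zero {n : ℕ} (s : Finset (Fin n)) :
    (insert 0 (s.map (Fin.succEmb n)))ᶜ = sᶜ.map (Fin.succEmb n) := by
  rw [compl_eq_comm, compl_map_succ, compl_compl]

/-- An unshuffle either leaves the entry `0` behind or takes it to the front block; the induction
for the iterated Leibniz rule follows this dichotomy. -/
theorem sum_finset_succ {n : ℕ} {H : Type*} [AddCommMonoid H] (f : Finset (Fin (n + 1)) → H) :
    ∑ s, f s = ∑ s : Finset (Fin n), f (s.map (Fin.succEmb n)) +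
      ∑ s : Finset (Fin n), f (insert 0 (s.map (Fin.succEmb n))) := by
  have h : (Finset.univ : Finset (Fin (n + 1))) =
      insert 0 ((Finset.univ : Finset (Fin n)).map (Fin.succEmb n)) := by
    have h := compl_map_succ (∅ : Finset (Fin n))
    simpa using h
  rw [← Finset.powerset_univ, h, Finset.sum_powerset_insert (zero_notMem_map_succ _)]
  have h2 : (Finset.univ.map (Fin.succEmb n)).powerset =
      (Finset.univ : Finset (Finset (Fin n))).map (Finset.mapEmbedding (Fin.succEmb n)).toEmbedding := by
    ext t
    simp only [Finset.mem_powerset, Finset.mem_map, Finset.mem_univ, true_and]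
    constructor
    · intro ht
      refine ⟨Finset.univ.filter fun i => i.succ ∈ t, ?_⟩
      ext i
      refine Fin.cases ?_ (fun i => ?_) i
      · have h0 : (0 : Fin (n + 1)) ∉ t := fun h0 => zero_notMem_map_succ _ (ht h0)
        simp [Finset.mapEmbedding_apply, h0, Fin.succ_ne_zero]
      · simp [Finset.mapEmbedding_apply]
    · rintro ⟨s, rfl⟩
      exact Finset.map_subset_map.2 (Finset.subset_univ s)
  rw [h2, Finset.sum_map, Finset.sum_map]
  rfl

theorem koszulSign_insert_zero {n : ℕ} (s : Finset (Fin n)) (p : Fin (n + 1) → ℤ) :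
    koszulSign (insert 0 (s.map (Fin.succEmb n))) p = koszulSign s (Fin.tail p) := by
  rw [koszulSign, koszulSign, Finset.prod_insert (zero_notMem_map_succ s), compl_insert_zero,
    Finset.prod_map, Finset.prod_map]
  simp only [Fin.coe_succEmb, Finset.prod_map, Fin.not_lt_zero, if_false, Finset.prod_const_one,
    one_mul, Fin.succ_lt_succ_iff]
  rfl

/-- The entry `0` stays behind and is overtaken by each entry of `s`. -/
theorem koszulSign_map_succ {n : ℕ} (s : Finset (Fin n)) (p : Fin (n + 1) → ℤ) :
    koszulSign (s.map (Fin.succEmb n)) p =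
      koszulSign s (Fin.tail p) * (-1 : ℝ) ^ (p 0 * ∑ i ∈ s, Fin.tail p i) := by
  rw [koszulSign, koszulSign, compl_map_succ, Finset.prod_map, Finset.mul_sum,
    ← prod_neg_one_zpow, ← Finset.prod_mul_distrib]
  refine Finset.prod_congr rfl fun i _ => ?_
  rw [Finset.prod_insert (zero_notMem_map_succ _), Finset.prod_map, mul_comm]
  simp only [Fin.coe_succEmb, Fin.succ_lt_succ_iff, Fin.succ_pos, if_true]
  rw [mul_comm (p i.succ)]
  rfl

/-- A pair with one index in `s` and one in `sᶜ` is an inversion for exactly one of the two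
unshuffles. The product of the signs is therefore the sign of exchanging the blocks, and each sign
is its own inverse. -/
theorem koszulSign_compl {n : ℕ} (s : Finset (Fin n)) (p : Fin n → ℤ) :
    koszulSign sᶜ p = koszulSign s p * (-1 : ℝ) ^ ((∑ i ∈ s, p i) * ∑ j ∈ sᶜ, p j) := by
  have h1 : ∀ (t : Finset (Fin n)), koszulSign t p * koszulSign t p = 1 := by
    intro t
    rw [koszulSign, ← Finset.prod_mul_distrib]
    refine Finset.prod_eq_one fun i _ => ?_
    rw [← Finset.prod_mul_distrib]
    refine Finset.prod_eq_one fun j _ => ?_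
    split_ifs
    · exact neg_one_zpow_mul_self _
    · simp
  have h2 : koszulSign s p * koszulSign sᶜ p = (-1 : ℝ) ^ ((∑ i ∈ s, p i) * ∑ j ∈ sᶜ, p j) := by
    rw [koszulSign, koszulSign, compl_compl, Finset.prod_comm (s := sᶜ), ← Finset.prod_mul_distrib,
      Finset.sum_mul, ← prod_neg_one_zpow]
    refine Finset.prod_congr rfl fun i hi => ?_
    rw [← Finset.prod_mul_distrib, Finset.mul_sum, ← prod_neg_one_zpow]
    refine Finset.prod_congr rfl fun j hj => ?_
    have hij : i ≠ j := by
      rintro rfl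
      exact (Finset.mem_compl.1 hj) hi
    rcases lt_or_gt_of_ne hij with h | h
    · rw [if_neg (by exact not_lt_of_gt h), if_pos h, one_mul, mul_comm]
    · rw [if_pos h, if_neg (by exact not_lt_of_gt h), mul_one]
  rw [← h2, ← mul_assoc, h1, one_mul]

end KoszulSigns

/-! ### Higher derived brackets and their Jacobi identities. -/

section DerivedBrackets

variable {G : Type*} [AddCommGroup G] [Module ℝ G] {W : Type*} [AddCommGroup W] [Module ℝ W]
  (I : W →ₗ[ℝ] MultiOps G)

/-- `[…[[X, I(ξ₁)], I(ξ₂)],…, I(ξ_k)]` as a linear function of `X`. -/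
def nestedBracket : (k : ℕ) → (Fin k → W) → MultiOps G →ₗ[ℝ] MultiOps G
  | 0, _ => LinearMap.id
  | k + 1, ξ => nestedBracket k (Fin.tail ξ) ∘ₗ (schoutenJacobi G).flip (I (ξ 0))

theorem nestedBracket_succ (k : ℕ) (ξ : Fin (k + 1) → W) (X : MultiOps G) :
    nestedBracket I (k + 1) ξ X = nestedBracket I k (Fin.tail ξ) (schoutenJacobi G X (I (ξ 0))) := rfl

theorem nestedBracket_eq_foldl (k : ℕ) (ξ : Fin k → W) (X : MultiOps G) :
    nestedBracket I k ξ X = (List.ofFn ξ).foldl (fun D η => schoutenJacobi G D (I η)) X := by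
  induction k generalizing X with
  | zero => simp [nestedBracket]
  | succ k ih =>
    rw [nestedBracket_succ, ih, List.ofFn_succ, List.foldl_cons]
    rfl

theorem nestedBracket_update_add (k : ℕ) (ξ : Fin k → W) (i : Fin k) (x y : W) (X : MultiOps G) :
    nestedBracket I k (Function.update ξ i (x + y)) X =
      nestedBracket I k (Function.update ξ i x) X + nestedBracket I k (Function.update ξ i y) X := by
  induction k generalizing X with
  | zero => exact i.elim0
  | succ k ih =>
    simp only [nestedBracket_succ]
    refine Fin.cases ?_ (fun i => ?_) i
    · rw [Fin.tail_update_zero, Fin.tail_update_zero, Fin.tail_update_zero, ← map_add]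
      simp
    · rw [Fin.tail_update_succ, Fin.tail_update_succ, Fin.tail_update_succ, ih]
      simp [Function.update_of_ne (Fin.succ_ne_zero i).symm]

theorem nestedBracket_update_smul (k : ℕ) (ξ : Fin k → W) (i : Fin k) (c : ℝ) (x : W)
    (X : MultiOps G) : nestedBracket I k (Function.update ξ i (c • x)) X =
      c • nestedBracket I k (Function.update ξ i x) X := by
  induction k generalizing X with
  | zero => exact i.elim0
  | succ k ih =>
    simp only [nestedBracket_succ]
    refine Fin.cases ?_ (fun i => ?_) i
    · rw [Fin.tail_update_zero, Fin.tail_update_zero, ← map_smul]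
      simp
    · rw [Fin.tail_update_succ, Fin.tail_update_succ, ih]
      simp [Function.update_of_ne (Fin.succ_ne_zero i).symm]

variable {I} {gr : ℤ → Submodule ℝ W}

theorem nestedBracket_mem (hI : ∀ d, ∀ x ∈ gr d, I x ∈ opGrading G d)
    {k : ℕ} {p : Fin k → ℤ} {x : Fin k → W} (hx : ∀ j, x j ∈ gr (p j))
    {d : ℤ} {X : MultiOps G} (hX : X ∈ opGrading G d) :
    nestedBracket I k x X ∈ opGrading G (∑ j, p j + d) := by
  induction k generalizing X d with
  | zero => simpa [nestedBracket] using hX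
  | succ k ih =>
    have h := ih (p := Fin.tail p) (x := Fin.tail x) (fun j => hx j.succ)
      (schoutenJacobi_mem hX (hI _ _ (hx 0)))
    have e : ∑ j, Fin.tail p j + (d + p 0) = ∑ j, p j + d := by
      rw [Fin.sum_univ_succ]
      simp only [Fin.tail]
      ring
    rw [e] at h
    exact h

/-- The bracket with an element of an abelian subalgebra can be moved to the end. -/
theorem nestedBracket_bracket (hI : ∀ d, ∀ x ∈ gr d, I x ∈ opGrading G d)
    (hab : ∀ x y, schoutenJacobi G (I x) (I y) = 0)
    {k : ℕ} {p : Fin k → ℤ} {x : Fin k → W} (hx : ∀ j, x j ∈ gr (p j))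
    {d e : ℤ} {X : MultiOps G} (hX : X ∈ opGrading G d) {y : W} (hy : y ∈ gr e) :
    nestedBracket I k x (schoutenJacobi G X (I y)) =
      (-1 : ℝ) ^ (e * ∑ j, p j) • schoutenJacobi G (nestedBracket I k x X) (I y) := by
  induction k generalizing X d with
  | zero => simp [nestedBracket]
  | succ k ih =>
    -- The Leibniz rule exchanges `I y` and `I (x 0)`; the term containing their bracket vanishes.
    rw [nestedBracket_succ, nestedBracket_succ, schoutenJacobi_leibniz hX (hI _ _ hy) (hI _ _ (hx 0)),
      hab, map_zero, zero_add, map_smul,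
      ih (p := Fin.tail p) (x := Fin.tail x) (fun j => hx j.succ)
        (schoutenJacobi_mem hX (hI _ _ (hx 0))), smul_smul,
      ← neg_one_zpow_add, ← mul_add, Fin.sum_univ_succ]
    rfl

/-- For the first two entries this is the Leibniz rule with `[I x₀, I x₁] = 0`, and later neighbours
become the first two by induction. It yields the graded symmetry of the derived brackets. -/
theorem nestedBracket_swap (hI : ∀ d, ∀ x ∈ gr d, I x ∈ opGrading G d)
    (hab : ∀ x y, schoutenJacobi G (I x) (I y) = 0)
    {k : ℕ} {p : Fin k → ℤ} {x : Fin k → W} (hx : ∀ j, x j ∈ gr (p j))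
    {d : ℤ} {X : MultiOps G} (hX : X ∈ opGrading G d) (i j : Fin k) (hij : (j : ℕ) = i + 1) :
    nestedBracket I k (x ∘ Equiv.swap i j) X = (-1 : ℝ) ^ (p i * p j) • nestedBracket I k x X := by
  induction k generalizing X d with
  | zero => exact i.elim0
  | succ k ih =>
    obtain ⟨j, rfl⟩ : ∃ j' : Fin k, j = j'.succ := ⟨j.pred (by
      rintro rfl; simp at hij), by simp⟩
    induction i using Fin.cases with
    | zero =>
      rcases k with _ | k
      · exact j.elim0
      obtain rfl : j = 0 := by
        ext
        simp at hij
        simp [hij]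
      rw [nestedBracket_succ, nestedBracket_succ, nestedBracket_succ I (k + 1) x, nestedBracket_succ]
      have h1 : Fin.tail (Fin.tail (x ∘ Equiv.swap (0 : Fin (k + 2)) (Fin.succ 0))) =
          Fin.tail (Fin.tail x) := by
        funext m
        simp only [Fin.tail, Function.comp_apply]
        rw [Equiv.swap_apply_of_ne_of_ne (Fin.succ_ne_zero _)]
        simp [Fin.ext_iff]
      have h2 : (x ∘ Equiv.swap (0 : Fin (k + 2)) (Fin.succ 0)) 0 = x (Fin.succ 0) := by simp
      have h3 : Fin.tail (x ∘ Equiv.swap (0 : Fin (k + 2)) (Fin.succ 0)) 0 = x 0 := by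
        simp [Fin.tail]
      have h4 : Fin.tail x 0 = x (Fin.succ 0) := rfl
      rw [h1, h2, h3, h4, schoutenJacobi_leibniz hX (hI _ _ (hx (Fin.succ 0))) (hI _ _ (hx 0)), hab,
        map_zero, zero_add, map_smul, mul_comm]
    | succ i =>
      rw [nestedBracket_succ, nestedBracket_succ]
      have h1 : Fin.tail (x ∘ Equiv.swap i.succ j.succ) = Fin.tail x ∘ Equiv.swap i j := by
        funext m
        simp only [Fin.tail, Function.comp_apply]
        rw [← (Fin.succ_injective k).map_swap]
      have h2 : (x ∘ Equiv.swap i.succ j.succ) 0 = x 0 := by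
        simp only [Function.comp_apply]
        rw [Equiv.swap_apply_of_ne_of_ne (Fin.succ_ne_zero _).symm (Fin.succ_ne_zero _).symm]
      rw [h1, h2, ih (p := Fin.tail p) (x := Fin.tail x) (fun j => hx j.succ)
        (schoutenJacobi_mem hX (hI _ _ (hx 0))) i j
        (by simpa using hij)]
      rfl

variable (I) in
/-- The nested bracket with those entries of `x` whose index lies in `s`, in increasing order. -/
def subsetBracket {n : ℕ} (s : Finset (Fin n)) (x : Fin n → W) : MultiOps G →ₗ[ℝ] MultiOps G :=
  nestedBracket I s.card (x ∘ s.orderEmbOfFin rfl)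

theorem subsetBracket_eq_foldl {n : ℕ} (s : Finset (Fin n)) (x : Fin n → W) (X : MultiOps G) :
    subsetBracket I s x X = ((s.sort).map x).foldl (fun D η => schoutenJacobi G D (I η)) X := by
  rw [subsetBracket, nestedBracket_eq_foldl, List.ofFn_eq_map, ← List.map_map,
    Finset.listMap_orderEmbOfFin_finRange]

theorem subsetBracket_map_succ {n : ℕ} (s : Finset (Fin n)) (x : Fin (n + 1) → W) (X : MultiOps G) :
    subsetBracket I (s.map (Fin.succEmb n)) x X = subsetBracket I s (Fin.tail x) X := by
  rw [subsetBracket_eq_foldl, subsetBracket_eq_foldl, sort_map_succ, List.map_map]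
  rfl

theorem subsetBracket_insert_zero {n : ℕ} (s : Finset (Fin n)) (x : Fin (n + 1) → W)
    (X : MultiOps G) : subsetBracket I (insert 0 (s.map (Fin.succEmb n))) x X =
      subsetBracket I s (Fin.tail x) (schoutenJacobi G X (I (x 0))) := by
  rw [subsetBracket_eq_foldl, subsetBracket_eq_foldl, sort_insert_zero, List.map_cons, List.map_map,
    List.foldl_cons]
  rfl

theorem sum_orderEmbOfFin {n : ℕ} (s : Finset (Fin n)) (p : Fin n → ℤ) :
    ∑ j, (p ∘ s.orderEmbOfFin rfl) j = ∑ i ∈ s, p i := by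
  conv_rhs => rw [← Finset.map_orderEmbOfFin_univ s rfl, Finset.sum_map]
  rfl

theorem subsetBracket_mem (hI : ∀ d, ∀ x ∈ gr d, I x ∈ opGrading G d)
    {n : ℕ} {p : Fin n → ℤ} {x : Fin n → W} (hx : ∀ j, x j ∈ gr (p j))
    (s : Finset (Fin n)) {d : ℤ} {X : MultiOps G} (hX : X ∈ opGrading G d) :
    subsetBracket I s x X ∈ opGrading G (∑ j ∈ s, p j + d) := by
  rw [← sum_orderEmbOfFin s p]
  exact nestedBracket_mem hI (fun j => hx _) hX

/-- The iterated Leibniz rule. -/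
theorem nestedBracket_leibniz (hI : ∀ d, ∀ x ∈ gr d, I x ∈ opGrading G d)
    {n : ℕ} {p : Fin n → ℤ} {x : Fin n → W} (hx : ∀ j, x j ∈ gr (p j))
    {d e : ℤ} {X Y : MultiOps G} (hX : X ∈ opGrading G d) (hY : Y ∈ opGrading G e) :
    nestedBracket I n x (schoutenJacobi G X Y) =
      ∑ s : Finset (Fin n), (koszulSign s p * (-1 : ℝ) ^ (e * ∑ i ∈ s, p i)) •
        schoutenJacobi G (subsetBracket I s x X) (subsetBracket I sᶜ x Y) := by
  induction n generalizing X Y d e with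
  | zero =>
    rw [Fintype.sum_unique]
    rw [Subsingleton.elim (default : Finset (Fin 0)) ∅]
    simp only [koszulSign, Finset.prod_empty, Finset.sum_empty, mul_zero, zpow_zero,
      one_smul, mul_one]
    rw [subsetBracket_eq_foldl, subsetBracket_eq_foldl, Finset.sort_empty,
      Subsingleton.elim (∅ᶜ : Finset (Fin 0)) ∅, Finset.sort_empty]
    simp [nestedBracket]
  | succ n ih =>
    -- The entry `0` acts either on `Y`, and then lies in the complement of `s`, or on `X`, and then
    -- lies in `s` and has passed `Y`.
    rw [nestedBracket_succ, schoutenJacobi_leibniz hX hY (hI _ _ (hx 0)), map_add, map_smul,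
      ih (p := Fin.tail p) (x := Fin.tail x) (fun j => hx j.succ) hX (schoutenJacobi_mem hY (hI _ _ (hx 0))),
      ih (p := Fin.tail p) (x := Fin.tail x) (fun j => hx j.succ)
        (schoutenJacobi_mem hX (hI _ _ (hx 0))) hY,
      sum_finset_succ]
    congr 1
    · refine Finset.sum_congr rfl fun s _ => ?_
      rw [subsetBracket_map_succ, compl_map_succ, subsetBracket_insert_zero, koszulSign_map_succ,
        mul_assoc, ← neg_one_zpow_add, Finset.sum_map, add_comm e, add_mul]
      rfl
    · rw [Finset.smul_sum]
      refine Finset.sum_congr rfl fun s _ => ?_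
      rw [subsetBracket_insert_zero, compl_insert_zero, subsetBracket_map_succ,
        koszulSign_insert_zero, Finset.sum_insert (zero_notMem_map_succ s), Finset.sum_map, smul_smul,
        mul_add, neg_one_zpow_add]
      congr 1
      simp only [Fin.tail, Fin.coe_succEmb]
      ring

/-- The higher Jacobi identities for higher derived brackets. -/
theorem derivedBracket_jacobi (hI : ∀ d, ∀ x ∈ gr d, I x ∈ opGrading G d)
    (hab : ∀ x y, schoutenJacobi G (I x) (I y) = 0)
    (P : MultiOps G →ₗ[ℝ] W) (hPgr : ∀ d, ∀ X ∈ opGrading G d, P X ∈ gr d)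
    (H : Submodule ℝ (MultiOps G)) (hH : ∀ X ∈ H, ∀ Y ∈ H, schoutenJacobi G X Y ∈ H)
    (hIH : ∀ x, I x ∈ H)
    (hP : ∀ X ∈ H, ∀ Y ∈ H, P (schoutenJacobi G X Y) =
      P (schoutenJacobi G (I (P X)) Y) + P (schoutenJacobi G X (I (P Y))))
    {J : MultiOps G} (hJ : J ∈ opGrading G 1) (hJH : J ∈ H) (hJJ : schoutenJacobi G J J = 0)
    {n : ℕ} {p : Fin n → ℤ} {x : Fin n → W} (hx : ∀ j, x j ∈ gr (p j)) :
    ∑ s : Finset (Fin n), koszulSign s p • P (nestedBracket I (sᶜ.card + 1)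
      (Fin.cons (P (nestedBracket I s.card (x ∘ s.orderEmbOfFin rfl) J))
        (x ∘ sᶜ.orderEmbOfFin rfl)) J) = 0 := by
  have hE : ∀ s, subsetBracket I s x J ∈ opGrading G (∑ j ∈ s, p j + 1) := fun s =>
    subsetBracket_mem hI hx s hJ
  have hEH : ∀ s, subsetBracket I s x J ∈ H := by
    intro s
    rw [subsetBracket]
    generalize x ∘ s.orderEmbOfFin rfl = y
    generalize s.card = k at y
    suffices h : ∀ X ∈ H, nestedBracket I k y X ∈ H from h J hJH
    induction k with
    | zero => exact fun X hX => hX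
    | succ k ih => exact fun X hX => ih _ _ (hH _ hX _ (hIH _))
  -- Let `J_s` be the nested bracket of `J` with the entries in `s`. Then `A s` is the summand of
  -- `s` in the Jacobi identity, brought into the form `P [I P J_s, J_{sᶜ}]` with a sign.
  set A : Finset (Fin n) → W := fun s => (koszulSign s p * (-1 : ℝ) ^ (∑ i ∈ s, p i)) •
    P (schoutenJacobi G (I (P (subsetBracket I s x J))) (subsetBracket I sᶜ x J)) with hA
  -- The lift of `P J_s` is moved behind the other lifts, which commute with it, and then in front
  -- of the bracket by antisymmetry.
  have h1 : ∀ s : Finset (Fin n), koszulSign s p • P (nestedBracket I (sᶜ.card + 1)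
      (Fin.cons (P (nestedBracket I s.card (x ∘ s.orderEmbOfFin rfl) J))
        (x ∘ sᶜ.orderEmbOfFin rfl)) J) = A s := by
    intro s
    have hm := hPgr _ _ (hE s)
    rw [nestedBracket_succ, Fin.tail_cons, Fin.cons_zero]
    change koszulSign s p • P (nestedBracket I _ _ (schoutenJacobi G J (I (P (subsetBracket I s x J))))) = _
    rw [nestedBracket_bracket (p := p ∘ sᶜ.orderEmbOfFin rfl) (x := x ∘ sᶜ.orderEmbOfFin rfl) hI hab (fun j => hx _) hJ hm,
      sum_orderEmbOfFin]
    change koszulSign s p • P (_ • schoutenJacobi G (subsetBracket I sᶜ x J) _) = _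
    rw [schoutenJacobi_antisymm (hE sᶜ) (hI _ _ hm), smul_neg, map_neg, smul_smul, map_smul, hA,
      ← neg_one_zpow_add, ← neg_smul, smul_smul]
    congr 2
    rw [show (∑ j ∈ s, p j + 1) * ∑ i ∈ sᶜ, p i + (∑ j ∈ sᶜ, p j + 1) * (∑ j ∈ s, p j + 1) =
      ∑ j ∈ s, p j + (1 + 2 * ((∑ j ∈ s, p j + 1) * ∑ i ∈ sᶜ, p i)) by ring, neg_one_zpow_add,
      neg_one_zpow_add, (even_two_mul _).neg_one_zpow]
    simp
  -- The projection identity splits each term in the expansion of `[J, J]` into the summands of `s`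
  -- and of `sᶜ`.
  have h2 : ∀ s : Finset (Fin n), (koszulSign s p * (-1 : ℝ) ^ ((1 : ℤ) * ∑ i ∈ s, p i)) •
      P (schoutenJacobi G (subsetBracket I s x J) (subsetBracket I sᶜ x J)) = A s + A sᶜ := by
    intro s
    rw [hP _ (hEH s) _ (hEH sᶜ), smul_add, one_mul]
    congr 1
    rw [hA, schoutenJacobi_antisymm (hE s) (hI _ _ (hPgr _ _ (hE sᶜ))), map_neg, map_smul, smul_neg,
      smul_smul, ← neg_smul]
    simp only [compl_compl]
    rw [koszulSign_compl]
    congr 1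
    rw [show (∑ j ∈ s, p j + 1) * (∑ j ∈ sᶜ, p j + 1) =
      ∑ j ∈ s, p j + ((∑ j ∈ s, p j) * (∑ j ∈ sᶜ, p j) + (∑ j ∈ sᶜ, p j + 1)) by ring,
      neg_one_zpow_add, neg_one_zpow_add _ (∑ j ∈ sᶜ, p j + 1), neg_one_zpow_add _ 1]
    have := neg_one_zpow_mul_self (∑ j ∈ s, p j)
    simp only [zpow_one]
    linear_combination (koszulSign s p * (-1 : ℝ) ^ ((∑ j ∈ s, p j) * (∑ j ∈ sᶜ, p j)) *
      (-1 : ℝ) ^ (∑ j ∈ sᶜ, p j)) * this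
  -- Complementation permutes the subsets, so `[J, J] = 0` gives the desired sum twice.
  have h3 : (0 : W) = ∑ s, A s + ∑ s, A s := by
    have h := congrArg P (nestedBracket_leibniz hI hx hJ hJ)
    rw [hJJ, map_zero, map_zero, map_sum] at h
    rw [h, ← Finset.sum_add_distrib.trans (congrArg (_ + ·) (Equiv.sum_comp (compl_involutive.toPerm _) A))]
    refine Finset.sum_congr rfl fun s _ => ?_
    rw [map_smul, h2]
    rfl
  rw [Finset.sum_congr rfl fun s _ => h1 s]
  have h4 : (2 : ℝ) • ∑ s, A s = 0 := by rw [two_smul, ← h3]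
  exact (smul_eq_zero.1 h4).resolve_left two_ne_zero

end DerivedBrackets

/-! ### Hadamard's lemma relative to a smooth map. -/

section Hadamard

open MeasureTheory Set in
/-- Hadamard's lemma relative to a smooth map `R`. -/
theorem exists_hadamard {E : Type*} [NormedAddCommGroup E] [NormedSpace ℝ E]
    [FiniteDimensional ℝ E] {f : E → ℝ} (hf : ContDiff ℝ ∞ f) {R : E → E} (hR : ContDiff ℝ ∞ R) :
    ∃ g : E → E →L[ℝ] ℝ, ContDiff ℝ ∞ g ∧ (∀ z, f z - f (R z) = g z (z - R z)) ∧
      ∀ z, R z = z → g z = fderiv ℝ f z := by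
  have hf' : ContDiff ℝ ∞ (fderiv ℝ f) := hf.fderiv_right (by simp)
  -- The factor `g` is the integral of the derivative over the segment from `R z` to `z`. To get
  -- smoothness in `z` it is written as a convolution with the indicator function of `[0, 1]`,
  -- evaluated at `0`; hence the parameter `-t`. The bump `χ` makes the kernel compactly supported
  -- and equals `1` at the arguments in `[-1, 0]` that matter.
  let χ : ContDiffBump (0 : ℝ) := ⟨2, 3, by norm_num, by norm_num⟩
  let h : E → ℝ → E →L[ℝ] ℝ := fun z t => χ t • fderiv ℝ f (R z + (-t) • (z - R z))
  have hh : ContDiff ℝ ∞ (Function.uncurry h) := by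
    have h1 : ContDiff ℝ ∞ fun q : E × ℝ => R q.1 + (-q.2) • (q.1 - R q.1) := by fun_prop
    exact (χ.contDiff.comp contDiff_snd).smul (hf'.comp h1)
  let ind : ℝ → ℝ := (Icc (0 : ℝ) 1).indicator fun _ => 1
  have hind : LocallyIntegrable ind volume :=
    (integrable_indicator_iff measurableSet_Icc |>.2 (by simp)).locallyIntegrable
  let L := ContinuousLinearMap.lsmul ℝ ℝ (E := E →L[ℝ] ℝ)
  have hsm := contDiffOn_convolution_right_with_param (μ := volume) (n := ⊤) L (f := ind) (g := h)
    (s := univ) (k := Metric.closedBall 0 3) isOpen_univ (isCompact_closedBall _ _)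
    (fun p x _ hx => by
      have : χ x = 0 := χ.zero_of_le_dist (by
        simp only [Metric.mem_closedBall, not_le] at hx
        exact hx.le)
      simp [h, this]) hind (by exact hh.contDiffOn)
  let g : E → E →L[ℝ] ℝ := fun z => ∫ t in (0 : ℝ)..1, fderiv ℝ f (R z + t • (z - R z))
  have hg : ∀ z, g z = (convolution ind (h z) L volume) 0 := by
    intro z
    rw [convolution]
    simp only [g, intervalIntegral.integral_of_le zero_le_one, ← integral_Icc_eq_integral_Ioc]
    rw [← integral_indicator measurableSet_Icc]
    refine integral_congr_ae (Filter.Eventually.of_forall fun t => ?_)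
    simp only [L, ind, ContinuousLinearMap.lsmul_apply]
    by_cases ht : t ∈ Icc (0 : ℝ) 1
    · have h1 : χ (0 - t) = 1 := χ.one_of_mem_closedBall (by
        rw [mem_closedBall_zero_iff, Real.norm_eq_abs, abs_le]
        constructor <;> simp [χ] <;> linarith [ht.1, ht.2])
      rw [indicator_of_mem ht, indicator_of_mem ht]
      rw [zero_sub] at h1
      simp only [h, h1, one_smul, zero_sub, neg_neg]
    · rw [indicator_of_notMem ht, indicator_of_notMem ht, zero_smul]
  refine ⟨g, ?_, fun z => ?_, fun z hz => ?_⟩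
  · have h1 : ContDiff ℝ ∞ fun q : E × ℝ => (convolution ind (h q.1) L volume) q.2 := by
      rw [univ_prod_univ] at hsm
      exact contDiffOn_univ.1 hsm
    have h2 : g = (fun q : E × ℝ => (convolution ind (h q.1) L volume) q.2) ∘ fun z => (z, 0) :=
      funext hg
    rw [h2]
    exact h1.comp (contDiff_id.prodMk contDiff_const)
  · have hd : ∀ t ∈ uIcc (0 : ℝ) 1, HasDerivAt (fun t : ℝ => f (R z + t • (z - R z)))
        (fderiv ℝ f (R z + t • (z - R z)) (z - R z)) t := by
      intro t _
      have h1 : HasDerivAt (fun t : ℝ => R z + t • (z - R z)) (z - R z) t := by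
        simpa using ((hasDerivAt_id t).smul_const (z - R z)).const_add (R z)
      exact ((hf.differentiable (by simp)).differentiableAt.hasFDerivAt).comp_hasDerivAt t h1
    have hc : Continuous fun t : ℝ => fderiv ℝ f (R z + t • (z - R z)) :=
      hf'.continuous.comp (by fun_prop)
    have h2 := intervalIntegral.integral_eq_sub_of_hasDerivAt hd
      ((hc.clm_apply continuous_const).intervalIntegrable _ _)
    simp only [one_smul, add_sub_cancel, zero_smul, add_zero] at h2
    rw [← h2]
    exact (ContinuousLinearMap.intervalIntegral_apply (hc.intervalIntegrable _ _) _).symm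
  · simp [g, hz]

end Hadamard

/-! ### Global extensions of germs of sections and functions. -/

section Bump

variable {EX HX : Type*} [NormedAddCommGroup EX] [NormedSpace ℝ EX] [FiniteDimensional ℝ EX]
  [TopologicalSpace HX] {IX : ModelWithCorners ℝ EX HX} {X : Type*} [TopologicalSpace X]
  [ChartedSpace HX X] [IsManifold IX ∞ X] [T2Space X]
  {K : Type*} [NormedAddCommGroup K] [NormedSpace ℝ K]
  {V : X → Type*} [∀ x, AddCommGroup (V x)] [∀ x, Module ℝ (V x)] [∀ x, TopologicalSpace (V x)]
  [TopologicalSpace (TotalSpace K V)] [FiberBundle K V] [VectorBundle ℝ K V]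
  [ContMDiffVectorBundle ∞ K V IX]

theorem exists_bump {x : X} {U : Set X} (hU : U ∈ nhds x) :
    ∃ χ : C^∞⟮IX, X; ℝ⟯, (∀ᶠ y in nhds x, χ y = 1) ∧ tsupport χ ⊆ U := by
  obtain ⟨f, _, hf⟩ := (SmoothBumpFunction.nhds_basis_tsupport (I := IX) x).mem_iff.1 hU
  exact ⟨⟨f, f.contMDiff⟩, f.eventuallyEq_one, hf⟩

/-- Local sections extend, after shrinking, to global ones. -/
theorem exists_section_eventuallyEq (σ : ∀ y, V y) {x : X}
    (h : ∀ᶠ y in nhds x, ContMDiffAt IX (IX.prod 𝓘(ℝ, K)) ∞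
      (fun y => (⟨y, σ y⟩ : TotalSpace K V)) y) :
    ∃ s : Cₛ^∞⟮IX; K, V⟯, ∀ᶠ y in nhds x, s y = σ y := by
  obtain ⟨U, hU, hUo, hxU⟩ := eventually_nhds_iff.1 h
  obtain ⟨χ, h1, h2⟩ := exists_bump (IX := IX) (hUo.mem_nhds hxU)
  refine ⟨⟨fun y => χ y • σ y, ?_⟩, ?_⟩
  · exact ContMDiffOn.smul_section_of_tsupport χ.contMDiff.contMDiffOn hUo h2
      fun y hy => (hU y hy).contMDiffWithinAt
  · filter_upwards [h1] with y hy
    change χ y • σ y = σ y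
    rw [hy, one_smul]

/-- Local smooth functions extend, after shrinking, to global ones. -/
theorem exists_function_eventuallyEq (f : X → ℝ) {x : X}
    (h : ∀ᶠ y in nhds x, ContMDiffAt IX 𝓘(ℝ, ℝ) ∞ f y) :
    ∃ g : C^∞⟮IX, X; ℝ⟯, ∀ᶠ y in nhds x, g y = f y := by
  obtain ⟨U, hU, hUo, hxU⟩ := eventually_nhds_iff.1 h
  obtain ⟨χ, h1, h2⟩ := exists_bump (IX := IX) (hUo.mem_nhds hxU)
  refine ⟨⟨fun y => χ y • f y, ?_⟩, ?_⟩
  · refine contMDiff_of_tsupport fun y hy => ?_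
    have hy' : y ∈ tsupport χ := closure_mono (Function.support_smul_subset_left _ _) hy
    exact χ.contMDiff.contMDiffAt.smul (hU y (h2 hy'))
  · filter_upwards [h1] with y hy
    change χ y • f y = f y
    rw [hy, one_smul]

/-- Every vector in a fibre is the value of a section, which is nowhere zero nearby when the vector
is not zero and the fibre is a line. -/
theorem exists_section_apply (x : X) (v : V x) :
    ∃ s : Cₛ^∞⟮IX; K, V⟯, s x = v ∧
      ∀ᶠ y in nhds x, s y = (trivializationAt K V x).symm y (trivializationAt K V x ⟨x, v⟩).2 := by
  set t := trivializationAt K V x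
  have hx := mem_baseSet_trivializationAt K V x
  obtain ⟨s, hs⟩ := exists_section_eventuallyEq (IX := IX) (V := V) (x := x)
    (fun y => t.symm y (t ⟨x, v⟩).2) (by
      filter_upwards [t.open_baseSet.mem_nhds hx] with y hy
      rw [t.contMDiffAt_section_iff hy]
      refine (contMDiffAt_const (c := (t ⟨x, v⟩).2)).congr_of_eventuallyEq ?_
      filter_upwards [t.open_baseSet.mem_nhds hy] with z hz
      rw [t.apply_mk_symm hz])
  refine ⟨s, ?_, hs⟩
  rw [hs.self_of_nhds, t.symm_apply_apply_mk hx]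

theorem section_coord_contMDiffAt (s : Cₛ^∞⟮IX; K, V⟯) (x y : X)
    (hy : y ∈ (trivializationAt K V x).baseSet) :
    ContMDiffAt IX 𝓘(ℝ, K) ∞ (fun z => (trivializationAt K V x ⟨z, s z⟩).2) y :=
  ((trivializationAt K V x).contMDiffAt_section_iff hy).1 s.contMDiff.contMDiffAt

end Bump

/-! ### First order operators on line bundles and their symbols. -/

section FirstOrder

variable {EX HX : Type*} [NormedAddCommGroup EX] [NormedSpace ℝ EX] [FiniteDimensional ℝ EX]
  [TopologicalSpace HX] {IX : ModelWithCorners ℝ EX HX} {X : Type*} [TopologicalSpace X]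
  [ChartedSpace HX X] [IsManifold IX ∞ X] [T2Space X]
  {V : X → Type*} [∀ x, AddCommGroup (V x)] [∀ x, Module ℝ (V x)] [∀ x, TopologicalSpace (V x)]
  [TopologicalSpace (TotalSpace ℝ V)] [FiberBundle ℝ V] [VectorBundle ℝ ℝ V]
  [ContMDiffVectorBundle ∞ ℝ V IX]

theorem section_sum_apply {ι : Type*} (u : Finset ι) (s : ι → Cₛ^∞⟮IX; ℝ, V⟯) (x : X) :
    (∑ j ∈ u, s j) x = ∑ j ∈ u, s j x := by
  have h := map_sum (ContMDiffSection.coeAddHom IX ℝ ∞ V) s u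
  exact (congrFun h x).trans (Finset.sum_apply _ _ _)

theorem section_smul_add (f : C^∞⟮IX, X; ℝ⟯) (s t : Cₛ^∞⟮IX; ℝ, V⟯) :
    f • (s + t) = f • s + f • t := ContMDiffSection.ext fun x => smul_add (f x) (s x) (t x)

theorem section_add_smul (f g : C^∞⟮IX, X; ℝ⟯) (s : Cₛ^∞⟮IX; ℝ, V⟯) :
    (f + g) • s = f • s + g • s := ContMDiffSection.ext fun x => add_smul (f x) (g x) (s x)

theorem section_mul_smul (f g : C^∞⟮IX, X; ℝ⟯) (s : Cₛ^∞⟮IX; ℝ, V⟯) :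
    (f * g) • s = f • g • s := ContMDiffSection.ext fun x => mul_smul (f x) (g x) (s x)

theorem section_smul_comm (f g : C^∞⟮IX, X; ℝ⟯) (s : Cₛ^∞⟮IX; ℝ, V⟯) :
    f • g • s = g • f • s := ContMDiffSection.ext fun x => smul_comm (f x) (g x) (s x)

theorem section_smul_real (c : ℝ) (f : C^∞⟮IX, X; ℝ⟯) (s : Cₛ^∞⟮IX; ℝ, V⟯) :
    f • c • s = c • f • s := ContMDiffSection.ext fun x => smul_comm (f x) c (s x)

/-- A section which is not zero near `x` spans the sections near `x`. -/
theorem exists_frame (x : X) : ∃ e : Cₛ^∞⟮IX; ℝ, V⟯, (∀ᶠ y in nhds x, e y ≠ 0) ∧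
    ∀ s : Cₛ^∞⟮IX; ℝ, V⟯, ∃ H : C^∞⟮IX, X; ℝ⟯, ∀ᶠ y in nhds x, s y = (H • e) y := by
  set t := trivializationAt ℝ V x
  have hx := mem_baseSet_trivializationAt ℝ V x
  obtain ⟨e, -, he⟩ := exists_section_apply (IX := IX) (K := ℝ) (V := V) x (t.symm x 1)
  have h1 : (t ⟨x, t.symm x 1⟩).2 = 1 := by rw [t.apply_mk_symm hx]
  rw [h1] at he
  have hb := t.open_baseSet.mem_nhds hx
  refine ⟨e, ?_, fun s => ?_⟩
  · filter_upwards [he, hb] with y hy hyb h0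
    rw [hy] at h0
    have h3 := congrArg (fun v => (t ⟨y, v⟩).2) h0
    have h2 : (t ⟨y, (0 : V y)⟩).2 = 0 := by
      have := t.zeroSection ℝ hyb
      exact congrArg Prod.snd this
    simp only [h2] at h3
    exact one_ne_zero ((congrArg Prod.snd (t.apply_mk_symm hyb 1)).symm.trans h3)
  · obtain ⟨H, hH⟩ := exists_function_eventuallyEq (IX := IX) (x := x) (fun y => (t ⟨y, s y⟩).2) (by
      filter_upwards [hb] with y hy
      exact section_coord_contMDiffAt s x y hy)
    refine ⟨H, ?_⟩
    filter_upwards [he, hb, hH] with y hy hyb hHy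
    rw [section_smul_apply, hy, hHy]
    have h2 := (t.symmₗ ℝ y).map_smul (t ⟨y, s y⟩).2 1
    rw [smul_eq_mul, mul_one] at h2
    rw [← t.coe_symmₗ (R := ℝ) hyb, ← h2, t.coe_symmₗ hyb, t.symm_apply_apply_mk hyb]

theorem exists_section_ne_zero (x : X) : ∃ e : Cₛ^∞⟮IX; ℝ, V⟯, e x ≠ 0 := by
  obtain ⟨e, he, -⟩ := exists_frame (IX := IX) (V := V) x
  exact ⟨e, he.self_of_nhds⟩

theorem smul_section_injective {f g : C^∞⟮IX, X; ℝ⟯}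
    (h : ∀ s : Cₛ^∞⟮IX; ℝ, V⟯, f • s = g • s) : f = g := by
  ext x
  obtain ⟨e, he⟩ := exists_section_ne_zero (IX := IX) (V := V) x
  exact smul_left_injective ℝ he (congrArg (fun s => s x) (h e))

/-- First order operators are local. -/
theorem IsFirstOrder.apply_eq_zero {D : Cₛ^∞⟮IX; ℝ, V⟯ →ₗ[ℝ] Cₛ^∞⟮IX; ℝ, V⟯}
    (hD : IsFirstOrder D) {s : Cₛ^∞⟮IX; ℝ, V⟯} {x : X} (hs : ∀ᶠ y in nhds x, s y = 0) :
    D s x = 0 := by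
  -- The support of `χ` lies in the zero set of `s`, so `χ s = 0`, and at `x`, where `χ = 1`, the
  -- first order identity for `χ, χ, s` reduces to `D s x = 0`.
  obtain ⟨χ, h1, h2⟩ := exists_bump (IX := IX) hs
  have h0 : χ • s = 0 := by
    refine ContMDiffSection.ext fun y => ?_
    change χ y • s y = 0
    by_cases hy : y ∈ tsupport χ
    · rw [show s y = 0 from h2 hy, smul_zero]
    · rw [image_eq_zero_of_notMem_tsupport hy, zero_smul]
  have h3 := congrArg (fun r => r x) (hD χ χ s)
  have h4 : (χ • D (χ • s)) x = 0 := by rw [h0, map_zero, section_smul_apply]; exact smul_zero _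
  have h5 : D (χ • χ • s) x = 0 := by
    rw [h0, show χ • (0 : Cₛ^∞⟮IX; ℝ, V⟯) = 0 from ContMDiffSection.ext fun y => smul_zero _,
      map_zero]; rfl
  have h6 : (χ • χ • D s) x = D s x := by
    rw [section_smul_apply, section_smul_apply, h1.self_of_nhds, one_smul, one_smul]
  change D (χ • χ • s) x - (χ • D (χ • s)) x - (χ • D (χ • s)) x + (χ • χ • D s) x = 0 at h3
  rwa [h4, h5, h6, sub_zero, sub_zero, zero_add] at h3

theorem IsFirstOrder.congr_apply {D : Cₛ^∞⟮IX; ℝ, V⟯ →ₗ[ℝ] Cₛ^∞⟮IX; ℝ, V⟯}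
    (hD : IsFirstOrder D) {s t : Cₛ^∞⟮IX; ℝ, V⟯} {x : X} (hs : ∀ᶠ y in nhds x, s y = t y) :
    D s x = D t x := by
  have h := hD.apply_eq_zero (s := s - t) (x := x) (by
    filter_upwards [hs] with y hy
    change s y - t y = 0
    rw [hy, sub_self])
  rw [map_sub] at h
  exact sub_eq_zero.1 h

/-- `C^∞`-linear operators on the sections of a line bundle are given by smooth functions. -/
theorem exists_eq_smul {T : Cₛ^∞⟮IX; ℝ, V⟯ →ₗ[ℝ] Cₛ^∞⟮IX; ℝ, V⟯}
    (hT : ∀ (f : C^∞⟮IX, X; ℝ⟯) s, T (f • s) = f • T s) :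
    ∃ c : C^∞⟮IX, X; ℝ⟯, ∀ s, T s = c • s := by
  have hF : IsFirstOrder T := fun f g s => by
    simp only [hT]
    rw [section_smul_comm g f]
    abel
  -- Near `x` the factor is the coefficient of `T e` in a frame `e`. At a nearby `y`, both `e` and
  -- `s` are written as `A e'` and `B e'` in a frame `e'` at `y`, and `T` is applied to the local
  -- relation `A s = B e`.
  have key : ∀ x, ∃ c : C^∞⟮IX, X; ℝ⟯, ∀ᶠ y in nhds x, ∀ s, T s y = c y • s y := by
    intro x
    obtain ⟨e, he, h⟩ := exists_frame (IX := IX) (V := V) x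
    obtain ⟨c, hc⟩ := h (T e)
    refine ⟨c, ?_⟩
    filter_upwards [hc, he, he.eventually_nhds] with y hy hy0 hyn s
    obtain ⟨e', -, h'⟩ := exists_frame (IX := IX) (V := V) y
    obtain ⟨A, hA⟩ := h' e
    obtain ⟨B, hB⟩ := h' s
    have hne : A y ≠ 0 := fun h0 => hy0 (by
      rw [hA.self_of_nhds, section_smul_apply, h0, zero_smul])
    have h1 : T (A • s) y = T (B • e) y := by
      refine hF.congr_apply ?_
      filter_upwards [hA, hB] with z hz hz'
      rw [section_smul_apply, section_smul_apply, hz, hz', section_smul_apply, section_smul_apply,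
        smul_comm]
    rw [hT, hT, section_smul_apply, section_smul_apply, hy, section_smul_apply] at h1
    have h2 : A y • s y = B y • e y := by
      rw [hA.self_of_nhds, hB.self_of_nhds, section_smul_apply, section_smul_apply, smul_comm]
    rw [smul_comm, ← h2, smul_comm] at h1
    exact smul_right_injective _ hne h1
  choose c hc using key
  refine ⟨⟨fun x => c x x, fun x => ?_⟩, fun s => ContMDiffSection.ext fun x =>
    (hc x).self_of_nhds s⟩
  refine (c x).contMDiff.contMDiffAt.congr_of_eventuallyEq ?_
  filter_upwards [hc x] with y hy
  obtain ⟨e, he⟩ := exists_section_ne_zero (IX := IX) (V := V) y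
  exact smul_left_injective ℝ he (((hc y).self_of_nhds e).symm.trans (hy e))

/-- The symbol of a first order operator. -/
theorem IsFirstOrder.exists_symbol {D : Cₛ^∞⟮IX; ℝ, V⟯ →ₗ[ℝ] Cₛ^∞⟮IX; ℝ, V⟯}
    (hD : IsFirstOrder D) : ∃ ρ : Derivation ℝ C^∞⟮IX, X; ℝ⟯ C^∞⟮IX, X; ℝ⟯,
      ∀ (f : C^∞⟮IX, X; ℝ⟯) s, D (f • s) = f • D s + ρ f • s := by
  have h : ∀ f : C^∞⟮IX, X; ℝ⟯, ∃ c : C^∞⟮IX, X; ℝ⟯, ∀ s, D (f • s) = f • D s + c • s := by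
    intro f
    -- The commutator of `D` with multiplication by `f` is linear over functions. As the rank is
    -- one, it is multiplication by a function, the value of the symbol at `f`.
    let T : Cₛ^∞⟮IX; ℝ, V⟯ →ₗ[ℝ] Cₛ^∞⟮IX; ℝ, V⟯ :=
      { toFun := fun s => D (f • s) - f • D s
        map_add' := fun s t => by
          rw [section_smul_add, map_add, map_add, section_smul_add]; abel
        map_smul' := fun c s => by
          rw [section_smul_real, D.map_smul, D.map_smul, section_smul_real, RingHom.id_apply, smul_sub] }
    obtain ⟨c, hc⟩ := exists_eq_smul (T := T) (fun g s => by
      have h1 := hD f g s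
      have h2 : D (f • g • s) - f • D (g • s) = g • (D (f • s) - f • D s) := by
        have h3 : g • (D (f • s) - f • D s) = g • D (f • s) - f • g • D s := by
          rw [section_smul_comm f g]
          exact ContMDiffSection.ext fun x => smul_sub (g x) _ _
        rw [h3, ← sub_eq_zero, ← h1]
        abel
      exact h2)
    exact ⟨c, fun s => by rw [← hc s]; exact (add_sub_cancel (f • D s) (D (f • s))).symm⟩
  choose ρ hρ using h
  -- The factor is unique; this makes `ρ` linear and a derivation.
  have hu : ∀ f c, (∀ s, D (f • s) = f • D s + c • s) → ρ f = c := fun f c hc =>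
    smul_section_injective (IX := IX) (V := V) fun s => add_left_cancel ((hρ f s).symm.trans (hc s))
  have hmul : ∀ f g, ρ (f * g) = f • ρ g + g • ρ f := fun f g => hu _ _ fun s => by
    rw [section_mul_smul, hρ, hρ, section_mul_smul]
    refine ContMDiffSection.ext fun x => ?_
    change f x • (g x • D s x + ρ g x • s x) + ρ f x • g x • s x = f x • g x • D s x +
      (f x * ρ g x + g x * ρ f x) • s x
    module
  refine ⟨Derivation.mk' { toFun := ρ, map_add' := ?_, map_smul' := ?_ } hmul, hρ⟩
  · intro f g
    refine hu _ _ fun s => ?_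
    rw [section_add_smul, map_add, hρ, hρ, section_add_smul, section_add_smul]
    abel
  · intro c f
    refine hu _ _ fun s => ?_
    have h1 : (c • f) • s = c • f • s := ContMDiffSection.ext fun x => smul_assoc c (f x) (s x)
    have h2 : (c • ρ f) • s = c • ρ f • s := ContMDiffSection.ext fun x => smul_assoc c (ρ f x) (s x)
    have h3 : (c • f) • D s = c • f • D s :=
      ContMDiffSection.ext fun x => smul_assoc c (f x) (D s x)
    rw [h1, map_smul, hρ, RingHom.id_apply, h2, h3, smul_add]

theorem isFirstOrder_of_symbol {D : Cₛ^∞⟮IX; ℝ, V⟯ →ₗ[ℝ] Cₛ^∞⟮IX; ℝ, V⟯}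
    {ρ : C^∞⟮IX, X; ℝ⟯ → C^∞⟮IX, X; ℝ⟯}
    (h : ∀ (f : C^∞⟮IX, X; ℝ⟯) s, D (f • s) = f • D s + ρ f • s) : IsFirstOrder D := by
  intro f g s
  rw [h f (g • s), h f s, section_smul_add, section_smul_comm g f, section_smul_comm g (ρ f)]
  abel

variable (IX V) in
/-- The first order differential operators on the sections of a line bundle. -/
def firstOrderOps : Submodule ℝ (Cₛ^∞⟮IX; ℝ, V⟯ →ₗ[ℝ] Cₛ^∞⟮IX; ℝ, V⟯) where
  carrier := {D | IsFirstOrder D}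
  zero_mem' := isFirstOrder_of_symbol (ρ := 0) fun f s => ContMDiffSection.ext fun x => by
    change (0 : V x) = f x • (0 : V x) + (0 : ℝ) • s x
    simp
  add_mem' := fun {A B} hA hB => by
    obtain ⟨α, hα⟩ := IsFirstOrder.exists_symbol hA
    obtain ⟨β, hβ⟩ := IsFirstOrder.exists_symbol hB
    refine isFirstOrder_of_symbol (ρ := α + β) fun f s => ?_
    rw [LinearMap.add_apply, hα, hβ, LinearMap.add_apply, section_smul_add, Pi.add_apply,
      section_add_smul]
    abel
  smul_mem' := fun c A hA => by
    obtain ⟨α, hα⟩ := IsFirstOrder.exists_symbol hA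
    refine isFirstOrder_of_symbol (ρ := c • α) fun f s => ?_
    rw [LinearMap.smul_apply, hα, LinearMap.smul_apply, smul_add, section_smul_real]
    congr 1
    exact ContMDiffSection.ext fun x => (smul_assoc c (α f x) (s x)).symm

/-- Since the symbols are scalar, the mixed terms cancel and the commutator of the symbols is a
symbol for the commutator. -/
theorem firstOrderOps_commutator (A : Cₛ^∞⟮IX; ℝ, V⟯ →ₗ[ℝ] Cₛ^∞⟮IX; ℝ, V⟯)
    (hA : A ∈ firstOrderOps IX V) (B : Cₛ^∞⟮IX; ℝ, V⟯ →ₗ[ℝ] Cₛ^∞⟮IX; ℝ, V⟯)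
    (hB : B ∈ firstOrderOps IX V) : A ∘ₗ B - B ∘ₗ A ∈ firstOrderOps IX V := by
  obtain ⟨α, hα⟩ := IsFirstOrder.exists_symbol hA
  obtain ⟨β, hβ⟩ := IsFirstOrder.exists_symbol hB
  refine isFirstOrder_of_symbol (ρ := fun f => α (β f) - β (α f)) fun f s => ?_
  simp only [LinearMap.sub_apply, LinearMap.comp_apply, hα, hβ, map_add]
  refine ContMDiffSection.ext fun x => ?_
  change f x • A (B s) x + α f x • B s x + (β f x • A s x + α (β f) x • s x) -
    (f x • B (A s) x + β f x • A s x + (α f x • B s x + β (α f) x • s x)) =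
    f x • (A (B s) x - B (A s) x) + (α (β f) x - β (α f) x) • s x
  module

/-- A first order operator sends products of functions and sections vanishing at `x` to sections
vanishing at `x`. -/
theorem IsFirstOrder.apply_sum_smul_eq_zero {D : Cₛ^∞⟮IX; ℝ, V⟯ →ₗ[ℝ] Cₛ^∞⟮IX; ℝ, V⟯}
    (hD : IsFirstOrder D) {ι : Type*} [Fintype ι] {f : ι → C^∞⟮IX, X; ℝ⟯}
    {r : ι → Cₛ^∞⟮IX; ℝ, V⟯} {s : Cₛ^∞⟮IX; ℝ, V⟯} {x : X}
    (hs : ∀ᶠ y in nhds x, s y = (∑ j, f j • r j) y) (hf : ∀ j, f j x = 0) (hr : ∀ j, r j x = 0) :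
    D s x = 0 := by
  obtain ⟨ρ, hρ⟩ := hD.exists_symbol
  rw [hD.congr_apply hs, map_sum, section_sum_apply]
  refine Finset.sum_eq_zero fun j _ => ?_
  rw [hρ]
  change f j x • D (r j) x + ρ (f j) x • r j x = 0
  rw [hf, hr, zero_smul, smul_zero, add_zero]

end FirstOrder

/-! ### Hadamard's lemma for sections, and dependence on one-jets. -/

section SectionHadamard

variable {EX HX : Type*} [NormedAddCommGroup EX] [NormedSpace ℝ EX] [FiniteDimensional ℝ EX]
  [TopologicalSpace HX] {IX : ModelWithCorners ℝ EX HX} [IX.Boundaryless]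
  {X : Type*} [TopologicalSpace X]
  [ChartedSpace HX X] [IsManifold IX ∞ X] [T2Space X]
  {V : X → Type*} [∀ x, AddCommGroup (V x)] [∀ x, Module ℝ (V x)] [∀ x, TopologicalSpace (V x)]
  [TopologicalSpace (TotalSpace ℝ V)] [FiberBundle ℝ V] [VectorBundle ℝ ℝ V]
  [ContMDiffVectorBundle ∞ ℝ V IX]

/-- The coordinate expression of a section of a line bundle near `q`. -/
def chartCoord (q : X) (r : Cₛ^∞⟮IX; ℝ, V⟯) (z : EX) : ℝ :=
  (trivializationAt ℝ V q ⟨(extChartAt IX q).symm z, r ((extChartAt IX q).symm z)⟩).2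

theorem contDiffAt_chartCoord (q : X) (r : Cₛ^∞⟮IX; ℝ, V⟯) :
    ∀ᶠ z in nhds (extChartAt IX q q), ContDiffAt ℝ ∞ (chartCoord q r) z := by
  have h1 := extChartAt_target_mem_nhds (I := IX) q
  have h2 : ∀ᶠ z in nhds (extChartAt IX q q), (extChartAt IX q).symm z ∈
      (trivializationAt ℝ V q).baseSet := by
    refine (continuousAt_extChartAt_symm (I := IX) q).eventually_mem ?_
    rw [extChartAt_to_inv]
    exact (trivializationAt ℝ V q).open_baseSet.mem_nhds (mem_baseSet_trivializationAt ℝ V q)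
  filter_upwards [eventually_mem_nhds_iff.2 h1, h2] with z hz hz2
  rw [← contMDiffAt_iff_contDiffAt]
  exact (section_coord_contMDiffAt r q _ hz2).comp z
    ((contMDiffOn_extChartAt_symm q).contMDiffAt hz)

/-- Hadamard's lemma for sections of a line bundle, relative to the fixed points of an idempotent
smooth map `R` of the chart. -/
theorem exists_section_hadamard (q : X) (r : Cₛ^∞⟮IX; ℝ, V⟯) {R : EX → EX}
    (hR : ContDiff ℝ ∞ R) (hRR : ∀ z, R (R z) = R z)
    (hr : ∀ᶠ z in nhds (extChartAt IX q q), R z = z → chartCoord q r z = 0) :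
    ∃ (f : Fin (Module.finrank ℝ EX) → C^∞⟮IX, X; ℝ⟯)
      (r' : Fin (Module.finrank ℝ EX) → Cₛ^∞⟮IX; ℝ, V⟯),
      ∀ᶠ y in nhds q, r y = (∑ j, f j • r' j) y ∧
        (R (extChartAt IX q y) = extChartAt IX q y → (∀ j, f j y = 0) ∧
          (fderiv ℝ (chartCoord q r) (extChartAt IX q y) = 0 → ∀ j, r' j y = 0)) := by
  set φ := extChartAt IX q
  set t := trivializationAt ℝ V q
  have hsm := contDiffAt_chartCoord q r
  obtain ⟨ε, hε, hball⟩ := Metric.eventually_nhds_iff_ball.1 (hr.and hsm)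
  -- The cutoff makes the coordinate expression smooth on the whole model space. Its product with
  -- `r` vanishes at all fixed points of `R`, hence on the image of `R`, and the term `h (R z)` in
  -- Hadamard's formula disappears.
  let ψ : ContDiffBump (φ q) := ⟨ε / 3, ε / 2, by positivity, by linarith⟩
  let h : EX → ℝ := fun z => ψ z * chartCoord q r z
  have hψ : ∀ z, ψ z ≠ 0 → z ∈ Metric.ball (φ q) ε := fun z hz => by
    have : z ∈ Function.support ψ := hz
    rw [ψ.support_eq] at this
    exact Metric.ball_subset_ball (by simp only [ψ]; linarith) this
  have hh : ContDiff ℝ ∞ h := by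
    rw [contDiff_iff_contDiffAt]
    intro z
    by_cases hz : z ∈ Metric.ball (φ q) ε
    · exact ψ.contDiffAt.mul (hball z hz).2
    · have hz' : z ∉ tsupport ψ := by
        rw [ψ.tsupport_eq]
        simp only [Metric.mem_ball, Metric.mem_closedBall, not_lt, not_le] at hz ⊢
        simp only [ψ]; linarith
      refine (contDiffAt_const (c := (0 : ℝ))).congr_of_eventuallyEq ?_
      filter_upwards [(isClosed_tsupport ψ).isOpen_compl.mem_nhds hz'] with w hw
      simp only [h, image_eq_zero_of_notMem_tsupport hw, zero_mul]
  obtain ⟨g, hg, hg1, hg2⟩ := exists_hadamard hh hR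
  have hhR : ∀ z, h (R z) = 0 := fun z => by
    by_cases hz : ψ (R z) = 0
    · simp only [h, hz, zero_mul]
    · simp only [h, (hball _ (hψ _ hz)).1 (hRR z), mul_zero]
  let b := Module.finBasis ℝ EX
  have hq := mem_extChartAt_source (I := IX) q
  have hsrc : ∀ᶠ y in nhds q, y ∈ φ.source := extChartAt_source_mem_nhds q
  have hφ : ∀ᶠ y in nhds q, ContMDiffAt IX 𝓘(ℝ, EX) ∞ φ y := by
    filter_upwards [(isOpen_extChartAt_source (I := IX) q).mem_nhds hq] with y hy
    exact contMDiffAt_extChartAt' (by rwa [extChartAt_source] at hy)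
  have hbase : ∀ᶠ y in nhds q, y ∈ t.baseSet :=
    t.open_baseSet.mem_nhds (mem_baseSet_trivializationAt ℝ V q)
  -- The functions `f j` are the coordinates of `z - R z` and vanish at the fixed points. The
  -- sections `r' j` have the coefficients of `g`, which at the fixed points are the partial
  -- derivatives.
  have hf : ∀ j, ∃ f : C^∞⟮IX, X; ℝ⟯, ∀ᶠ y in nhds q, f y = b.coord j (φ y - R (φ y)) := by
    intro j
    refine exists_function_eventuallyEq _ ?_
    filter_upwards [hφ] with y hy
    have h1 : ContDiff ℝ ∞ fun z => b.coord j (z - R z) :=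
      ((LinearMap.toContinuousLinearMap (b.coord j)).contDiff).comp (contDiff_id.sub hR)
    exact h1.contMDiff.contMDiffAt.comp y hy
  have hr' : ∀ j, ∃ r' : Cₛ^∞⟮IX; ℝ, V⟯, ∀ᶠ y in nhds q, r' y = t.symm y (g (φ y) (b j)) := by
    intro j
    refine exists_section_eventuallyEq _ ?_
    filter_upwards [hφ, hbase] with y hy hyb
    rw [t.contMDiffAt_section_iff hyb]
    have h1 : ContDiff ℝ ∞ fun z => g z (b j) := hg.clm_apply contDiff_const
    refine (h1.contMDiff.contMDiffAt.comp y hy).congr_of_eventuallyEq ?_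
    filter_upwards [t.open_baseSet.mem_nhds hyb] with z hz
    rw [t.apply_mk_symm hz]
    rfl
  choose f hf using hf
  choose r' hr' using hr'
  refine ⟨f, r', ?_⟩
  have hcont : ContinuousAt φ q := continuousAt_extChartAt q
  have hψ1 : ∀ᶠ y in nhds q, ∀ᶠ z in nhds (φ y), ψ z = 1 :=
    hcont.eventually (ψ.eventuallyEq_one.eventually_nhds)
  filter_upwards [Filter.eventually_all.2 hf, Filter.eventually_all.2 hr', hsrc, hbase, hψ1]
    with y hfy hry hys hyb hψy
  have hcoord : chartCoord q r (φ y) = (t ⟨y, r y⟩).2 := by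
    simp only [chartCoord]
    rw [φ.left_inv hys]
  refine ⟨?_, fun hRy => ⟨fun j => ?_, fun hd j => ?_⟩⟩
  · have h1 : h (φ y) = (t ⟨y, r y⟩).2 := by
      simp only [h]
      rw [hψy.self_of_nhds, one_mul, hcoord]
    have h2 : (t ⟨y, r y⟩).2 = ∑ j, f j y * g (φ y) (b j) := by
      have h3 := hg1 (φ y)
      rw [hhR, sub_zero, h1] at h3
      rw [h3]
      conv_lhs => rw [← b.sum_repr (φ y - R (φ y)), map_sum]
      refine Finset.sum_congr rfl fun j _ => ?_
      rw [map_smul, hfy, smul_eq_mul]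
      rfl
    rw [section_sum_apply]
    calc r y = t.symm y (t ⟨y, r y⟩).2 := (t.symm_apply_apply_mk hyb _).symm
      _ = t.symmₗ ℝ y (∑ j, f j y • g (φ y) (b j)) := by
        rw [h2, t.coe_symmₗ hyb]; rfl
      _ = _ := by
        rw [map_sum]
        refine Finset.sum_congr rfl fun j _ => ?_
        rw [map_smul, section_smul_apply, hry, t.coe_symmₗ hyb]
  · rw [hfy, hRy, sub_self, map_zero]
  · have h1 : fderiv ℝ h (φ y) = 0 := by
      rw [← hd]
      refine Filter.EventuallyEq.fderiv_eq ?_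
      filter_upwards [hψy] with z hz
      simp only [h, hz, one_mul]
    rw [hry, hg2 _ hRy, h1, ← t.coe_symmₗ (R := ℝ) hyb]
    exact (t.symmₗ ℝ y).map_zero

/-- A first order operator at `q` only depends on the `1`-jet at `q`. -/
theorem IsFirstOrder.apply_eq_zero_of_jet {D : Cₛ^∞⟮IX; ℝ, V⟯ →ₗ[ℝ] Cₛ^∞⟮IX; ℝ, V⟯}
    (hD : IsFirstOrder D) {q : X} {r : Cₛ^∞⟮IX; ℝ, V⟯} (h0 : r q = 0)
    (h1 : fderiv ℝ (chartCoord q r) (extChartAt IX q q) = 0) : D r q = 0 := by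
  -- For a constant map the only fixed point is the coordinate of `q`.
  obtain ⟨f, r', h⟩ := exists_section_hadamard q r (R := fun _ => extChartAt IX q q)
    contDiff_const (fun _ => rfl) (Filter.Eventually.of_forall fun z hz => by
      simp only [chartCoord]
      rw [← hz, extChartAt_to_inv, h0]
      have := (trivializationAt ℝ V q).zeroSection ℝ (mem_baseSet_trivializationAt ℝ V q)
      exact congrArg Prod.snd this)
  have h2 := h.self_of_nhds.2 rfl
  exact hD.apply_sum_smul_eq_zero (h.mono fun y hy => hy.1) h2.1 (h2.2 h1)

end SectionHadamard

/-! ### Vertical derivatives and affine approximation of sections. -/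

section VerticalJets

variable {ES : Type*} [NormedAddCommGroup ES] [NormedSpace ℝ ES] [FiniteDimensional ℝ ES]
  {S : Type*} [TopologicalSpace S] [ChartedSpace ES S]
  [IsManifold 𝓘(ℝ, ES) ∞ S] [T2Space S]
  {F : Type*} [NormedAddCommGroup F] [NormedSpace ℝ F] [FiniteDimensional ℝ F]
  {N : S → Type*} [∀ x, AddCommGroup (N x)] [∀ x, Module ℝ (N x)] [∀ x, TopologicalSpace (N x)]
  [∀ x, IsTopologicalAddGroup (N x)] [∀ x, ContinuousSMul ℝ (N x)]
  [TopologicalSpace (TotalSpace F N)] [FiberBundle F N] [VectorBundle ℝ F N]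
  [ContMDiffVectorBundle ∞ F N 𝓘(ℝ, ES)] [T2Space (TotalSpace F N)]
  {ℓ : S → Type*} [∀ x, AddCommGroup (ℓ x)] [∀ x, Module ℝ (ℓ x)] [∀ x, TopologicalSpace (ℓ x)]
  [∀ x, IsTopologicalAddGroup (ℓ x)] [∀ x, ContinuousSMul ℝ (ℓ x)]
  [TopologicalSpace (TotalSpace ℝ ℓ)] [FiberBundle ℝ ℓ] [VectorBundle ℝ ℝ ℓ]
  [ContMDiffVectorBundle ∞ ℝ ℓ 𝓘(ℝ, ES)]

/-- The pullback along `π` of a section of `ℓ`. -/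
def baseLift : Cₛ^∞⟮𝓘(ℝ, ES); ℝ, ℓ⟯ →ₗ[ℝ] PullbackSections ES F N ℓ where
  toFun u := pullbackSection (footPoint ES F N) (fun p => u p.1) (u.contMDiff.comp (contMDiff_proj N))
  map_add' _ _ := rfl
  map_smul' _ _ := rfl

theorem restrictZero_apply (s : PullbackSections ES F N ℓ) (x : S) :
    restrictZero s x = s ⟨x, 0⟩ := rfl

theorem restrictZero_smul (f : C^∞⟮𝓘(ℝ, ES).prod 𝓘(ℝ, F), TotalSpace F N; ℝ⟯)
    (s : PullbackSections ES F N ℓ) :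
    restrictZero (f • s) = (f.comp zeroSectionMap : C^∞⟮𝓘(ℝ, ES), S; ℝ⟯) • restrictZero s := rfl

theorem restrictZero_baseLift (u : Cₛ^∞⟮𝓘(ℝ, ES); ℝ, ℓ⟯) :
    restrictZero (baseLift u : PullbackSections ES F N ℓ) = u := rfl

theorem restrictZero_linLift (φ : ConormalSections ES F N ℓ) : restrictZero (linLift φ) = 0 :=
  ContMDiffSection.ext fun x => (φ x).map_zero

/-- The conormal part `d^v s|_S` of a section. -/
def conormalPart : PullbackSections ES F N ℓ →ₗ[ℝ] ConormalSections ES F N ℓ where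
  toFun s := ⟨fun x => vertDeriv s ⟨x, 0⟩, by
    have h : ContMDiff 𝓘(ℝ, ES) (𝓘(ℝ, ES).prod 𝓘(ℝ, F)) ∞ (zeroSection F N) :=
      contMDiff_zeroSection _ _
    exact (contMDiff_vertDeriv s).comp h⟩
  map_add' s t := ContMDiffSection.ext fun x => (vertDerivAt ⟨x, 0⟩).map_add s t
  map_smul' c s := ContMDiffSection.ext fun x => (vertDerivAt ⟨x, 0⟩).map_smul c s

-- The bundle data are given explicitly, since they are slow to infer.
local notation "resZ" => restrictZero (ES := ES) (F := F) (N := N) (ℓ := ℓ)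
local notation "linZ" => linLift (ES := ES) (F := F) (N := N) (ℓ := ℓ)
local notation "jetZ" => conormalPart (ES := ES) (F := F) (N := N) (ℓ := ℓ)
local notation "basZ" => baseLift (ES := ES) (F := F) (N := N) (ℓ := ℓ)

theorem vertDeriv_add (s t : PullbackSections ES F N ℓ) (p : TotalSpace F N) :
    vertDeriv (s + t) p = vertDeriv s p + vertDeriv t p := (vertDerivAt p).map_add s t

theorem vertDeriv_sub (s t : PullbackSections ES F N ℓ) (p : TotalSpace F N) :
    vertDeriv (s - t) p = vertDeriv s p - vertDeriv t p := (vertDerivAt p).map_sub s t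

theorem vertDeriv_linLift (φ : ConormalSections ES F N ℓ) (p : TotalSpace F N) :
    vertDeriv (linZ φ) p = φ p.1 := by
  set e := (trivializationAt F N p.1).continuousLinearEquivAt ℝ p.1
    (mem_baseSet_trivializationAt F N p.1)
  set e' := (trivializationAt ℝ ℓ p.1).continuousLinearEquivAt ℝ p.1
    (mem_baseSet_trivializationAt ℝ ℓ p.1)
  rw [vertDeriv_eq _ p e e']
  have h : (fun w : F => e' (fibreValue (linZ φ) p.1 (e.symm w))) =
      ((e' : ℓ p.1 →L[ℝ] ℝ) ∘L φ p.1 ∘L (e.symm : F →L[ℝ] N p.1)) := rfl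
  rw [h, ContinuousLinearMap.fderiv]
  ext v
  simp

theorem vertDeriv_baseLift (u : Cₛ^∞⟮𝓘(ℝ, ES); ℝ, ℓ⟯) (p : TotalSpace F N) :
    vertDeriv (basZ u : PullbackSections ES F N ℓ) p = 0 := by
  set e := (trivializationAt F N p.1).continuousLinearEquivAt ℝ p.1
    (mem_baseSet_trivializationAt F N p.1)
  set e' := (trivializationAt ℝ ℓ p.1).continuousLinearEquivAt ℝ p.1
    (mem_baseSet_trivializationAt ℝ ℓ p.1)
  rw [vertDeriv_eq _ p e e']
  have h : (fun w : F => e' (fibreValue (basZ u : PullbackSections ES F N ℓ) p.1 (e.symm w))) =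
      fun _ => e' (u p.1) := rfl
  rw [h, fderiv_fun_const]
  ext v
  simp

theorem conormalPart_linLift (φ : ConormalSections ES F N ℓ) : jetZ (linZ φ) = φ :=
  ContMDiffSection.ext fun x => vertDeriv_linLift φ ⟨x, 0⟩

theorem contMDiff_fibre_inclusion (x : S) : ContMDiff 𝓘(ℝ, F) (𝓘(ℝ, ES).prod 𝓘(ℝ, F)) ∞
    (fun w : F => (⟨x, (trivializationAt F N x).symm x w⟩ : TotalSpace F N)) := by
  intro w
  have hx := mem_baseSet_trivializationAt F N x
  rw [(trivializationAt F N x).contMDiffAt_iff (IB := 𝓘(ℝ, ES)) (by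
    rw [Trivialization.mem_source]; exact hx)]
  refine ⟨contMDiffAt_const, ?_⟩
  simp only [(trivializationAt F N x).apply_mk_symm hx]
  exact contMDiffAt_id

/-- The Leibniz rule for the vertical derivative. -/
theorem exists_vertDeriv_smul (f : C^∞⟮𝓘(ℝ, ES).prod 𝓘(ℝ, F), TotalSpace F N; ℝ⟯)
    (p : TotalSpace F N) : ∃ δ : N p.1 →L[ℝ] ℝ, ∀ s : PullbackSections ES F N ℓ, ∀ v : N p.1,
      vertDeriv (f • s) p v = f p • vertDeriv s p v + δ v • fibreValue s p.1 p.2 := by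
  set e := (trivializationAt F N p.1).continuousLinearEquivAt ℝ p.1
    (mem_baseSet_trivializationAt F N p.1)
  set e' := (trivializationAt ℝ ℓ p.1).continuousLinearEquivAt ℝ p.1
    (mem_baseSet_trivializationAt ℝ ℓ p.1)
  have hf : Differentiable ℝ fun w : F => f ⟨p.1, e.symm w⟩ :=
    ((f.contMDiff.comp (contMDiff_fibre_inclusion p.1)).contDiff).differentiable (by simp)
  refine ⟨fderiv ℝ (fun w : F => f ⟨p.1, e.symm w⟩) (e p.2) ∘L (e : N p.1 →L[ℝ] F), fun s v => ?_⟩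
  have h : (fun w : F => e' (fibreValue (f • s) p.1 (e.symm w))) =
      fun w => f ⟨p.1, e.symm w⟩ • e' (fibreValue s p.1 (e.symm w)) :=
    funext fun w => e'.map_smul (f ⟨p.1, e.symm w⟩) (fibreValue s p.1 (e.symm w))
  rw [vertDeriv_eq _ p e e', vertDeriv_eq s p e e', h, fderiv_fun_smul (hf _)
    (differentiable_fibre s p.1 e e' _)]
  simp only [ContinuousLinearMap.comp_apply, _root_.add_apply,
    _root_.smul_apply, ContinuousLinearMap.smulRight_apply,
    ContinuousLinearEquiv.coe_coe, e.symm_apply_apply, map_add, map_smul, e'.symm_apply_apply]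

theorem vertDeriv_smul_of_eq_zero (f : C^∞⟮𝓘(ℝ, ES).prod 𝓘(ℝ, F), TotalSpace F N; ℝ⟯)
    (s : PullbackSections ES F N ℓ) (p : TotalSpace F N) (hs : fibreValue s p.1 p.2 = 0) :
    vertDeriv (f • s) p = f p • vertDeriv s p := by
  obtain ⟨δ, hδ⟩ := exists_vertDeriv_smul (ℓ := ℓ) f p
  ext v
  rw [hδ, hs, smul_zero, add_zero]
  rfl

/-- The chart of the total space combines the base chart with the trivialization at `q.1`, so that
differentiation takes place on `ES × F`. -/
theorem extChartAt_totalSpace_symm (q : TotalSpace F N) (z : ES × F) :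
    (extChartAt (𝓘(ℝ, ES).prod 𝓘(ℝ, F)) q).symm z =
      (trivializationAt F N q.1).toOpenPartialHomeomorph.symm
        ((extChartAt 𝓘(ℝ, ES) q.1).symm z.1, z.2) := by
  rw [FiberBundle.extChartAt]
  rfl

theorem extChartAt_totalSpace_apply (q p : TotalSpace F N)
    (hp : p.1 ∈ (trivializationAt F N q.1).baseSet) :
    extChartAt (𝓘(ℝ, ES).prod 𝓘(ℝ, F)) q p =
      (extChartAt 𝓘(ℝ, ES) q.1 p.1, (trivializationAt F N q.1 p).2) := by
  rw [FiberBundle.extChartAt]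
  simp [Trivialization.coe_fst' _ hp]

theorem triv_zero_snd {K : Type*} [NormedAddCommGroup K] [NormedSpace ℝ K]
    {V : S → Type*} [∀ x, AddCommGroup (V x)] [∀ x, Module ℝ (V x)] [∀ x, TopologicalSpace (V x)]
    [TopologicalSpace (TotalSpace K V)] [FiberBundle K V] [VectorBundle ℝ K V] {x y : S}
    (hy : y ∈ (trivializationAt K V x).baseSet) :
    (trivializationAt K V x ⟨y, (0 : V y)⟩).2 = 0 :=
  congrArg Prod.snd ((trivializationAt K V x).zeroSection ℝ hy)

/-- A section which vanishes along the image of a section `n` of `N`, and whose vertical derivative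
vanishes at a point of this image, has zero derivative at this point. -/
theorem fderiv_chartCoord_eq_zero (q : TotalSpace F N) (r : PullbackSections ES F N ℓ)
    (n : Cₛ^∞⟮𝓘(ℝ, ES); F, N⟯) (x : S) (hx : x ∈ (extChartAt 𝓘(ℝ, ES) q.1).source)
    (hN : x ∈ (trivializationAt F N q.1).baseSet) (hL : x ∈ (trivializationAt ℝ ℓ q.1).baseSet)
    (hr : ∀ y, r ⟨y, n y⟩ = 0) (hv : vertDeriv r ⟨x, n x⟩ = 0) :
    fderiv ℝ (chartCoord (IX := 𝓘(ℝ, ES).prod 𝓘(ℝ, F)) q r)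
      (extChartAt (𝓘(ℝ, ES).prod 𝓘(ℝ, F)) q ⟨x, n x⟩) = 0 := by
  set t := trivializationAt F N q.1
  set t' := trivializationAt ℝ ℓ q.1
  set c := extChartAt 𝓘(ℝ, ES) q.1
  rw [extChartAt_totalSpace_apply q ⟨x, n x⟩ hN]
  set w₀ := (t ⟨x, n x⟩).2 with hw₀
  set G : S × F → ℝ := fun q => (t' ⟨q.1, r ⟨q.1, t.symm q.1 q.2⟩⟩).2 with hG
  have hcx : c.symm (c x) = x := c.left_inv hx
  have hc : ContMDiffAt 𝓘(ℝ, ES) 𝓘(ℝ, ES) ∞ c.symm (c x) :=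
    (contMDiffOn_extChartAt_symm q.1).contMDiffAt
      (extChartAt_target_mem_nhds' (c.map_source hx))
  have hcb : ∀ᶠ z in nhds (c x), c.symm z ∈ t.baseSet ∧ c.symm z ∈ t'.baseSet := by
    refine (hc.continuousAt.eventually_mem ?_).and (hc.continuousAt.eventually_mem ?_)
    · rw [hcx]; exact t.open_baseSet.mem_nhds hN
    · rw [hcx]; exact t'.open_baseSet.mem_nhds hL
  have hform : ∀ z : ES × F, c.symm z.1 ∈ t.baseSet →
      chartCoord (IX := 𝓘(ℝ, ES).prod 𝓘(ℝ, F)) q r z = G (c.symm z.1, z.2) := by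
    intro z hz
    have h1 : (extChartAt (𝓘(ℝ, ES).prod 𝓘(ℝ, F)) q).symm z =
        ⟨c.symm z.1, t.symm (c.symm z.1) z.2⟩ := by
      rw [extChartAt_totalSpace_symm, t.mk_symm hz]
    have h2 : ∀ p : TotalSpace F N, (extChartAt (𝓘(ℝ, ES).prod 𝓘(ℝ, F)) q).symm z = p →
        chartCoord (IX := 𝓘(ℝ, ES).prod 𝓘(ℝ, F)) q r z = (t' ⟨p.1, r p⟩).2 := by
      rintro p rfl
      rfl
    exact h2 _ h1
  set H := chartCoord (IX := 𝓘(ℝ, ES).prod 𝓘(ℝ, F)) q r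
  have hHG : H =ᶠ[nhds (c x, w₀)] fun z => G (c.symm z.1, z.2) := by
    have := continuous_fst.continuousAt (x := (c x, w₀)) hcb
    filter_upwards [this] with z hz
    exact hform z hz.1
  have hG1 : ContMDiffAt (𝓘(ℝ, ES).prod 𝓘(ℝ, F)) 𝓘(ℝ, ℝ) ∞ G (x, w₀) :=
    contMDiffAt_trivialized r q.1 (x, w₀) hN hL
  have hHd : DifferentiableAt ℝ H (c x, w₀) := by
    have h1 : ContMDiffAt (𝓘(ℝ, ES).prod 𝓘(ℝ, F)) 𝓘(ℝ, ℝ) ∞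
        (fun z : ES × F => G (c.symm z.1, z.2)) (c x, w₀) := by
      refine ContMDiffAt.comp (I' := 𝓘(ℝ, ES).prod 𝓘(ℝ, F)) (c x, w₀) (g := G) (f := fun z : ES × F => (c.symm z.1, z.2)) ?_ ?_
      · simp only [hcx]; exact hG1
      · exact (hc.comp (c x, w₀) contMDiffAt_fst).prodMk contMDiffAt_snd
    rw [← modelWithCornersSelf_prod, chartedSpaceSelf_prod] at h1
    exact (h1.contDiffAt.differentiableAt (by simp)).congr_of_eventuallyEq hHG
  have hHf := hHd.hasFDerivAt
  set A := fderiv ℝ H (c x, w₀)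
  -- the fibre direction
  have hfib : ∀ u : F, A (0, u) = 0 := by
    set e := t.continuousLinearEquivAt ℝ x hN
    set e' := t'.continuousLinearEquivAt ℝ x hL
    have h1 := vertDeriv_eq r ⟨x, n x⟩ e e'
    rw [hv] at h1
    have h2 : (fun w : F => e' (fibreValue r x (e.symm w))) = fun w => H (c x, w) := by
      ext w
      rw [hform (c x, w) (by simpa only [hcx] using hN)]
      simp only [hG, hcx]
      rfl
    have h3 : HasFDerivAt (fun w : F => H (c x, w)) (A ∘L ContinuousLinearMap.inr ℝ ES F) w₀ :=
      hHf.comp w₀ (hasFDerivAt_prodMk_right (c x) w₀)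
    intro u
    have h4 := congrArg (fun B => e' (B (e.symm u))) h1
    simp only [h2] at h4
    have h5 : e (n x) = w₀ := rfl
    simp only [_root_.zero_apply, map_zero, ContinuousLinearMap.comp_apply,
      ContinuousLinearEquiv.coe_coe, e.apply_symm_apply, e'.apply_symm_apply, h5, h3.fderiv] at h4
    simpa using h4.symm
  -- the direction of `n`
  set nh : ES → F := fun z => (t ⟨c.symm z, n (c.symm z)⟩).2
  have hnh : DifferentiableAt ℝ nh (c x) := by
    have h1 : ContMDiffAt 𝓘(ℝ, ES) 𝓘(ℝ, F) ∞ nh (c x) := by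
      refine ContMDiffAt.comp (c x) (g := fun y => (t ⟨y, n y⟩).2) (f := c.symm) ?_ hc
      rw [hcx]
      exact section_coord_contMDiffAt n q.1 x hN
    exact h1.contDiffAt.differentiableAt (by simp)
  have hnx : nh (c x) = w₀ :=
    congrArg (fun y => (t ⟨y, n y⟩).2) hcx
  have hz : (fun z => H (z, nh z)) =ᶠ[nhds (c x)] fun _ => 0 := by
    filter_upwards [hcb] with z hz
    rw [hform (z, nh z) hz.1]
    simp only [hG, nh]
    rw [t.symm_apply_apply_mk hz.1, hr]
    exact triv_zero_snd hz.2
  have hn2 : HasFDerivAt (fun z => H (z, nh z))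
      (A ∘L (ContinuousLinearMap.id ℝ ES).prod (fderiv ℝ nh (c x))) (c x) := by
    refine HasFDerivAt.comp (c x) (g := H) (f := fun z => (z, nh z)) ?_
      ((hasFDerivAt_id _).prodMk hnh.hasFDerivAt)
    rw [hnx]
    exact hHf
  have hn3 : A ∘L (ContinuousLinearMap.id ℝ ES).prod (fderiv ℝ nh (c x)) = 0 :=
    hn2.unique ((hasFDerivAt_const (0 : ℝ) (c x)).congr_of_eventuallyEq hz)
  refine ContinuousLinearMap.ext fun v => ?_
  -- Every direction is a sum of one tangent to the image of `n` and one along the fibre.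
  have h1 : v = (v.1, fderiv ℝ nh (c x) v.1) + (0, v.2 - fderiv ℝ nh (c x) v.1) := by
    ext <;> simp
  rw [h1, map_add, hfib, add_zero]
  exact congrArg (fun B => B v.1) hn3

theorem IsFirstOrder.apply_eq_zero_of_vertDeriv
    {D : PullbackSections ES F N ℓ →ₗ[ℝ] PullbackSections ES F N ℓ} (hD : IsFirstOrder D)
    {r : PullbackSections ES F N ℓ} (n : Cₛ^∞⟮𝓘(ℝ, ES); F, N⟯) (x : S)
    (hr : ∀ y, r ⟨y, n y⟩ = 0) (hv : vertDeriv r ⟨x, n x⟩ = 0) : D r ⟨x, n x⟩ = 0 :=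
  hD.apply_eq_zero_of_jet (hr x) (fderiv_chartCoord_eq_zero ⟨x, n x⟩ r n x
    (mem_extChartAt_source (I := 𝓘(ℝ, ES)) x) (mem_baseSet_trivializationAt F N x)
    (mem_baseSet_trivializationAt ℝ ℓ x) hr hv)

/-- The restriction to `S` of a first order operator only sees the affine part of a section. -/
theorem IsFirstOrder.restrictZero_apply
    {D : PullbackSections ES F N ℓ →ₗ[ℝ] PullbackSections ES F N ℓ} (hD : IsFirstOrder D)
    (s : PullbackSections ES F N ℓ) :
    resZ (D s) = resZ (D (basZ (resZ s))) +
      resZ (D (linZ (jetZ s))) := by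
  rw [← map_add, ← map_add, ← sub_eq_zero, ← map_sub, ← map_sub]
  refine ContMDiffSection.ext fun x => ?_
  -- The zero section is the image of `n = 0`; along it `s` and its affine part have the same values
  -- and vertical derivatives.
  refine hD.apply_eq_zero_of_vertDeriv 0 x (fun y => ?_) ?_
  · change (fibreValue s y 0 - (fibreValue s y 0 + jetZ s y 0) : ℓ y) = 0
    rw [map_zero, add_zero, sub_self]
  · rw [vertDeriv_sub, vertDeriv_add, vertDeriv_baseLift, vertDeriv_linLift, zero_add]
    exact sub_self _

/-- A first order operator which vanishes at `p` on the fibrewise affine sections vanishes at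
`p`. -/
theorem IsFirstOrder.apply_eq_zero_of_affine
    {D : PullbackSections ES F N ℓ →ₗ[ℝ] PullbackSections ES F N ℓ} (hD : IsFirstOrder D)
    {p : TotalSpace F N} (h : ∀ u φ, D (basZ u + linZ φ) p = 0)
    (s : PullbackSections ES F N ℓ) : D s p = 0 := by
  obtain ⟨x, w⟩ := p
  -- An affine section with the same one-jet at `p` is found along a section `n` of `N` through `p`:
  -- `φ` provides the vertical derivative at `p`, and `u` corrects the values along all of `n`.
  obtain ⟨n, hn, -⟩ := exists_section_apply (IX := 𝓘(ℝ, ES)) (K := F) x w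
  obtain ⟨φ, hφ, -⟩ := exists_section_apply (IX := 𝓘(ℝ, ES)) (K := F →L[ℝ] ℝ)
    (V := fun x => N x →L[ℝ] ℓ x) x (vertDeriv s ⟨x, w⟩)
  subst hn
  let u : Cₛ^∞⟮𝓘(ℝ, ES); ℝ, ℓ⟯ := ⟨fun y => (s - linZ φ) ⟨y, n y⟩,
    (pullbackSection_total (s - linZ φ)).comp n.contMDiff⟩
  have h1 := hD.apply_eq_zero_of_vertDeriv (r := s - (basZ u + linZ φ)) n x
    (fun y => by
      change (fibreValue s y (n y) - ((fibreValue s y (n y) - φ y (n y)) + φ y (n y)) : ℓ y) = 0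
      rw [sub_add_cancel, sub_self])
    (by
      rw [vertDeriv_sub, vertDeriv_add, vertDeriv_baseLift, vertDeriv_linLift, zero_add]
      exact sub_eq_zero.2 hφ.symm)
  rw [map_sub] at h1
  exact (sub_eq_zero.1 h1).trans (h u φ)

/-- A section with zero `1`-jet along `S` is locally a sum of products of functions and sections
vanishing on `S`. -/
theorem exists_sum_smul_of_jet (s : PullbackSections ES F N ℓ) (h0 : resZ s = 0)
    (h1 : jetZ s = 0) (x : S) :
    ∃ (f : Fin (Module.finrank ℝ (ES × F)) → C^∞⟮𝓘(ℝ, ES).prod 𝓘(ℝ, F), TotalSpace F N; ℝ⟯)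
      (r : Fin (Module.finrank ℝ (ES × F)) → PullbackSections ES F N ℓ),
      (∀ᶠ p in nhds (⟨x, 0⟩ : TotalSpace F N), s p = (∑ j, f j • r j) p) ∧
        ∀ j y, f j ⟨y, 0⟩ = 0 ∧ r j ⟨y, 0⟩ = 0 := by
  set q : TotalSpace F N := ⟨x, 0⟩
  set φ := extChartAt (𝓘(ℝ, ES).prod 𝓘(ℝ, F)) q
  have hs : ∀ p : TotalSpace F N, p.2 = 0 → s p = 0 := by
    rintro ⟨y, w⟩ (rfl : w = 0)
    exact congrArg (fun u => u y) h0
  have hc : Continuous (TotalSpace.proj : TotalSpace F N → S) := FiberBundle.continuous_proj F N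
  have hbN : ∀ᶠ p : TotalSpace F N in nhds q, p.1 ∈ (trivializationAt F N x).baseSet :=
    hc.continuousAt.eventually_mem ((trivializationAt F N x).open_baseSet.mem_nhds
      (mem_baseSet_trivializationAt F N x))
  have hbL : ∀ᶠ p : TotalSpace F N in nhds q, p.1 ∈ (trivializationAt ℝ ℓ x).baseSet :=
    hc.continuousAt.eventually_mem ((trivializationAt ℝ ℓ x).open_baseSet.mem_nhds
      (mem_baseSet_trivializationAt ℝ ℓ x))
  have hbS : ∀ᶠ p : TotalSpace F N in nhds q, p.1 ∈ (extChartAt 𝓘(ℝ, ES) x).source :=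
    hc.continuousAt.eventually_mem (extChartAt_source_mem_nhds (I := 𝓘(ℝ, ES)) x)
  have hfix : ∀ p : TotalSpace F N, p.1 ∈ (trivializationAt F N x).baseSet →
      ((φ p).1, (0 : F)) = φ p → p.2 = 0 := by
    intro p hp h
    have h2 := congrArg Prod.snd h
    simp only [φ] at h2
    rw [extChartAt_totalSpace_apply q p hp] at h2
    have h3 := (trivializationAt F N x).symm_apply_apply_mk hp p.2
    rw [← h3, show (trivializationAt F N x ⟨p.1, p.2⟩).2 = 0 from h2.symm,
      ← (trivializationAt F N x).coe_symmₗ (R := ℝ) hp]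
    exact LinearMap.map_zero _
  -- The map `R` forgets the fibre coordinate; its fixed points are the points of the zero section.
  obtain ⟨f, r, h⟩ := exists_section_hadamard (IX := 𝓘(ℝ, ES).prod 𝓘(ℝ, F)) q s
    (R := fun z => (z.1, 0)) (contDiff_fst.prodMk contDiff_const) (fun _ => rfl) (by
      have h2 : ∀ᶠ z in nhds (φ q), φ.symm z ∈ {p : TotalSpace F N |
          (p.1 ∈ (trivializationAt F N x).baseSet ∧ p.1 ∈ (trivializationAt ℝ ℓ x).baseSet) } := by
        refine (continuousAt_extChartAt_symm q).eventually_mem ?_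
        rw [extChartAt_to_inv]
        exact hbN.and hbL
      filter_upwards [h2, extChartAt_target_mem_nhds (I := 𝓘(ℝ, ES).prod 𝓘(ℝ, F)) q]
        with z hz hzt hRz
      have h3 : (φ.symm z).2 = 0 := hfix _ hz.1 (by rw [φ.right_inv hzt]; exact hRz)
      simp only [chartCoord]
      rw [hs _ h3]
      exact triv_zero_snd hz.2)
  have h' : ∀ᶠ p in nhds q, s p = (∑ j, f j • r j) p ∧
      (p.2 = 0 → (∀ j, f j p = 0) ∧ ∀ j, r j p = 0) := by
    filter_upwards [h, hbN, hbL, hbS] with p hp hpN hpL hpS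
    refine ⟨hp.1, fun hp0 => ?_⟩
    obtain ⟨y, w⟩ := p
    obtain rfl : w = 0 := hp0
    have h4 : ((φ ⟨y, 0⟩).1, (0 : F)) = φ ⟨y, 0⟩ := by
      simp only [φ]
      rw [extChartAt_totalSpace_apply q ⟨y, 0⟩ hpN]
      exact Prod.ext rfl (triv_zero_snd hpN).symm
    have h5 := hp.2 h4
    exact ⟨h5.1, h5.2 (fderiv_chartCoord_eq_zero q s 0 y hpS hpN hpL
      (fun z => hs _ rfl) (congrArg (fun u => u y) h1))⟩
  -- Both factors are cut off, since they are required to vanish on the whole zero section and not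
  -- just near `x`.
  obtain ⟨χ, hχ1, hχ2⟩ := exists_bump (IX := 𝓘(ℝ, ES).prod 𝓘(ℝ, F)) h'
  refine ⟨fun j => χ * f j, fun j => χ • r j, ?_, fun j y => ?_⟩
  · filter_upwards [h', hχ1] with p hp hp1
    rw [hp.1, section_sum_apply, section_sum_apply]
    refine Finset.sum_congr rfl fun j _ => ?_
    change f j p • r j p = (χ p * f j p) • χ p • r j p
    rw [hp1, one_mul, one_smul]
  · change χ ⟨y, 0⟩ * f j ⟨y, 0⟩ = 0 ∧ χ ⟨y, 0⟩ • r j ⟨y, 0⟩ = 0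
    by_cases hy : (⟨y, 0⟩ : TotalSpace F N) ∈ tsupport χ
    · have h6 := (hχ2 hy).2 rfl
      rw [h6.1 j, h6.2 j, mul_zero, smul_zero]
      exact ⟨rfl, rfl⟩
    · rw [image_eq_zero_of_notMem_tsupport hy, zero_mul, zero_smul]
      exact ⟨rfl, rfl⟩

theorem vertDeriv_congr {s t : PullbackSections ES F N ℓ} {p : TotalSpace F N}
    (h : ∀ᶠ q in nhds p, s q = t q) : vertDeriv s p = vertDeriv t p := by
  set e := (trivializationAt F N p.1).continuousLinearEquivAt ℝ p.1
    (mem_baseSet_trivializationAt F N p.1)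
  set e' := (trivializationAt ℝ ℓ p.1).continuousLinearEquivAt ℝ p.1
    (mem_baseSet_trivializationAt ℝ ℓ p.1)
  have hc : ContinuousAt (fun w : F => (⟨p.1, e.symm w⟩ : TotalSpace F N)) (e p.2) :=
    (contMDiff_fibre_inclusion (ES := ES) (F := F) (N := N) p.1).continuous.continuousAt
  have h1 : (fun w : F => e' (fibreValue s p.1 (e.symm w))) =ᶠ[nhds (e p.2)]
      fun w : F => e' (fibreValue t p.1 (e.symm w)) := by
    have h2 : ∀ᶠ q in nhds (⟨p.1, e.symm (e p.2)⟩ : TotalSpace F N), s q = t q := by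
      rw [e.symm_apply_apply]; exact h
    filter_upwards [hc.eventually h2] with w hw
    exact congrArg e' hw
  rw [vertDeriv_eq _ p e e', vertDeriv_eq t p e e', h1.fderiv_eq]

/-- If a first order operator preserves the sections vanishing on `S`, it sends sections with zero
`1`-jet along `S` to such sections. -/
theorem IsFirstOrder.conormalPart_eq_zero
    {D : PullbackSections ES F N ℓ →ₗ[ℝ] PullbackSections ES F N ℓ} (hD : IsFirstOrder D)
    (hDS : ∀ s, resZ s = 0 → resZ (D s) = 0)
    {s : PullbackSections ES F N ℓ} (h0 : resZ s = 0) (h1 : jetZ s = 0) :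
    jetZ (D s) = 0 := by
  obtain ⟨ρ, hρ⟩ := hD.exists_symbol
  refine ContMDiffSection.ext fun x => ?_
  obtain ⟨f, r, h, hfr⟩ := exists_sum_smul_of_jet s h0 h1 x
  have hr0 : ∀ j, resZ (r j) = 0 := fun j => ContMDiffSection.ext fun y => (hfr j y).2
  have h2 : ∀ᶠ p in nhds (⟨x, 0⟩ : TotalSpace F N),
      D s p = (∑ j, (f j • D (r j) + ρ (f j) • r j)) p := by
    filter_upwards [h.eventually_nhds] with p hp
    rw [hD.congr_apply hp, map_sum]
    simp only [hρ]
  -- On the zero section `ρ (f j) e = D (f j e) - f j D e` vanishes for every `e`, because `D`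
  -- preserves the sections vanishing there.
  have h3 : ∀ j, ρ (f j) ⟨x, 0⟩ = 0 := fun j => by
    obtain ⟨e, he⟩ := exists_section_ne_zero (IX := 𝓘(ℝ, ES).prod 𝓘(ℝ, F))
      (V := footPoint ES F N *ᵖ ℓ) ⟨x, 0⟩
    have h4 := hDS (f j • e) (ContMDiffSection.ext fun y => by
      change f j ⟨y, 0⟩ • e ⟨y, 0⟩ = 0
      rw [(hfr j y).1, zero_smul])
    rw [hρ] at h4
    have h5 : f j ⟨x, 0⟩ • D e ⟨x, 0⟩ + ρ (f j) ⟨x, 0⟩ • e ⟨x, 0⟩ = 0 :=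
      congrArg (fun u => u x) h4
    rw [(hfr j x).1, zero_smul, zero_add] at h5
    exact (smul_eq_zero.1 h5).resolve_right he
  change vertDeriv (D s) ⟨x, 0⟩ = 0
  rw [vertDeriv_congr h2]
  refine (map_sum (vertDerivAt (⟨x, 0⟩ : TotalSpace F N)) _ _).trans
    (Finset.sum_eq_zero fun j _ => ?_)
  change vertDeriv (f j • D (r j) + ρ (f j) • r j) ⟨x, 0⟩ = 0
  rw [vertDeriv_add, vertDeriv_smul_of_eq_zero _ _ _ (congrArg (fun u => u x) (hDS _ (hr0 j))),
    vertDeriv_smul_of_eq_zero (ρ (f j)) (r j) ⟨x, 0⟩ (hfr j x).2, (hfr j x).1, h3, zero_smul, zero_smul, add_zero]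

end VerticalJets

/-! ### Derived brackets in abstract form: lifts `I`, injections `E`, projections `R`. -/

section DerivedBracketStructure

variable {G : Type*} [AddCommGroup G] [Module ℝ G] {𝒟 : Submodule ℝ (G →ₗ[ℝ] G)}
  {A C : ℕ → Type*} [∀ k, AddCommGroup (A k)] [∀ k, Module ℝ (A k)]
  [∀ k, AddCommGroup (C k)] [∀ k, Module ℝ (C k)]

variable (A) in
/-- The grading of `⨁ A k` in which `A k` has degree `k - 1`. -/
def shiftedGrading (d : ℤ) : Submodule ℝ (⨁ k, A k) :=
  ⨆ k : ℕ, ⨆ _ : (k : ℤ) - 1 = d, LinearMap.range (DirectSum.lof ℝ ℕ A k)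

theorem lof_mem_shiftedGrading {k : ℕ} {d : ℤ} (h : (k : ℤ) - 1 = d) (ξ : A k) :
    DirectSum.lof ℝ ℕ A k ξ ∈ shiftedGrading A d :=
  Submodule.mem_iSup_of_mem k (Submodule.mem_iSup_of_mem h (LinearMap.mem_range_self _ ξ))

theorem schoutenJacobi_opOf_apply {a b : ℕ} (D : MultiOp G a) (D' : MultiOp G b) (n : ℕ)
    (v : Fin n → G) : schoutenJacobi G (opOf a D) (opOf b D') n v =
      (-1 : ℝ) ^ (((a : ℤ) - 1) * ((b : ℤ) - 1)) • insertLin G a b D D' n v -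
        insertLin G b a D' D n v := by
  rw [schoutenJacobi_eq_comp, comp_opOf, comp_opOf]
  rfl

/-- An operator all of whose unary contractions are determined, after composition with `ev`, by
their values on `T`, is determined in the same way by its values on entries in `T`. -/
theorem map_eq_zero_of_forall_mem {H : Type*} [AddCommGroup H] [Module ℝ H] {ev : G →ₗ[ℝ] H}
    {T : Set G} (hT : ∀ B ∈ 𝒟, (∀ s ∈ T, ev (B s) = 0) → ∀ s, ev (B s) = 0) {k : ℕ}
    {D : MultiOp G k} (hD : opOf k D ∈ unaryIn 𝒟) (h : ∀ v, (∀ j, v j ∈ T) → ev (D v) = 0)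
    (v : Fin k → G) : ev (D v) = 0 := by
  induction k with
  | zero => exact h v fun j => j.elim0
  | succ k ih =>
    rw [← Matrix.cons_head_tail v]
    refine hT _ (headMap_mem D hD (Matrix.vecTail v)) (fun s hs => ?_) (Matrix.vecHead v)
    have h1 := contract_mem hD s
    rw [contract_opOf_succ] at h1
    refine ih h1 (fun w hw => h _ fun j => ?_) (Matrix.vecTail v)
    refine Fin.cases ?_ (fun j => ?_) j
    · exact hs
    · exact hw j

/-- The compositions of two lifts are only known to vanish on entries in `T`. Their bracket,
however, lies in `unaryIn 𝒟` again and is therefore determined by such entries. -/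
theorem schoutenJacobi_eq_zero_of_forall_mem {ι : Type*} {H : ι → Type*}
    [∀ p, AddCommGroup (H p)] [∀ p, Module ℝ (H p)] {ev : ∀ p, G →ₗ[ℝ] H p}
    (hev : ∀ s, (∀ p, ev p s = 0) → s = 0) {T : Set G}
    (hT : ∀ p, ∀ B ∈ 𝒟, (∀ s ∈ T, ev p (B s) = 0) → ∀ s, ev p (B s) = 0)
    (h𝒟 : ∀ B ∈ 𝒟, ∀ B' ∈ 𝒟, B ∘ₗ B' - B' ∘ₗ B ∈ 𝒟)
    {I : ∀ k, A k →ₗ[ℝ] MultiOp G k} (hI : ∀ k ξ, opOf k (I k ξ) ∈ unaryIn 𝒟)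
    (hIT : ∀ a b ξ η v w, (∀ j, v j ∈ T) → I (a + 1) ξ (Matrix.vecCons (I b η v) w) = 0)
    (a b : ℕ) (ξ : A a) (η : A b) :
    schoutenJacobi G (opOf a (I a ξ)) (opOf b (I b η)) = 0 := by
  have hmem := schoutenJacobi_mem_unaryIn h𝒟 (hI a ξ) (hI b η)
  have hins : ∀ a b (ξ : A a) (η : A b) n (v : Fin n → G), (∀ j, v j ∈ T) →
      insertLin G a b (I a ξ) (I b η) n v = 0 := by
    intro a b ξ η n v hv
    rcases a with _ | a
    · rfl
    change opOf (b + a) (insertOp (I (a + 1) ξ) (I b η)) n v = 0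
    by_cases hn : b + a = n
    · subst hn
      rw [opOf_apply_same, insertOp_apply]
      simp only [hIT a b ξ η _ _ fun j => hv _, smul_zero, Finset.sum_const_zero]
    · rw [opOf_apply_of_ne hn]
      rfl
  refine DFinsupp.ext fun n => AlternatingMap.ext fun v => hev _ fun p => ?_
  refine map_eq_zero_of_forall_mem (hT p) (component_mem hmem n) (fun u hu => ?_) v
  rw [schoutenJacobi_opOf_apply, hins a b ξ η n u hu, hins b a η ξ n u hu, smul_zero, sub_zero,
    map_zero]

theorem lmap_mem_opGrading (I : ∀ k, A k →ₗ[ℝ] MultiOp G k) (d : ℤ) (x : ⨁ k, A k)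
    (hx : x ∈ shiftedGrading A d) : DirectSum.lmap I x ∈ opGrading G d := by
  suffices h : shiftedGrading A d ≤ (opGrading G d).comap (DirectSum.lmap I) from h hx
  refine iSup_le fun k => iSup_le fun hk => ?_
  rintro _ ⟨ξ, rfl⟩
  rw [Submodule.mem_comap, DirectSum.lmap_lof]
  exact opOf_mem_opGrading (by omega) _

theorem lmap_mem_shiftedGrading (P : ∀ k, MultiOp G k →ₗ[ℝ] A k) (d : ℤ) (X : MultiOps G)
    (hX : X ∈ opGrading G d) : DirectSum.lmap P X ∈ shiftedGrading A d := by
  rcases eq_opOf_of_mem hX with rfl | ⟨n, D, hn, rfl⟩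
  · rw [map_zero]
    exact zero_mem _
  · rw [DirectSum.lmap_lof]
    exact lof_mem_shiftedGrading (by omega) _

theorem lmap_mem_unaryIn {I : ∀ k, A k →ₗ[ℝ] MultiOp G k}
    (hI : ∀ k ξ, opOf k (I k ξ) ∈ unaryIn 𝒟) (x : ⨁ k, A k) :
    DirectSum.lmap I x ∈ unaryIn 𝒟 := by
  induction x using DirectSum.induction_on with
  | zero => rw [map_zero]; exact zero_mem _
  | of k ξ => exact (DirectSum.lmap_lof I k ξ).symm ▸ hI k ξ
  | add x y hx hy => rw [map_add]; exact add_mem hx hy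

theorem schoutenJacobi_lmap {I : ∀ k, A k →ₗ[ℝ] MultiOp G k}
    (hII : ∀ a b ξ η, schoutenJacobi G (opOf a (I a ξ)) (opOf b (I b η)) = 0) (x y : ⨁ k, A k) :
    schoutenJacobi G (DirectSum.lmap I x) (DirectSum.lmap I y) = 0 := by
  induction x using DirectSum.induction_on with
  | zero => rw [map_zero, map_zero, LinearMap.zero_apply]
  | add x x' hx hx' => rw [map_add, map_add, LinearMap.add_apply, hx, hx', add_zero]
  | of k ξ =>
    induction y using DirectSum.induction_on with
    | zero => rw [map_zero, map_zero]
    | add y y' hy hy' => rw [map_add, map_add, hy, hy', add_zero]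
    | of l η =>
      exact (congrArg₂ (fun a b => schoutenJacobi G a b) (DirectSum.lmap_lof I k ξ)
        (DirectSum.lmap_lof I l η)).trans (hII k l ξ η)

theorem lmap_apply_component (E : ∀ k, A k →ₗ[ℝ] C k) (x : ⨁ k, A k) (k : ℕ) :
    DirectSum.lmap E x k = E k (x k) := by
  induction x using DirectSum.induction_on with
  | zero => simp
  | add x y hx hy => rw [map_add, DirectSum.add_apply, hx, hy, DirectSum.add_apply, map_add]
  | of l ξ =>
    have h := DirectSum.lmap_lof E l ξ
    refine (congrArg (fun z => z k) h).trans ?_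
    by_cases hk : l = k
    · subst hk
      exact (DirectSum.lof_apply _ _ _).trans (congrArg (E l) (DirectSum.lof_apply ℝ l ξ).symm)
    · have h1 : DirectSum.lof ℝ ℕ C l (E l ξ) k = 0 := DFinsupp.single_eq_of_ne (Ne.symm hk)
      have h2 : DirectSum.of A l ξ k = 0 := DFinsupp.single_eq_of_ne (Ne.symm hk)
      rw [h2, map_zero]
      exact h1

theorem lmap_injective {E : ∀ k, A k →ₗ[ℝ] C k} (hE : ∀ k, Function.Injective (E k)) :
    Function.Injective (DirectSum.lmap E) := by
  intro x y h
  refine DFinsupp.ext fun k => hE k ?_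
  have h1 := congrArg (fun z => z k) h
  exact (lmap_apply_component E x k).symm.trans (h1.trans (lmap_apply_component E y k))

/-- The composition `J ∘ J` is, up to sign, the Jacobiator of `J`. -/
theorem schoutenJacobi_opOf_self_eq_zero {J : MultiOp G 2}
    (hJ : ∀ r s t, J ![r, J ![s, t]] + J ![s, J ![t, r]] + J ![t, J ![r, s]] = 0) :
    schoutenJacobi G (opOf 2 J) (opOf 2 J) = 0 := by
  have h : comp (opOf 2 J) (opOf 2 J) = 0 := by
    refine DFinsupp.ext fun n => ?_
    by_cases hn : n = 3
    · subst hn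
      refine AlternatingMap.ext fun v => ?_
      have h1 := comp_binary_apply J J v
      refine h1.trans ?_
      have e0 : v ∘ (0 : Fin 3).succAbove = ![v 1, v 2] := by
        funext i; fin_cases i <;> rfl
      have e1 : v ∘ (1 : Fin 3).succAbove = ![v 0, v 2] := by
        funext i; fin_cases i <;> rfl
      have e2 : v ∘ (2 : Fin 3).succAbove = ![v 0, v 1] := by
        funext i; fin_cases i <;> rfl
      have hs : ∀ a b, J ![a, b] = -J ![b, a] := fun a b => map_vecCons_swap J a b ![]
      have h2 := hJ (v 0) (v 1) (v 2)
      have hneg : ∀ a b, J ![-a, b] = -J ![a, b] := fun a b => (headMap J ![b]).map_neg a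
      rw [hs (v 0) (J ![v 1, v 2]), hs (v 1) (J ![v 2, v 0]), hs (v 2) (J ![v 0, v 1]),
        hs (v 2) (v 0), hneg] at h2
      rw [Fin.sum_univ_three, e0, e1, e2]
      refine Eq.trans ?_ (neg_eq_zero.2 h2)
      norm_num [pow_succ]
      abel
    · have h1 : comp (opOf 2 J) (opOf 2 J) = opOf 3 (insertAt (by rfl : 2 + 1 = 3) J J) :=
        comp_opOf_insertAt _ J J
      rw [h1]
      exact opOf_apply_of_ne (Ne.symm hn) _
  rw [schoutenJacobi_eq_comp, h, smul_zero, sub_zero]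

/-- The projection property of a family of maps `R` with respect to the Gerstenhaber composition
gives the one with respect to the bracket. -/
theorem lmap_schoutenJacobi {I : ∀ k, A k →ₗ[ℝ] MultiOp G k} {R : ∀ k, MultiOp G k →ₗ[ℝ] C k}
    {P : ∀ k, MultiOp G k →ₗ[ℝ] A k}
    (hRI : ∀ a b (D : MultiOp G (a + 1)) (D' : MultiOp G b), opOf (a + 1) D ∈ unaryIn 𝒟 →
      opOf b D' ∈ unaryIn 𝒟 → R (b + a) (insertOp D D') =
        R (b + a) (insertOp D (I b (P b D'))) + R (b + a) (insertOp (I (a + 1) (P (a + 1) D)) D'))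
    {X Y : MultiOps G} (hX : X ∈ unaryIn 𝒟) (hY : Y ∈ unaryIn 𝒟) :
    DirectSum.lmap R (schoutenJacobi G X Y) =
      DirectSum.lmap R (schoutenJacobi G (DirectSum.lmap I (DirectSum.lmap P X)) Y) +
      DirectSum.lmap R (schoutenJacobi G X (DirectSum.lmap I (DirectSum.lmap P Y))) := by
  have hcomp : ∀ a b (D : MultiOp G a) (D' : MultiOp G b), opOf a D ∈ unaryIn 𝒟 →
      opOf b D' ∈ unaryIn 𝒟 → DirectSum.lmap R (comp (opOf a D) (opOf b D')) =
        DirectSum.lmap R (comp (opOf a D) (opOf b (I b (P b D')))) +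
        DirectSum.lmap R (comp (opOf a (I a (P a D))) (opOf b D')) := by
    intro a b D D' hD hD'
    rcases a with _ | a
    · rw [comp_opOf_zero, comp_opOf_zero, comp_opOf_zero, map_zero, add_zero]
    · have h : ∀ (B : MultiOp G (a + 1)) (B' : MultiOp G b), DirectSum.lmap R
          (comp (opOf (a + 1) B) (opOf b B')) =
          DirectSum.lof ℝ ℕ C (b + a) (R (b + a) (insertOp B B')) := fun B B' => by
        rw [comp_opOf]
        exact DirectSum.lmap_lof R _ _
      rw [h, h, h, hRI a b D D' hD hD', map_add]
  obtain ⟨s, hs⟩ := eq_sum_opOf X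
  obtain ⟨t, ht⟩ := eq_sum_opOf Y
  have key : ∀ a b, DirectSum.lmap R (schoutenJacobi G (opOf a (X a)) (opOf b (Y b))) =
      DirectSum.lmap R (schoutenJacobi G (DirectSum.lmap I (DirectSum.lmap P (opOf a (X a))))
        (opOf b (Y b))) +
      DirectSum.lmap R (schoutenJacobi G (opOf a (X a))
        (DirectSum.lmap I (DirectSum.lmap P (opOf b (Y b))))) := by
    intro a b
    simp only [DirectSum.lmap_lof]
    simp only [schoutenJacobi_eq_comp, map_sub, map_smul]
    rw [hcomp a b _ _ (component_mem hX a) (component_mem hY b),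
      hcomp b a _ _ (component_mem hY b) (component_mem hX a)]
    module
  rw [hs, ht]
  simp only [map_sum, LinearMap.coe_sum, Finset.sum_apply, ← Finset.sum_add_distrib]
  exact Finset.sum_congr rfl fun b _ => Finset.sum_congr rfl fun a _ => key _ _

/-- The `L_∞`-structure given by higher derived brackets. -/
theorem exists_lInfinityStructure (h𝒟 : ∀ B ∈ 𝒟, ∀ B' ∈ 𝒟, B ∘ₗ B' - B' ∘ₗ B ∈ 𝒟)
    {I : ∀ k, A k →ₗ[ℝ] MultiOp G k} {E : ∀ k, A k →ₗ[ℝ] C k} {R : ∀ k, MultiOp G k →ₗ[ℝ] C k}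
    (hE : ∀ k, Function.Injective (E k)) (hI : ∀ k ξ, opOf k (I k ξ) ∈ unaryIn 𝒟)
    (hII : ∀ a b ξ η, schoutenJacobi G (opOf a (I a ξ)) (opOf b (I b η)) = 0)
    (hR : ∀ k D, opOf k D ∈ unaryIn 𝒟 → ∃ ξ, E k ξ = R k D)
    (hRI : ∀ a b (D : MultiOp G (a + 1)) (D' : MultiOp G b) ξ η, opOf (a + 1) D ∈ unaryIn 𝒟 →
      opOf b D' ∈ unaryIn 𝒟 → E (a + 1) ξ = R (a + 1) D → E b η = R b D' →
      R (b + a) (insertOp D D') =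
        R (b + a) (insertOp D (I b η)) + R (b + a) (insertOp (I (a + 1) ξ) D'))
    {J : MultiOp G 2} (hJ : opOf 2 J ∈ unaryIn 𝒟)
    (hJJ : ∀ r s t, J ![r, J ![s, t]] + J ![s, J ![t, r]] + J ![t, J ![r, s]] = 0)
    (hRJ : R 2 J = 0) :
    ∃ 𝔪 : LInfinityStructure (shiftedGrading A), ∀ (k : ℕ) (ξ : Fin k → ⨁ k, A k),
      DirectSum.lmap E (𝔪.bracket k ξ) = DirectSum.lmap R
        ((List.ofFn ξ).foldl (fun D η => schoutenJacobi G D (DirectSum.lmap I η)) (opOf 2 J)) := by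
  -- `P` is `R` followed by a linear left inverse of `E`. It is defined on all operators, but
  -- represents `R` only where the values of `R` lie in the range of `E`, in particular on `unaryIn
  -- 𝒟`.
  choose Q hQ using fun k => (E k).exists_leftInverse_of_injective (LinearMap.ker_eq_bot.2 (hE k))
  let P : ∀ k, MultiOp G k →ₗ[ℝ] A k := fun k => Q k ∘ₗ R k
  have hP : ∀ k D, opOf k D ∈ unaryIn 𝒟 → E k (P k D) = R k D := by
    intro k D hD
    obtain ⟨ξ, hξ⟩ := hR k D hD
    have : P k D = ξ := by
      simp only [P, LinearMap.comp_apply, ← hξ]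
      exact congrArg (fun B => B ξ) (hQ k)
    rw [this, hξ]
  have hPt : ∀ X ∈ unaryIn 𝒟, DirectSum.lmap E (DirectSum.lmap P X) = DirectSum.lmap R X := by
    intro X hX
    refine DFinsupp.ext fun k => ?_
    refine (lmap_apply_component E _ k).trans (Eq.trans ?_ (lmap_apply_component R X k).symm)
    rw [lmap_apply_component P X k]
    exact hP k _ (component_mem hX k)
  have hIt : ∀ x, DirectSum.lmap I x ∈ unaryIn 𝒟 := lmap_mem_unaryIn hI
  have hbr : ∀ X ∈ unaryIn 𝒟, ∀ Y ∈ unaryIn 𝒟, schoutenJacobi G X Y ∈ unaryIn 𝒟 :=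
    fun X hX Y hY => schoutenJacobi_mem_unaryIn h𝒟 hX hY
  have hPbr : ∀ X ∈ unaryIn 𝒟, ∀ Y ∈ unaryIn 𝒟, DirectSum.lmap P (schoutenJacobi G X Y) =
      DirectSum.lmap P (schoutenJacobi G (DirectSum.lmap I (DirectSum.lmap P X)) Y) +
      DirectSum.lmap P (schoutenJacobi G X (DirectSum.lmap I (DirectSum.lmap P Y))) := by
    intro X hX Y hY
    apply lmap_injective hE
    rw [map_add, hPt _ (hbr X hX Y hY), hPt _ (hbr _ (hIt _) Y hY), hPt _ (hbr X hX _ (hIt _))]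
    exact lmap_schoutenJacobi (fun a b D D' hD hD' => hRI a b D D' _ _ hD hD'
      (hP _ D hD) (hP _ D' hD')) hX hY
  have hgr := lmap_mem_opGrading I
  have hab := schoutenJacobi_lmap hII
  have hJgr : opOf 2 J ∈ opGrading G 1 := opOf_mem_opGrading (by norm_num) J
  have hnest : ∀ (k : ℕ) (ξ : Fin k → ⨁ k, A k),
      ∀ X ∈ unaryIn 𝒟, nestedBracket (DirectSum.lmap I) k ξ X ∈ unaryIn 𝒟 := by
    intro k
    induction k with
    | zero => exact fun _ X hX => hX
    | succ k ih => exact fun ξ X hX => ih _ _ (hbr X hX _ (hIt _))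
  refine ⟨{
    bracket := fun k =>
      { toFun := fun ξ => DirectSum.lmap P (nestedBracket (DirectSum.lmap I) k ξ (opOf 2 J))
        map_update_add' := fun {inst} ξ i x y => by
          rw [Subsingleton.elim inst (instDecidableEqFin k), nestedBracket_update_add, map_add]
        map_update_smul' := fun {inst} ξ i c x => by
          rw [Subsingleton.elim inst (instDecidableEqFin k), nestedBracket_update_smul, map_smul] }
    -- The bracket without entries is `P J`, which `hRJ` makes zero.
    bracket_zero := fun x => by
      apply lmap_injective hE
      refine (hPt _ (hnest 0 x _ hJ)).trans ((DirectSum.lmap_lof R 2 J).trans ?_)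
      rw [hRJ, map_zero, map_zero]
    degree := fun k p x hx => lmap_mem_shiftedGrading P _ _ (nestedBracket_mem hgr hx hJgr)
    symm := fun k p x hx i j hij => by
      have h := nestedBracket_swap hgr hab hx hJgr i j hij
      exact (congrArg (DirectSum.lmap P) h).trans (map_smul _ _ _)
    jacobi := fun n p x hx => derivedBracket_jacobi hgr hab (DirectSum.lmap P)
      (lmap_mem_shiftedGrading P) (unaryIn 𝒟) hbr hIt hPbr hJgr hJ
      (schoutenJacobi_opOf_self_eq_zero hJJ) hx }, fun k ξ => ?_⟩
  refine (hPt _ (hnest k ξ _ hJ)).trans ?_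
  rw [nestedBracket_eq_foldl]

end DerivedBracketStructure

/-! ### Continuity and smoothness of forms on finite-dimensional spaces. -/

section FiniteDimensionalForms

variable {E : Type*} [NormedAddCommGroup E] [NormedSpace ℝ E] [FiniteDimensional ℝ E]

/-- Expansion in a basis turns the map into a polynomial in the coordinates. -/
theorem continuous_multilinearMap {k : ℕ} (f : MultilinearMap ℝ (fun _ : Fin k => E) ℝ) :
    Continuous f := by
  let b := Module.finBasis ℝ E
  have h : ∀ v, f v = ∑ r : Fin k → Fin (Module.finrank ℝ E),
      (∏ j, b.coord (r j) (v j)) * f fun j => b (r j) := by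
    intro v
    have h1 : v = fun j => ∑ i, b.coord i (v j) • b i := funext fun j => (b.sum_repr (v j)).symm
    conv_lhs => rw [h1, f.map_sum]
    refine Finset.sum_congr rfl fun r _ => ?_
    rw [f.map_smul_univ (fun j => b.coord (r j) (v j)) fun j => b (r j)]
    rfl
  rw [show (f : (Fin k → E) → ℝ) = _ from funext h]
  refine continuous_finsetSum _ fun r _ => (continuous_finsetProd _ fun j _ => ?_).mul
    continuous_const
  exact ((b.coord (r j)).continuous_of_finiteDimensional).comp (continuous_apply j)

/-- A family of alternating forms is smooth when its values on the vectors of a basis are. -/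
theorem contMDiffAt_alternating_of_basis {EY HY : Type*} [NormedAddCommGroup EY]
    [NormedSpace ℝ EY] [TopologicalSpace HY] {IY : ModelWithCorners ℝ EY HY} {Y : Type*}
    [TopologicalSpace Y] [ChartedSpace HY Y] {k : ℕ} {T : Y → E [⋀^Fin k]→L[ℝ] ℝ} {y : Y}
    {ι : Type*} [Finite ι] (b : Module.Basis ι ℝ E)
    (h : ∀ r : Fin k → ι, ContMDiffAt IY 𝓘(ℝ, ℝ) ∞ (fun z => T z fun j => b (r j)) y) :
    ContMDiffAt IY 𝓘(ℝ, E [⋀^Fin k]→L[ℝ] ℝ) ∞ T y := by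
  have := Fintype.ofFinite ι
  let ev : (E [⋀^Fin k]→L[ℝ] ℝ) →ₗ[ℝ] ((Fin k → ι) → ℝ) :=
    { toFun := fun A r => A fun j => b (r j)
      map_add' := fun _ _ => rfl
      map_smul' := fun _ _ => rfl }
  have hev : LinearMap.ker ev = ⊥ := by
    rw [LinearMap.ker_eq_bot]
    intro A B hAB
    have h1 : A.toMultilinearMap = B.toMultilinearMap :=
      Module.Basis.ext_multilinear (fun _ => b) fun r => congrFun hAB r
    ext v
    exact congrArg (fun C => C v) h1
  -- The form is recovered from its values on basis vectors by a linear map out of a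
  -- finite-dimensional space, which is smooth.
  obtain ⟨g, hg⟩ := ev.exists_leftInverse_of_injective hev
  have h2 : T = fun z => LinearMap.toContinuousLinearMap g (ev (T z)) :=
    funext fun z => (congrArg (fun C => C (T z)) hg).symm
  rw [h2]
  exact (LinearMap.toContinuousLinearMap g).contMDiff.contMDiffAt.comp y
    (contMDiffAt_pi_space.2 h)

end FiniteDimensionalForms

/-! ### Vertical lifts and the projection on multi-differential operators. -/

section NormalOperators

variable {ES : Type*} [NormedAddCommGroup ES] [NormedSpace ℝ ES] [FiniteDimensional ℝ ES]
  {S : Type*} [TopologicalSpace S] [ChartedSpace ES S]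
  [IsManifold 𝓘(ℝ, ES) ∞ S] [T2Space S]
  {F : Type*} [NormedAddCommGroup F] [NormedSpace ℝ F] [FiniteDimensional ℝ F]
  {N : S → Type*} [∀ x, AddCommGroup (N x)] [∀ x, Module ℝ (N x)] [∀ x, TopologicalSpace (N x)]
  [∀ x, IsTopologicalAddGroup (N x)] [∀ x, ContinuousSMul ℝ (N x)]
  [TopologicalSpace (TotalSpace F N)] [FiberBundle F N] [VectorBundle ℝ F N]
  [ContMDiffVectorBundle ∞ F N 𝓘(ℝ, ES)] [T2Space (TotalSpace F N)]
  {ℓ : S → Type*} [∀ x, AddCommGroup (ℓ x)] [∀ x, Module ℝ (ℓ x)] [∀ x, TopologicalSpace (ℓ x)]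
  [∀ x, IsTopologicalAddGroup (ℓ x)] [∀ x, ContinuousSMul ℝ (ℓ x)]
  [TopologicalSpace (TotalSpace ℝ ℓ)] [FiberBundle ℝ ℓ] [VectorBundle ℝ ℝ ℓ]
  [ContMDiffVectorBundle ∞ ℝ ℓ 𝓘(ℝ, ES)]

variable (ES F N ℓ) in
/-- The multi-differential operators on `L_NS` which are first order in each entry. -/
def multiDer : Submodule ℝ (MultiOps (PullbackSections ES F N ℓ)) :=
  unaryIn (firstOrderOps (𝓘(ℝ, ES).prod 𝓘(ℝ, F)) (footPoint ES F N *ᵖ ℓ))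

theorem schoutenJacobi_mem_multiDer (X : MultiOps (PullbackSections ES F N ℓ))
    (hX : X ∈ multiDer ES F N ℓ) (Y : MultiOps (PullbackSections ES F N ℓ))
    (hY : Y ∈ multiDer ES F N ℓ) : schoutenJacobi _ X Y ∈ multiDer ES F N ℓ :=
  schoutenJacobi_mem_unaryIn firstOrderOps_commutator hX hY

-- The bundle data are given explicitly, since they are slow to infer.
local notation "resZ" => restrictZero (ES := ES) (F := F) (N := N) (ℓ := ℓ)
local notation "linZ" => linLift (ES := ES) (F := F) (N := N) (ℓ := ℓ)
local notation "basZ" => baseLift (ES := ES) (F := F) (N := N) (ℓ := ℓ)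
local notation "evF" => evalForm (ES := ES) (F := F) (N := N) (ℓ := ℓ)
local notation "verL" => vertLift (ES := ES) (F := F) (N := N) (ℓ := ℓ)
local notation "resC" => restrictConormal (ES := ES) (F := F) (N := N) (ℓ := ℓ)

theorem vertLift_apply {k : ℕ} (ξ : NormalForms ES F N ℓ k) (s : Fin k → PullbackSections ES F N ℓ)
    (p : TotalSpace F N) : verL k ξ s p = ξ p.1 fun j => vertDeriv (s j) p := rfl

theorem evalForm_apply {k : ℕ} (ξ : NormalForms ES F N ℓ k)
    (φ : Fin k → ConormalSections ES F N ℓ) (x : S) : evF k ξ φ x = ξ x fun j => φ j x := rfl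

theorem restrictConormal_apply {k : ℕ} (D : MultiOp (PullbackSections ES F N ℓ) k)
    (φ : Fin k → ConormalSections ES F N ℓ) :
    resC k D φ = resZ (D fun j => linZ (φ j)) := rfl

/-- In each entry the lift is, pointwise, a linear function of the vertical derivative, and this
satisfies the first order identity by its Leibniz rule. -/
theorem vertLift_mem {k : ℕ} (ξ : NormalForms ES F N ℓ k) :
    opOf k (verL k ξ) ∈ multiDer ES F N ℓ := by
  rcases k with _ | k
  · exact opOf_zero_mem _
  refine mem_unaryIn_of_headMap _ fun w => ?_
  intro f g s
  refine ContMDiffSection.ext fun p => ?_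
  set Λ : (N p.1 →L[ℝ] ℓ p.1) →ₗ[ℝ] ℓ p.1 :=
    { toFun := fun α => ξ p.1 (Matrix.vecCons α fun j => vertDeriv (w j) p)
      map_add' := fun α β => (ξ p.1).toAlternatingMap.map_vecCons_add _ α β
      map_smul' := fun c α => (ξ p.1).toAlternatingMap.map_vecCons_smul _ c α }
  have h : ∀ s, headMap (verL (k + 1) ξ) w s p = Λ (vertDeriv s p) := fun s => by
    rw [headMap_apply, vertLift_apply]
    refine congrArg (ξ p.1) (funext fun j => ?_)
    refine Fin.cases ?_ (fun j => ?_) j <;> rfl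
  have h1 : vertDeriv (f • g • s) p - f p • vertDeriv (g • s) p - g p • vertDeriv (f • s) p +
      f p • g p • vertDeriv s p = 0 := by
    obtain ⟨δ, hδ⟩ := exists_vertDeriv_smul (ℓ := ℓ) f p
    obtain ⟨δ', hδ'⟩ := exists_vertDeriv_smul (ℓ := ℓ) g p
    ext v
    have h2 : fibreValue (g • s) p.1 p.2 = g p • fibreValue s p.1 p.2 := rfl
    change vertDeriv (f • g • s) p v - f p • vertDeriv (g • s) p v - g p • vertDeriv (f • s) p v +
      f p • g p • vertDeriv s p v = 0
    rw [hδ, hδ', hδ, h2]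
    module
  change headMap (verL (k + 1) ξ) w (f • g • s) p -
    f p • headMap (verL (k + 1) ξ) w (g • s) p -
    g p • headMap (verL (k + 1) ξ) w (f • s) p +
    f p • g p • headMap (verL (k + 1) ξ) w s p = (0 : ℓ p.1)
  rw [h, h, h, h]
  have h3 := congrArg Λ h1
  rw [map_zero, map_add, map_sub, map_sub, map_smul, map_smul, map_smul, map_smul] at h3
  exact h3

/-- Affine sections have vertical derivatives which are constant along the fibres. The inner lift is
then a pullback from `S`, and its own vertical derivative is zero. -/
theorem vertLift_affine {a b : ℕ} (ξ : NormalForms ES F N ℓ (a + 1)) (η : NormalForms ES F N ℓ b)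
    (v : Fin b → PullbackSections ES F N ℓ) (w : Fin a → PullbackSections ES F N ℓ)
    (hv : ∀ j, ∃ u φ, v j = basZ u + linZ φ) :
    verL (a + 1) ξ (Matrix.vecCons (verL b η v) w) = 0 := by
  choose u φ h using hv
  have h1 : verL b η v = basZ (evF b η φ) := ContMDiffSection.ext fun q => by
    rw [vertLift_apply]
    refine congrArg (η q.1) (funext fun j => ?_)
    rw [h, vertDeriv_add, vertDeriv_baseLift, vertDeriv_linLift, zero_add]
  refine ContMDiffSection.ext fun q => ?_
  rw [h1, vertLift_apply]
  exact (ξ q.1).map_coord_zero 0 (vertDeriv_baseLift _ q)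

theorem evalForm_injective (k : ℕ) :
    Function.Injective (evalForm (ES := ES) (F := F) (N := N) (ℓ := ℓ) k) := by
  intro ξ η h
  refine ContMDiffSection.ext fun x => ContinuousAlternatingMap.ext fun α => ?_
  choose φ hφ using fun j => exists_section_apply (IX := 𝓘(ℝ, ES)) (K := F →L[ℝ] ℝ)
    (V := fun x => N x →L[ℝ] ℓ x) x (α j)
  have h1 := congrArg (fun B => B φ x) h
  simp only [evalForm_apply] at h1
  rwa [show (fun j => φ j x) = α from funext fun j => (hφ j).1] at h1

/-- If `φ j x = 0`, the linear section of `φ j` vanishes on the zero section and has no vertical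
derivative at `0_x`, so its one-jet at `0_x` is zero. -/
theorem restrictConormal_apply_eq_zero {k : ℕ} {A : MultiOp (PullbackSections ES F N ℓ) k}
    (hA : opOf k A ∈ multiDer ES F N ℓ) (φ : Fin k → ConormalSections ES F N ℓ) (x : S)
    (j : Fin k) (hj : φ j x = 0) : resC k A φ x = 0 := by
  rcases k with _ | k
  · exact j.elim0
  have key : ∀ φ : Fin (k + 1) → ConormalSections ES F N ℓ, φ 0 x = 0 →
      resC (k + 1) A φ x = 0 := by
    intro φ h0
    have h1 := IsFirstOrder.apply_eq_zero_of_vertDeriv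
      (headMap_mem A hA fun j => linZ (φ j.succ)) (r := linZ (φ 0)) 0 x
      (fun y => (φ 0 y).map_zero) ((vertDeriv_linLift _ _).trans h0)
    rw [headMap_apply] at h1
    rw [restrictConormal_apply, restrictZero_apply]
    have h2 : (fun j => linZ (φ j)) = Matrix.vecCons (linZ (φ 0)) fun j => linZ (φ j.succ) :=
      funext fun j => by refine Fin.cases ?_ (fun j => ?_) j <;> rfl
    rw [h2]
    exact h1
  have h2 := key (φ ∘ Equiv.swap 0 j) (by simpa using hj)
  rw [AlternatingMap.map_perm] at h2
  rcases Int.units_eq_one_or (Equiv.Perm.sign (Equiv.swap 0 j)) with h3 | h3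
  · rw [h3, one_smul] at h2
    exact h2
  · rw [h3, Units.neg_smul, one_smul] at h2
    exact neg_eq_zero.1 h2

/-- The values of `P` on first order operators are tensorial. -/
theorem restrictConormal_congr {k : ℕ} {A : MultiOp (PullbackSections ES F N ℓ) k}
    (hA : opOf k A ∈ multiDer ES F N ℓ) {φ ψ : Fin k → ConormalSections ES F N ℓ} {x : S}
    (h : ∀ j, φ j x = ψ j x) : resC k A φ x = resC k A ψ x := by
  -- In the multilinear expansion every term with at least one entry from `φ - ψ` vanishes at `x`.
  have h1 : φ = (φ - ψ) + ψ := (sub_add_cancel φ ψ).symm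
  have h2 := (resC k A).toMultilinearMap.map_add_univ (φ - ψ) ψ
  rw [← h1] at h2
  have h3 := congrArg (fun u => u x) h2
  change resC k A φ x = (∑ s : Finset (Fin k), resC k A
    (s.piecewise (φ - ψ) ψ)) x at h3
  rw [h3, section_sum_apply, Finset.sum_eq_single ∅]
  · rw [Finset.piecewise_empty]
  · intro s _ hs
    obtain ⟨j, hj⟩ := Finset.nonempty_iff_ne_empty.2 hs
    refine restrictConormal_apply_eq_zero hA _ x j ?_
    rw [Finset.piecewise_eq_of_mem _ _ _ hj]
    exact sub_eq_zero.2 (h j)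
  · exact fun h => absurd (Finset.mem_univ _) h

/-- By tensoriality the form at `x` may be evaluated by extending elements of `Hom(N_x, ℓ_x)` to
sections; the extension `e x` is chosen linear so that multilinearity is inherited. In a local frame
the components are coordinates of smooth sections of `ℓ`, which gives smoothness. -/
theorem exists_evalForm_eq {k : ℕ} {A : MultiOp (PullbackSections ES F N ℓ) k}
    (hA : opOf k A ∈ multiDer ES F N ℓ) :
    ∃ ξ : NormalForms ES F N ℓ k, evF k ξ = resC k A := by
  set R := resC k A with hR
  have hext : ∀ x, ∃ e : (N x →L[ℝ] ℓ x) →ₗ[ℝ] ConormalSections ES F N ℓ,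
      evalAt x ∘ₗ e = LinearMap.id := fun x => by
    refine LinearMap.exists_rightInverse_of_surjective _ (LinearMap.range_eq_top.2 fun α => ?_)
    obtain ⟨φ, hφ, -⟩ := exists_section_apply (IX := 𝓘(ℝ, ES)) (K := F →L[ℝ] ℝ)
      (V := fun x => N x →L[ℝ] ℓ x) x α
    exact ⟨φ, hφ⟩
  choose e he using hext
  have he' : ∀ x α, e x α x = α := fun x α => congrArg (fun B => B α) (he x)
  let Φ := fun x => (trivializationAt (F →L[ℝ] ℝ) (fun x => N x →L[ℝ] ℓ x) x).continuousLinearEquivAt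
    ℝ x (mem_baseSet_trivializationAt _ _ x)
  let Ψ := fun x => (trivializationAt ℝ ℓ x).continuousLinearEquivAt ℝ x
    (mem_baseSet_trivializationAt _ _ x)
  let ev : ∀ x, Cₛ^∞⟮𝓘(ℝ, ES); ℝ, ℓ⟯ →ₗ[ℝ] ℓ x := fun x =>
    { toFun := fun u => u x, map_add' := fun _ _ => rfl, map_smul' := fun _ _ => rfl }
  -- The form is built on the finite-dimensional model fibre, where continuity is automatic, and
  -- transported back afterwards.
  let T : ∀ x, (F →L[ℝ] ℝ) [⋀^Fin k]→L[ℝ] ℝ := fun x =>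
    { (((Ψ x).toLinearMap ∘ₗ ev x).compAlternatingMap R).compLinearMap
        (e x ∘ₗ (Φ x).symm.toLinearMap) with
      cont := continuous_multilinearMap _ }
  let ξ : ∀ x, (N x →L[ℝ] ℓ x) [⋀^Fin k]→L[ℝ] ℓ x := fun x =>
    ((Ψ x).symm : ℝ →L[ℝ] ℓ x).compContinuousAlternatingMap
      ((T x).compContinuousLinearMap (Φ x : (N x →L[ℝ] ℓ x) →L[ℝ] (F →L[ℝ] ℝ)))
  have hξ : ∀ x (φ : Fin k → ConormalSections ES F N ℓ), ξ x (fun j => φ j x) = R φ x := by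
    intro x φ
    have h1 : ξ x (fun j => φ j x) = R (fun j => e x (φ j x)) x := by
      change (Ψ x).symm (Ψ x (R (fun j => e x ((Φ x).symm (Φ x (φ j x)))) x)) = _
      simp only [ContinuousLinearEquiv.symm_apply_apply]
    rw [h1]
    exact restrictConormal_congr hA fun j => he' x _
  refine ⟨⟨ξ, fun x₀ => ?_⟩, AlternatingMap.ext fun φ => ContMDiffSection.ext fun x => hξ x φ⟩
  set t := trivializationAt (F →L[ℝ] ℝ) (fun x => N x →L[ℝ] ℓ x) x₀
  have hx₀ : x₀ ∈ t.baseSet := mem_baseSet_trivializationAt _ _ x₀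
  set t' := trivializationAt ℝ ℓ x₀
  have hx₀' : x₀ ∈ t'.baseSet := mem_baseSet_trivializationAt _ _ x₀
  rw [contMDiffAt_section]
  let b := Module.finBasis ℝ (F →L[ℝ] ℝ)
  refine contMDiffAt_alternating_of_basis b fun r => ?_
  have hs : ∀ i, ∃ φ : ConormalSections ES F N ℓ, ∀ᶠ y in nhds x₀, φ y = t.symm y (b i) := by
    intro i
    obtain ⟨φ, -, hφ⟩ := exists_section_apply (IX := 𝓘(ℝ, ES)) (K := F →L[ℝ] ℝ)
      (V := fun x => N x →L[ℝ] ℓ x) x₀ (t.symm x₀ (b i))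
    refine ⟨φ, ?_⟩
    rw [show (trivializationAt (F →L[ℝ] ℝ) (fun x => N x →L[ℝ] ℓ x) x₀
      ⟨x₀, t.symm x₀ (b i)⟩).2 = b i from congrArg Prod.snd (t.apply_mk_symm hx₀ (b i))] at hφ
    exact hφ
  choose φ hφ using hs
  refine (section_coord_contMDiffAt (R fun j => φ (r j)) x₀ x₀ hx₀').congr_of_eventuallyEq ?_
  filter_upwards [t.open_baseSet.mem_nhds hx₀, t'.open_baseSet.mem_nhds hx₀',
    Filter.eventually_all.2 hφ] with y hy hy' hφy
  rw [FiberBundle.trivializationAt_continuousAlternatingMap_apply,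
    ContinuousAlternatingMap.inCoordinates_eq _ _ hy hy']
  rw [← hξ]
  simp only [hφy]
  rfl

end NormalOperators

/-! ### The projection identity and the `L_∞`-structure on the normal bundle. -/

/-- The normalization is the same in the three compositions, so the identity may be checked one
permutation at a time. -/
theorem map_insertOp_eq_add {G H : Type*} [AddCommGroup G] [Module ℝ G] [AddCommGroup H]
    [Module ℝ H] (ρ : G →ₗ[ℝ] H) {a b : ℕ} {D D₁ : MultiOp G (a + 1)} {D' D'₁ : MultiOp G b}
    (v : Fin (b + a) → G)
    (h : ∀ σ : Equiv.Perm (Fin (b + a)),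
      ρ (D (Matrix.vecCons (D' fun j => v (σ (Fin.castAdd a j))) fun j => v (σ (Fin.natAdd b j)))) =
      ρ (D (Matrix.vecCons (D'₁ fun j => v (σ (Fin.castAdd a j))) fun j => v (σ (Fin.natAdd b j)))) +
      ρ (D₁ (Matrix.vecCons (D' fun j => v (σ (Fin.castAdd a j)))
        fun j => v (σ (Fin.natAdd b j))))) :
    ρ (insertOp D D' v) = ρ (insertOp D D'₁ v) + ρ (insertOp D₁ D' v) := by
  have h4 : ∀ (ε : ℤˣ) (s : G), ρ (ε • s) = ε • ρ s := fun ε s => by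
    rcases Int.units_eq_one_or ε with rfl | rfl
    · rw [one_smul, one_smul]
    · rw [Units.neg_smul, Units.neg_smul, one_smul, one_smul, map_neg]
  simp only [insertOp_apply, map_smul, map_sum, h4, h, smul_add, Finset.sum_add_distrib]

section NormalLInfinity

variable {ES : Type*} [NormedAddCommGroup ES] [NormedSpace ℝ ES] [FiniteDimensional ℝ ES]
  {S : Type*} [TopologicalSpace S] [ChartedSpace ES S]
  [IsManifold 𝓘(ℝ, ES) ∞ S] [T2Space S]
  {F : Type*} [NormedAddCommGroup F] [NormedSpace ℝ F] [FiniteDimensional ℝ F]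
  {N : S → Type*} [∀ x, AddCommGroup (N x)] [∀ x, Module ℝ (N x)] [∀ x, TopologicalSpace (N x)]
  [∀ x, IsTopologicalAddGroup (N x)] [∀ x, ContinuousSMul ℝ (N x)]
  [TopologicalSpace (TotalSpace F N)] [FiberBundle F N] [VectorBundle ℝ F N]
  [ContMDiffVectorBundle ∞ F N 𝓘(ℝ, ES)] [T2Space (TotalSpace F N)]
  {ℓ : S → Type*} [∀ x, AddCommGroup (ℓ x)] [∀ x, Module ℝ (ℓ x)] [∀ x, TopologicalSpace (ℓ x)]
  [∀ x, IsTopologicalAddGroup (ℓ x)] [∀ x, ContinuousSMul ℝ (ℓ x)]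
  [TopologicalSpace (TotalSpace ℝ ℓ)] [FiberBundle ℝ ℓ] [VectorBundle ℝ ℝ ℓ]
  [ContMDiffVectorBundle ∞ ℝ ℓ 𝓘(ℝ, ES)]

-- The bundle data are given explicitly, since they are slow to infer.
local notation "resZ" => restrictZero (ES := ES) (F := F) (N := N) (ℓ := ℓ)
local notation "linZ" => linLift (ES := ES) (F := F) (N := N) (ℓ := ℓ)
local notation "jetZ" => conormalPart (ES := ES) (F := F) (N := N) (ℓ := ℓ)
local notation "basZ" => baseLift (ES := ES) (F := F) (N := N) (ℓ := ℓ)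
local notation "evF" => evalForm (ES := ES) (F := F) (N := N) (ℓ := ℓ)
local notation "verL" => vertLift (ES := ES) (F := F) (N := N) (ℓ := ℓ)
local notation "resC" => restrictConormal (ES := ES) (F := F) (N := N) (ℓ := ℓ)

theorem headMap_restrictZero {a : ℕ} {D : MultiOp (PullbackSections ES F N ℓ) (a + 1)}
    (hD : opOf (a + 1) D ∈ multiDer ES F N ℓ) (s : PullbackSections ES F N ℓ)
    (w : Fin a → PullbackSections ES F N ℓ) :
    resZ (D (Matrix.vecCons s w)) =
      resZ (D (Matrix.vecCons (basZ (resZ s)) w)) +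
      resZ (D (Matrix.vecCons (linZ (jetZ s)) w)) :=
  IsFirstOrder.restrictZero_apply (headMap_mem D hD w) s

-- On the zero section the outer operator sees the inner value `s` only through the pullback of
-- `s|_S` and the linear section of `d^v s|_S`. When the entries are linear, the pullback of `s|_S`
-- is the value of `I(P D')`, and inserting the linear section of `d^v s|_S` into `D` is the same as
-- inserting `s` into `I(P D)`.
set_option maxHeartbeats 1000000 in
theorem restrictConormal_insertOp {a b : ℕ} {D : MultiOp (PullbackSections ES F N ℓ) (a + 1)}
    {D' : MultiOp (PullbackSections ES F N ℓ) b} {ξ : NormalForms ES F N ℓ (a + 1)}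
    {η : NormalForms ES F N ℓ b} (hD : opOf (a + 1) D ∈ multiDer ES F N ℓ)
    (hξ : evF (a + 1) ξ = resC (a + 1) D)
    (hη : evF b η = resC b D') :
    resC (b + a) (insertOp D D') =
      resC (b + a) (insertOp D (verL b η)) +
      resC (b + a) (insertOp (verL (a + 1) ξ) D') := by
  have h1 : ∀ ψ : Fin b → ConormalSections ES F N ℓ, verL b η (fun j => linZ (ψ j)) =
      basZ (resZ (D' fun j => linZ (ψ j))) := by
    intro ψ
    rw [← restrictConormal_apply, ← hη]
    refine ContMDiffSection.ext fun p => ?_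
    rw [vertLift_apply]
    exact congrArg (η p.1) (funext fun j => vertDeriv_linLift _ _)
  have h2 : ∀ s : PullbackSections ES F N ℓ, ∀ ψ : Fin a → ConormalSections ES F N ℓ,
      resZ (verL (a + 1) ξ (Matrix.vecCons s fun j => linZ (ψ j))) =
      resZ (D (Matrix.vecCons (linZ (jetZ s)) fun j => linZ (ψ j))) := by
    intro s ψ
    have h3 : (Matrix.vecCons (linZ (jetZ s)) fun j => linZ (ψ j)) =
        fun j => linZ (Matrix.vecCons (jetZ s) ψ j) :=
      funext fun j => by refine Fin.cases ?_ (fun j => ?_) j <;> rfl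
    rw [h3, ← restrictConormal_apply, ← hξ]
    refine ContMDiffSection.ext fun x => ?_
    rw [restrictZero_apply, vertLift_apply]
    refine congrArg (ξ x) (funext fun j => ?_)
    refine Fin.cases ?_ (fun j => ?_) j
    · rfl
    · exact vertDeriv_linLift _ _
  refine AlternatingMap.ext fun φ => ?_
  refine map_insertOp_eq_add resZ (fun j => linZ (φ j)) fun σ => ?_
  rw [h1 fun j => φ (σ (Fin.castAdd a j)), h2 _ fun j => φ (σ (Fin.natAdd b j))]
  exact headMap_restrictZero hD _ _

variable (J : JacobiStructure (𝓘(ℝ, ES).prod 𝓘(ℝ, F)) ℝ (footPoint ES F N *ᵖ ℓ))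

theorem JacobiStructure.isFirstOrder_headMap {EX HX : Type*} [NormedAddCommGroup EX]
    [NormedSpace ℝ EX] [TopologicalSpace HX] {IX : ModelWithCorners ℝ EX HX} {X : Type*}
    [TopologicalSpace X] [ChartedSpace HX X] {V : X → Type*} [∀ x, AddCommGroup (V x)]
    [∀ x, Module ℝ (V x)] [∀ x, TopologicalSpace (V x)] [TopologicalSpace (TotalSpace ℝ V)]
    [FiberBundle ℝ V] [VectorBundle ℝ ℝ V] (J : JacobiStructure IX ℝ V)
    (w : Fin 1 → Cₛ^∞⟮IX; ℝ, V⟯) : IsFirstOrder (headMap J.bracket w) := by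
  have h : w = ![w 0] := funext fun j => by rw [Subsingleton.elim j 0]; rfl
  rw [h]
  exact J.firstOrder (w 0)

theorem JacobiStructure.mem_multiDer : opOf 2 J.bracket ∈ multiDer ES F N ℓ :=
  mem_unaryIn_of_headMap _ fun w => J.isFirstOrder_headMap w

local notation "totEv" => totalEval (ES := ES) (F := F) (N := N) (ℓ := ℓ)
local notation "totRes" => totalRestrict (ES := ES) (F := F) (N := N) (ℓ := ℓ)

set_option maxHeartbeats 1000000 in
/-- The `L_∞`-structure of a coisotropic submanifold. -/
theorem exists_normal_lInfinityStructure (hJ : resC 2 J.bracket = 0) :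
    ∃ 𝔪 : LInfinityStructure (formGrading ES F N ℓ),
      ∀ (k : ℕ) (ξ : Fin k → FormSpace ES F N ℓ),
        totEv (𝔪.bracket k ξ) = totRes (iteratedBracket J ξ) := by
  -- The lifts commute: the fibrewise affine sections serve as test entries, and on them every
  -- composition of lifts is zero.
  have hII : ∀ a b (ξ : NormalForms ES F N ℓ a) (η : NormalForms ES F N ℓ b),
      schoutenJacobi _ (opOf a (verL a ξ)) (opOf b (verL b η)) = 0 :=
    schoutenJacobi_eq_zero_of_forall_mem (ι := TotalSpace F N)
      (H := fun p => (footPoint ES F N *ᵖ ℓ) p)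
      (ev := fun p => { toFun := fun s => s p, map_add' := fun _ _ => rfl, map_smul' := fun _ _ => rfl })
      (fun s hs => ContMDiffSection.ext hs) (T := {s | ∃ u φ, s = basZ u + linZ φ})
      (fun p B hB h => IsFirstOrder.apply_eq_zero_of_affine hB fun u φ =>
        h (basZ u + linZ φ) ⟨u, φ, rfl⟩)
      firstOrderOps_commutator (fun k ξ => vertLift_mem ξ)
      fun a b ξ η v w hv => vertLift_affine ξ η v w hv
  exact exists_lInfinityStructure firstOrderOps_commutator
    (I := fun k => vertLift (ES := ES) (F := F) (N := N) (ℓ := ℓ) k)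
    (E := fun k => evalForm (ES := ES) (F := F) (N := N) (ℓ := ℓ) k)
    (R := fun k => restrictConormal (ES := ES) (F := F) (N := N) (ℓ := ℓ) k)
    evalForm_injective (fun k ξ => vertLift_mem ξ) hII (fun k D hD => exists_evalForm_eq hD)
    (fun a b D D' ξ η hD hD' hξ hη => restrictConormal_insertOp hD hξ hη) J.mem_multiDer J.jacobi hJ

end NormalLInfinity

/-! ### Local inverses of immersions of codimension zero. -/

section LocalInverse

variable {EX HX : Type*} [NormedAddCommGroup EX] [NormedSpace ℝ EX] [FiniteDimensional ℝ EX]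
  [TopologicalSpace HX] {IX : ModelWithCorners ℝ EX HX} [IX.Boundaryless]
  {X : Type*} [TopologicalSpace X] [ChartedSpace HX X]
  {EM HM : Type*} [NormedAddCommGroup EM] [NormedSpace ℝ EM] [FiniteDimensional ℝ EM]
  [TopologicalSpace HM] {IM : ModelWithCorners ℝ EM HM}
  {M : Type*} [TopologicalSpace M] [ChartedSpace HM M]

/-- An immersion into a manifold whose dimension is not greater has a smooth local inverse. -/
theorem exists_local_inverse {f : X → M} {x : X} (h : IsImmersionAt IX IM ∞ f x)
    (hdim : Module.finrank ℝ EM ≤ Module.finrank ℝ EX) :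
    ∃ σ : M → X, (∀ᶠ m in nhds (f x), ContMDiffAt IM IX ∞ σ m) ∧
      (∀ᶠ m in nhds (f x), f (σ m) = m) ∧ σ (f x) = x := by
  set c := h.domChart.extend IX with hc
  set d := h.codChart.extend IM with hd
  have hfin : FiniteDimensional ℝ (EX × h.complement) :=
    h.equiv.symm.toLinearEquiv.finiteDimensional
  have hfin' : FiniteDimensional ℝ h.complement :=
    Module.Finite.of_surjective (LinearMap.snd ℝ EX h.complement) LinearMap.snd_surjective
  -- In the immersion charts the map is `u ↦ h.equiv (u, 0)`. The dimension count makes the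
  -- complement trivial, so `B` inverts it.
  have h0 : Module.finrank ℝ h.complement = 0 := by
    have h1 := h.equiv.toLinearEquiv.finrank_eq
    rw [Module.finrank_prod] at h1
    omega
  have hsub : Subsingleton h.complement := Module.finrank_zero_iff.1 h0
  let B : EM → EX := fun z => (h.equiv.symm z).1
  have hB : ∀ z, h.equiv (B z, 0) = z := fun z => by
    have : ((B z, 0) : EX × h.complement) = h.equiv.symm z := Prod.ext rfl (Subsingleton.elim _ _)
    rw [this, ContinuousLinearEquiv.apply_symm_apply]
  have hBs : ContDiff ℝ ∞ B := contDiff_fst.comp h.equiv.symm.contDiff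
  have hx := h.mem_domChart_source
  have hxc : x ∈ c.source := by rw [hc, OpenPartialHomeomorph.extend_source]; exact hx
  have hfx := h.mem_codChart_source
  have hwr : ∀ u ∈ c.target, d (f (c.symm u)) = h.equiv (u, 0) := fun u hu => h.writtenInCharts hu
  have hBx : B (d (f x)) = c x := by
    have h1 := hwr (c x) (c.map_source hxc)
    rw [c.left_inv hxc] at h1
    simp only [B]
    rw [h1, ContinuousLinearEquiv.symm_apply_apply]
  have hdc : ContinuousAt (fun m => B (d m)) (f x) :=
    hBs.continuous.continuousAt.comp (h.codChart.continuousAt_extend hfx)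
  have htar : ∀ᶠ m in nhds (f x), B (d m) ∈ c.target := by
    refine hdc.eventually_mem ?_
    rw [hBx]
    exact (h.domChart.isOpen_extend_target (I := IX)).mem_nhds (c.map_source hxc)
  have hsrc : ∀ᶠ m in nhds (f x), m ∈ h.codChart.source := h.codChart.open_source.mem_nhds hfx
  refine ⟨fun m => c.symm (B (d m)), ?_, ?_, ?_⟩
  · filter_upwards [htar, hsrc] with m hm hms
    have h1 : ContMDiffAt 𝓘(ℝ, EX) IX ∞ c.symm (B (d m)) := by
      have h2 := contMDiffOn_extend_symm (I := IX) h.domChart_mem_maximalAtlas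
      have h3 : IX '' h.domChart.target = c.target := by
        rw [hc, OpenPartialHomeomorph.extend_target']
      rw [h3] at h2
      exact h2.contMDiffAt ((h.domChart.isOpen_extend_target (I := IX)).mem_nhds hm)
    exact h1.comp m (hBs.contMDiff.contMDiffAt.comp m
      (OpenPartialHomeomorph.contMDiffAt_extend h.codChart_mem_maximalAtlas hms))
  · filter_upwards [htar, hsrc] with m hm hms
    have h1 := hwr _ hm
    rw [hB] at h1
    have h2 : c.symm (B (d m)) ∈ h.domChart.source := by
      have := c.map_target hm
      rwa [hc, OpenPartialHomeomorph.extend_source] at this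
    have h3 := h.source_subset_preimage_source h2
    have h4 : d.symm (d (f (c.symm (B (d m))))) = d.symm (d m) := by rw [h1]
    rwa [hd, h.codChart.extend_left_inv h3, h.codChart.extend_left_inv hms] at h4
  · simp only [hBx]
    exact c.left_inv hxc

end LocalInverse

/-! ### Pullback of Jacobi structures along local isomorphisms of line bundles. -/

section Transport

variable {EX HX : Type*} [NormedAddCommGroup EX] [NormedSpace ℝ EX] [FiniteDimensional ℝ EX]
  [TopologicalSpace HX] {IX : ModelWithCorners ℝ EX HX}
  {X : Type*} [TopologicalSpace X] [ChartedSpace HX X] [IsManifold IX ∞ X] [T2Space X]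
  {V : X → Type*} [∀ x, AddCommGroup (V x)] [∀ x, Module ℝ (V x)] [∀ x, TopologicalSpace (V x)]
  [TopologicalSpace (TotalSpace ℝ V)] [FiberBundle ℝ V] [VectorBundle ℝ ℝ V]
  [ContMDiffVectorBundle ∞ ℝ V IX]
  {EM HM : Type*} [NormedAddCommGroup EM] [NormedSpace ℝ EM] [FiniteDimensional ℝ EM]
  [TopologicalSpace HM] {IM : ModelWithCorners ℝ EM HM}
  {M : Type*} [TopologicalSpace M] [ChartedSpace HM M] [IsManifold IM ∞ M] [T2Space M]
  {L : M → Type*} [∀ x, AddCommGroup (L x)] [∀ x, Module ℝ (L x)] [∀ x, TopologicalSpace (L x)]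
  [TopologicalSpace (TotalSpace ℝ L)] [FiberBundle ℝ L] [VectorBundle ℝ ℝ L]
  [ContMDiffVectorBundle ∞ ℝ L IM]

/-- First order operators are local, so the bracket at a point depends only on the germs of its
entries. -/
theorem JacobiStructure.bracket_congr {J : JacobiStructure IM ℝ L} {w w' : Fin 2 → Cₛ^∞⟮IM; ℝ, L⟯}
    {m : M} (h : ∀ j, ∀ᶠ y in nhds m, w j y = w' j y) : J.bracket w m = J.bracket w' m := by
  have hv : ∀ w : Fin 2 → Cₛ^∞⟮IM; ℝ, L⟯, w = ![w 0, w 1] := fun w => by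
    funext j; fin_cases j <;> rfl
  have h1 : ∀ a a' b : Cₛ^∞⟮IM; ℝ, L⟯, (∀ᶠ y in nhds m, a y = a' y) →
      J.bracket ![a, b] m = J.bracket ![a', b] m := fun a a' b hab =>
    IsFirstOrder.congr_apply (D := headMap J.bracket ![b]) (J.isFirstOrder_headMap _) hab
  rw [hv w, hv w', h1 _ _ _ (h 0), map_vecCons_swap, map_vecCons_swap J.bracket (w' 0)]
  exact congrArg Neg.neg (h1 _ _ _ (h 1))

variable (IX V IM L) in
/-- A fibrewise isomorphic map of line bundles over a map with smooth local inverses. -/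
structure LineBundleLocalIso where
  base : C^∞⟮IX, X; IM, M⟯
  fib : ∀ p, V p ≃ₗ[ℝ] L (base p)
  contMDiff_total : ContMDiff (IX.prod 𝓘(ℝ, ℝ)) (IM.prod 𝓘(ℝ, ℝ)) ∞
    fun v : TotalSpace ℝ V => (⟨base v.1, fib v.1 v.2⟩ : TotalSpace ℝ L)
  exists_inverse : ∀ p, ∃ σ : M → X, (∀ᶠ m in nhds (base p), ContMDiffAt IM IX ∞ σ m) ∧
    (∀ᶠ m in nhds (base p), base (σ m) = m) ∧ ∀ᶠ q in nhds p, σ (base q) = q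

namespace LineBundleLocalIso

variable (κ : LineBundleLocalIso IX V IM L)

theorem contMDiff_fib_section (s : Cₛ^∞⟮IX; ℝ, V⟯) : ContMDiff IX (IM.prod 𝓘(ℝ, ℝ)) ∞
    fun p => (⟨κ.base p, κ.fib p (s p)⟩ : TotalSpace ℝ L) :=
  κ.contMDiff_total.comp s.contMDiff

/-- The pullback of sections. -/
def pull (s : Cₛ^∞⟮IM; ℝ, L⟯) : Cₛ^∞⟮IX; ℝ, V⟯ :=
  ⟨fun p => (κ.fib p).symm (s (κ.base p)), by
    intro p₀
    obtain ⟨e, he, -⟩ := exists_frame (IX := IX) (V := V) p₀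
    set t := trivializationAt ℝ L (κ.base p₀)
    have ha := (contMDiffAt_totalSpace.1 ((κ.contMDiff_fib_section e) p₀)).2
    have hb := (contMDiffAt_totalSpace.1 ((s.contMDiff.comp κ.base.contMDiff) p₀)).2
    have hbase : ∀ᶠ p in nhds p₀, κ.base p ∈ t.baseSet :=
      κ.base.contMDiff.continuous.continuousAt.eventually_mem
        (t.open_baseSet.mem_nhds (mem_baseSet_trivializationAt ℝ L _))
    have hne : ∀ᶠ p in nhds p₀, (t ⟨κ.base p, κ.fib p (e p)⟩).2 ≠ 0 := by
      filter_upwards [he, hbase] with p hp hpb h0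
      have h1 := t.symm_apply_apply_mk hpb (κ.fib p (e p))
      rw [h0, ← t.coe_symmₗ (R := ℝ) hpb, map_zero] at h1
      exact hp ((κ.fib p).map_eq_zero_iff.1 h1.symm)
    -- In the frame `e` the coefficient of the pullback is a quotient of smooth coordinates, with a
    -- denominator that is not zero near `p₀`.
    have hq := hb.div₀ ha hne.self_of_nhds
    refine (hq.smul_section (e.contMDiff p₀)).congr_of_eventuallyEq ?_
    filter_upwards [hbase, hne] with p hp hpn
    congr 1
    rw [LinearEquiv.symm_apply_eq]
    change _ = κ.fib p (((t ⟨κ.base p, s (κ.base p)⟩).2 / (t ⟨κ.base p, κ.fib p (e p)⟩).2) • e p)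
    have h1 := t.symm_apply_apply_mk hp (κ.fib p (e p))
    have h2 := t.symm_apply_apply_mk hp (s (κ.base p))
    rw [← t.coe_symmₗ (R := ℝ) hp] at h1 h2
    refine Eq.trans ?_ ((κ.fib p).map_smul _ _).symm
    refine h2.symm.trans (Eq.trans ?_ (congrArg _ h1))
    rw [← map_smul, smul_eq_mul, div_mul_cancel₀ _ hpn]⟩

theorem fib_pull (s : Cₛ^∞⟮IM; ℝ, L⟯) (p : X) : κ.fib p (κ.pull s p) = s (κ.base p) :=
  (κ.fib p).apply_symm_apply _

/-- `s'` is the pullback of `s` near `p`. -/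
def RelatedAt (p : X) (s : Cₛ^∞⟮IM; ℝ, L⟯) (s' : Cₛ^∞⟮IX; ℝ, V⟯) : Prop :=
  ∀ᶠ q in nhds p, κ.fib q (s' q) = s (κ.base q)

/-- A section of `V` need not be a global pullback. Its germ at `p` is transported by the local
inverse and extended, which suffices for a local bracket. -/
theorem exists_relatedAt (p : X) (s' : Cₛ^∞⟮IX; ℝ, V⟯) :
    ∃ s : Cₛ^∞⟮IM; ℝ, L⟯, κ.RelatedAt p s s' := by
  obtain ⟨σ, hσ, hσ1, hσ2⟩ := κ.exists_inverse p
  set t := trivializationAt ℝ L (κ.base p)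
  have hb : ∀ᶠ m in nhds (κ.base p), m ∈ t.baseSet :=
    t.open_baseSet.mem_nhds (mem_baseSet_trivializationAt ℝ L _)
  let g : X → ℝ := fun q => (t ⟨κ.base q, κ.fib q (s' q)⟩).2
  obtain ⟨s, hs⟩ := exists_section_eventuallyEq (IX := IM) (K := ℝ) (V := L) (x := κ.base p)
    (fun m => t.symm m (g (σ m))) (by
      filter_upwards [hσ, hσ1, hb] with m hm hm1 hmb
      rw [t.contMDiffAt_section_iff hmb]
      have h1 : ContMDiffAt IX 𝓘(ℝ, ℝ) ∞ g (σ m) := by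
        refine ((t.contMDiffAt_iff (IB := IM) ?_).1 ((κ.contMDiff_fib_section s') (σ m))).2
        rw [Trivialization.mem_source]
        change κ.base (σ m) ∈ t.baseSet
        rwa [hm1]
      refine (h1.comp m hm).congr_of_eventuallyEq ?_
      filter_upwards [t.open_baseSet.mem_nhds hmb] with z hz
      rw [t.apply_mk_symm hz]
      rfl)
  refine ⟨s, ?_⟩
  have hc := κ.base.contMDiff.continuous.continuousAt (x := p)
  filter_upwards [hc.eventually hs, hc.eventually hb, hσ2] with q hq hqb hq2
  rw [hq, hq2]
  exact (t.symm_apply_apply_mk hqb _).symm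

theorem exists_function_relatedAt (p : X) (f : C^∞⟮IX, X; ℝ⟯) :
    ∃ g : C^∞⟮IM, M; ℝ⟯, ∀ᶠ q in nhds p, g (κ.base q) = f q := by
  obtain ⟨σ, hσ, hσ1, hσ2⟩ := κ.exists_inverse p
  obtain ⟨g, hg⟩ := exists_function_eventuallyEq (IX := IM) (x := κ.base p) (fun m => f (σ m)) (by
    filter_upwards [hσ] with m hm
    exact f.contMDiff.contMDiffAt.comp m hm)
  refine ⟨g, ?_⟩
  filter_upwards [κ.base.contMDiff.continuous.continuousAt.eventually hg, hσ2] with q hq hq2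
  rw [hq, hq2]

variable {κ}

/-- All points near `base p` are images of points near `p`, so a germ downstairs is determined by
its pullback. This makes the pulled back bracket independent of choices. -/
theorem RelatedAt.eventually_eq {p : X} {s t : Cₛ^∞⟮IM; ℝ, L⟯} {s' t' : Cₛ^∞⟮IX; ℝ, V⟯}
    (hs : κ.RelatedAt p s s') (ht : κ.RelatedAt p t t') (h : ∀ᶠ q in nhds p, s' q = t' q) :
    ∀ᶠ m in nhds (κ.base p), s m = t m := by
  obtain ⟨σ, hσ, hσ1, hσ2⟩ := κ.exists_inverse p
  have hc := hσ.self_of_nhds.continuousAt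
  rw [ContinuousAt, hσ2.self_of_nhds] at hc
  filter_upwards [hc.eventually hs, hc.eventually ht, hc.eventually h, hσ1] with m hm hm' hmh hm1
  rw [hmh] at hm
  have h1 : s (κ.base (σ m)) = t (κ.base (σ m)) := hm.symm.trans hm'
  rwa [hm1] at h1

theorem RelatedAt.add {p : X} {s t : Cₛ^∞⟮IM; ℝ, L⟯} {s' t' : Cₛ^∞⟮IX; ℝ, V⟯}
    (hs : κ.RelatedAt p s s') (ht : κ.RelatedAt p t t') : κ.RelatedAt p (s + t) (s' + t') := by
  filter_upwards [hs, ht] with q hq hq'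
  exact ((κ.fib q).map_add _ _).trans (congrArg₂ _ hq hq')

theorem RelatedAt.smul_real {p : X} {s : Cₛ^∞⟮IM; ℝ, L⟯} {s' : Cₛ^∞⟮IX; ℝ, V⟯}
    (c : ℝ) (hs : κ.RelatedAt p s s') : κ.RelatedAt p (c • s) (c • s') := by
  filter_upwards [hs] with q hq
  exact ((κ.fib q).map_smul c _).trans (congrArg _ hq)

theorem RelatedAt.smul {p : X} {s : Cₛ^∞⟮IM; ℝ, L⟯} {s' : Cₛ^∞⟮IX; ℝ, V⟯}
    {g : C^∞⟮IM, M; ℝ⟯} {f : C^∞⟮IX, X; ℝ⟯} (hg : ∀ᶠ q in nhds p, g (κ.base q) = f q)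
    (hs : κ.RelatedAt p s s') : κ.RelatedAt p (g • s) (f • s') := by
  filter_upwards [hs, hg] with q hq hgq
  refine ((κ.fib q).map_smul (f q) _).trans ?_
  rw [hq, ← hgq]
  rfl

theorem RelatedAt.update {p : X} {w : Fin 2 → Cₛ^∞⟮IM; ℝ, L⟯} {v : Fin 2 → Cₛ^∞⟮IX; ℝ, V⟯}
    (h : ∀ j, κ.RelatedAt p (w j) (v j)) (i : Fin 2) {s : Cₛ^∞⟮IM; ℝ, L⟯} {s' : Cₛ^∞⟮IX; ℝ, V⟯}
    (hs : κ.RelatedAt p s s') (j : Fin 2) :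
    κ.RelatedAt p (Function.update w i s j) (Function.update v i s' j) := by
  by_cases hj : j = i
  · subst hj
    rwa [Function.update_self, Function.update_self]
  · rw [Function.update_of_ne hj, Function.update_of_ne hj]
    exact h j

theorem relatedAt_vec {p : X} {s t : Cₛ^∞⟮IM; ℝ, L⟯} {s' t' : Cₛ^∞⟮IX; ℝ, V⟯}
    (hs : κ.RelatedAt p s s') (ht : κ.RelatedAt p t t') (j : Fin 2) :
    κ.RelatedAt p ((![s, t] : Fin 2 → _) j) ((![s', t'] : Fin 2 → _) j) := by
  fin_cases j
  · exact hs
  · exact ht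

variable (κ) (J : JacobiStructure IM ℝ L)

/-- The value at `p` of the pulled back bracket. -/
def pullBracketAt (v : Fin 2 → Cₛ^∞⟮IX; ℝ, V⟯) (p : X) : V p :=
  (κ.fib p).symm (J.bracket (fun j => (κ.exists_relatedAt p (v j)).choose) (κ.base p))

theorem fib_pullBracketAt {v : Fin 2 → Cₛ^∞⟮IX; ℝ, V⟯} {p : X} {w : Fin 2 → Cₛ^∞⟮IM; ℝ, L⟯}
    (h : ∀ j, κ.RelatedAt p (w j) (v j)) :
    κ.fib p (κ.pullBracketAt J v p) = J.bracket w (κ.base p) := by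
  rw [pullBracketAt, LinearEquiv.apply_symm_apply]
  exact J.bracket_congr fun j => (κ.exists_relatedAt p (v j)).choose_spec.eventually_eq (h j)
    (Filter.Eventually.of_forall fun _ => rfl)

theorem eventually_fib_pullBracketAt {v : Fin 2 → Cₛ^∞⟮IX; ℝ, V⟯} {p : X}
    {w : Fin 2 → Cₛ^∞⟮IM; ℝ, L⟯} (h : ∀ j, κ.RelatedAt p (w j) (v j)) :
    ∀ᶠ q in nhds p, κ.fib q (κ.pullBracketAt J v q) = J.bracket w (κ.base q) := by
  filter_upwards [Filter.eventually_all.2 fun j => (h j).eventually_nhds] with q hq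
  exact κ.fib_pullBracketAt J hq

/-- The pullback of a Jacobi bracket, as a biderivation. -/
def pullBracket : MultiOp Cₛ^∞⟮IX; ℝ, V⟯ 2 where
  toFun v := ⟨κ.pullBracketAt J v, fun p => by
    -- Sections chosen at `p` also represent the entries at nearby points, so near `p` the result is
    -- the pullback of one smooth section.
    choose w hw using fun j => κ.exists_relatedAt p (v j)
    refine ((κ.pull (J.bracket w)).contMDiff p).congr_of_eventuallyEq ?_
    filter_upwards [κ.eventually_fib_pullBracketAt J hw] with q hq
    congr 1
    exact (κ.fib q).injective (hq.trans (κ.fib_pull _ q).symm)⟩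
  map_update_add' := fun {inst} v i x y => by
    rw [Subsingleton.elim inst (instDecidableEqFin 2)]
    refine ContMDiffSection.ext fun p => (κ.fib p).injective ?_
    choose w hw using fun j => κ.exists_relatedAt p (v j)
    obtain ⟨a, ha⟩ := κ.exists_relatedAt p x
    obtain ⟨b, hb⟩ := κ.exists_relatedAt p y
    refine (κ.fib_pullBracketAt J (RelatedAt.update hw i (ha.add hb))).trans ?_
    refine Eq.trans ?_ ((κ.fib p).map_add _ _).symm
    refine Eq.trans ?_ (congrArg₂ (· + ·) (κ.fib_pullBracketAt J (RelatedAt.update hw i ha)).symm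
      (κ.fib_pullBracketAt J (RelatedAt.update hw i hb)).symm)
    rw [J.bracket.map_update_add]
    rfl
  map_update_smul' := fun {inst} v i c x => by
    rw [Subsingleton.elim inst (instDecidableEqFin 2)]
    refine ContMDiffSection.ext fun p => (κ.fib p).injective ?_
    choose w hw using fun j => κ.exists_relatedAt p (v j)
    obtain ⟨a, ha⟩ := κ.exists_relatedAt p x
    refine (κ.fib_pullBracketAt J (RelatedAt.update hw i (ha.smul_real c))).trans ?_
    refine Eq.trans ?_ ((κ.fib p).map_smul _ _).symm
    refine Eq.trans ?_ (congrArg (c • ·) (κ.fib_pullBracketAt J (RelatedAt.update hw i ha)).symm)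
    rw [J.bracket.map_update_smul]
    rfl
  map_eq_zero_of_eq' := fun v i j hij hne => by
    refine ContMDiffSection.ext fun p => (κ.fib p).injective ?_
    refine Eq.trans ?_ (κ.fib p).map_zero.symm
    refine (κ.fib_pullBracketAt J fun j => (κ.exists_relatedAt p (v j)).choose_spec).trans ?_
    rw [J.bracket.map_eq_zero_of_eq _ (by rw [hij]) hne]
    rfl

theorem relatedAt_pullBracket {v : Fin 2 → Cₛ^∞⟮IX; ℝ, V⟯} {p : X}
    {w : Fin 2 → Cₛ^∞⟮IM; ℝ, L⟯} (h : ∀ j, κ.RelatedAt p (w j) (v j)) :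
    κ.RelatedAt p (J.bracket w) (κ.pullBracket J v) := κ.eventually_fib_pullBracketAt J h

/-- The pullback of a Jacobi structure. -/
def pullJacobi : JacobiStructure IX ℝ V where
  bracket := κ.pullBracket J
  firstOrder t' f g s' := by
    refine ContMDiffSection.ext fun p => (κ.fib p).injective ?_
    refine Eq.trans ?_ (κ.fib p).map_zero.symm
    obtain ⟨t, ht⟩ := κ.exists_relatedAt p t'
    obtain ⟨s, hs⟩ := κ.exists_relatedAt p s'
    obtain ⟨f₁, hf⟩ := κ.exists_function_relatedAt p f
    obtain ⟨g₁, hg⟩ := κ.exists_function_relatedAt p g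
    have h1 := κ.fib_pullBracketAt J (relatedAt_vec ((hs.smul hg).smul hf) ht)
    have h2 := κ.fib_pullBracketAt J (relatedAt_vec (hs.smul hg) ht)
    have h3 := κ.fib_pullBracketAt J (relatedAt_vec (hs.smul hf) ht)
    have h4 := κ.fib_pullBracketAt J (relatedAt_vec hs ht)
    have h5 := congrArg (fun r => r (κ.base p)) (J.firstOrder t f₁ g₁ s)
    change J.bracket ![f₁ • g₁ • s, t] (κ.base p) - f₁ (κ.base p) • J.bracket ![g₁ • s, t] (κ.base p) -
      g₁ (κ.base p) • J.bracket ![f₁ • s, t] (κ.base p) +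
      f₁ (κ.base p) • g₁ (κ.base p) • J.bracket ![s, t] (κ.base p) = 0 at h5
    rw [← h1, ← h2, ← h3, ← h4, hf.self_of_nhds, hg.self_of_nhds] at h5
    refine Eq.trans ?_ h5
    change κ.fib p (κ.pullBracketAt J ![f • g • s', t'] p - f p • κ.pullBracketAt J ![g • s', t'] p -
      g p • κ.pullBracketAt J ![f • s', t'] p + f p • g p • κ.pullBracketAt J ![s', t'] p) = _
    simp only [map_add, map_sub, map_smul]
  jacobi r' s' t' := by
    refine ContMDiffSection.ext fun p => (κ.fib p).injective ?_
    refine Eq.trans ?_ (κ.fib p).map_zero.symm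
    obtain ⟨r, hr⟩ := κ.exists_relatedAt p r'
    obtain ⟨s, hs⟩ := κ.exists_relatedAt p s'
    obtain ⟨t, ht⟩ := κ.exists_relatedAt p t'
    have hb : ∀ {a b a' b'}, κ.RelatedAt p a a' → κ.RelatedAt p b b' →
        κ.RelatedAt p (J.bracket ![a, b]) (κ.pullBracket J ![a', b']) := fun ha hb =>
      κ.relatedAt_pullBracket J (relatedAt_vec ha hb)
    have h1 := (((hb hr (hb hs ht)).add (hb hs (hb ht hr))).add (hb ht (hb hr hs))).self_of_nhds
    rw [J.jacobi] at h1
    exact h1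

theorem JacobiStructure.ext_bracket {J J' : JacobiStructure IX ℝ V} (h : J.bracket = J'.bracket) :
    J = J' := by
  cases J
  cases J'
  congr

theorem pullJacobi_related {s t : Cₛ^∞⟮IM; ℝ, L⟯} {s' t' : Cₛ^∞⟮IX; ℝ, V⟯}
    (hs : ∀ p, κ.fib p (s' p) = s (κ.base p)) (ht : ∀ p, κ.fib p (t' p) = t (κ.base p)) (p : X) :
    κ.fib p ((κ.pullJacobi J).bracket ![s', t'] p) = J.bracket ![s, t] (κ.base p) :=
  κ.fib_pullBracketAt J (relatedAt_vec (Filter.Eventually.of_forall hs)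
    (Filter.Eventually.of_forall ht))

/-- Global pullbacks determine the bracket, because near each point every section agrees with the
pullback of some global section of `L`. -/
theorem pullJacobi_unique {J' : JacobiStructure IX ℝ V}
    (h : ∀ s t p, κ.fib p (J'.bracket ![κ.pull s, κ.pull t] p) = J.bracket ![s, t] (κ.base p)) :
    J' = κ.pullJacobi J := by
  refine JacobiStructure.ext_bracket (AlternatingMap.ext fun v => ContMDiffSection.ext fun p =>
    (κ.fib p).injective ?_)
  choose w hw using fun j => κ.exists_relatedAt p (v j)
  refine Eq.trans ?_ (κ.fib_pullBracketAt J hw).symm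
  have h1 : w = ![w 0, w 1] := by funext j; fin_cases j <;> rfl
  rw [h1, ← h]
  congr 1
  refine J'.bracket_congr fun j => ?_
  have h2 : ∀ j, ∀ᶠ q in nhds p, v j q = κ.pull (w j) q := fun j => by
    filter_upwards [hw j] with q hq
    exact (κ.fib q).injective (hq.trans (κ.fib_pull _ q).symm)
  fin_cases j
  · exact h2 0
  · exact h2 1

end LineBundleLocalIso

end Transport

/-! ### The Jacobi structure on the normal bundle of a coisotropic submanifold. -/

section Submanifold

variable {EM : Type*} [NormedAddCommGroup EM] [NormedSpace ℝ EM] [FiniteDimensional ℝ EM]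
  {M : Type*} [TopologicalSpace M] [ChartedSpace EM M] [IsManifold 𝓘(ℝ, EM) ∞ M] [T2Space M]
  {L : M → Type*} [∀ x, AddCommGroup (L x)] [∀ x, Module ℝ (L x)] [∀ x, TopologicalSpace (L x)]
  [∀ x, IsTopologicalAddGroup (L x)] [∀ x, ContinuousSMul ℝ (L x)]
  [TopologicalSpace (TotalSpace ℝ L)] [FiberBundle ℝ L] [VectorBundle ℝ ℝ L]
  [ContMDiffVectorBundle ∞ ℝ L 𝓘(ℝ, EM)]
  {ES : Type*} [NormedAddCommGroup ES] [NormedSpace ℝ ES] [FiniteDimensional ℝ ES]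
  {S : Type*} [TopologicalSpace S] [ChartedSpace ES S] [IsManifold 𝓘(ℝ, ES) ∞ S]
  {F : Type*} [NormedAddCommGroup F] [NormedSpace ℝ F] [FiniteDimensional ℝ F]
  {N : S → Type*} [∀ x, AddCommGroup (N x)] [∀ x, Module ℝ (N x)] [∀ x, TopologicalSpace (N x)]
  [∀ x, IsTopologicalAddGroup (N x)] [∀ x, ContinuousSMul ℝ (N x)]
  [TopologicalSpace (TotalSpace F N)] [FiberBundle F N] [VectorBundle ℝ F N]
  [ContMDiffVectorBundle ∞ F N 𝓘(ℝ, ES)]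

/-- Chain rule for the derivative of a section along a map. -/
theorem sectionDeriv_mfderiv {EY HY : Type*} [NormedAddCommGroup EY] [NormedSpace ℝ EY]
    [TopologicalSpace HY] {IY : ModelWithCorners ℝ EY HY} {Y : Type*} [TopologicalSpace Y]
    [ChartedSpace HY Y] (s : Cₛ^∞⟮𝓘(ℝ, EM); ℝ, L⟯) {c : Y → M} {y : Y}
    (hc : MDifferentiableAt IY 𝓘(ℝ, EM) c y) (v : TangentSpace IY y) :
    sectionDeriv s (c y) (mfderiv IY 𝓘(ℝ, EM) c y v) =
      (trivializationAt ℝ L (c y)).symmL ℝ (c y)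
        (mfderiv IY 𝓘(ℝ, ℝ) (fun z => (trivializationAt ℝ L (c y) ⟨c z, s (c z)⟩).2) y v) := by
  have h1 := section_coord_contMDiffAt s (c y) (c y) (mem_baseSet_trivializationAt ℝ L (c y))
  have h2 := mfderiv_comp (I := IY) (I' := 𝓘(ℝ, EM)) (I'' := 𝓘(ℝ, ℝ)) y
    (h1.mdifferentiableAt (by simp)) hc
  have h3 : mfderiv IY 𝓘(ℝ, ℝ) (fun z => (trivializationAt ℝ L (c y) ⟨c z, s (c z)⟩).2) y v =
    mfderiv 𝓘(ℝ, EM) 𝓘(ℝ, ℝ) (fun m => (trivializationAt ℝ L (c y) ⟨m, s m⟩).2) (c y)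
      (mfderiv IY 𝓘(ℝ, EM) c y v) := by
    exact congrArg (fun l => l v) h2
  rw [h3]
  rfl

theorem sectionDeriv_mfderiv_eq_zero {EY HY : Type*} [NormedAddCommGroup EY] [NormedSpace ℝ EY]
    [TopologicalSpace HY] {IY : ModelWithCorners ℝ EY HY} {Y : Type*} [TopologicalSpace Y]
    [ChartedSpace HY Y] (s : Cₛ^∞⟮𝓘(ℝ, EM); ℝ, L⟯) {c : Y → M} {y : Y}
    (hc : MDifferentiableAt IY 𝓘(ℝ, EM) c y) (h : ∀ᶠ z in nhds y, s (c z) = 0)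
    (v : TangentSpace IY y) :
    sectionDeriv s (c y) (mfderiv IY 𝓘(ℝ, EM) c y v) = 0 := by
  rw [sectionDeriv_mfderiv s hc]
  have h1 : (fun z => (trivializationAt ℝ L (c y) ⟨c z, s (c z)⟩).2) =ᶠ[nhds y] fun _ => (0 : ℝ) := by
    filter_upwards [h, hc.continuousAt.eventually_mem
      ((trivializationAt ℝ L (c y)).open_baseSet.mem_nhds
        (mem_baseSet_trivializationAt ℝ L (c y)))] with z hz hz'
    rw [hz]
    exact (trivializationAt ℝ L (c y)).linear ℝ hz' |>.map_zero
  rw [h1.mfderiv_eq, mfderiv_const]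
  exact map_zero _

/-- The kernel of the quotient map lies in the image of the derivative of `i`. This inequality is
all that is needed for the tubular embedding to be a local diffeomorphism. -/
theorem NormalBundle.finrank_le {i : C^∞⟮𝓘(ℝ, ES), S; 𝓘(ℝ, EM), M⟯} (ν : NormalBundle F N i)
    (x : S) : Module.finrank ℝ EM ≤ Module.finrank ℝ (ES × F) := by
  let e := (trivializationAt F N x).continuousLinearEquivAt ℝ x (mem_baseSet_trivializationAt F N x)
  let q : EM →ₗ[ℝ] F := e.toLinearEquiv.toLinearMap ∘ₗ (ν.quot x).toLinearMap
  let d : ES →ₗ[ℝ] EM := (mfderiv 𝓘(ℝ, ES) 𝓘(ℝ, EM) i x).toLinearMap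
  have h1 : LinearMap.ker q ≤ LinearMap.range d := fun v hv =>
    (ν.ker_eq x v).1 (e.toLinearEquiv.map_eq_zero_iff.1 hv)
  have h2 := LinearMap.finrank_range_add_finrank_ker q
  have h3 := Submodule.finrank_mono h1
  have h4 := LinearMap.finrank_range_le d
  have h5 := Submodule.finrank_le (LinearMap.range q)
  rw [Module.finrank_prod]
  omega

namespace FatTubularNeighborhood

variable {i : C^∞⟮𝓘(ℝ, ES), S; 𝓘(ℝ, EM), M⟯} (τ : FatTubularNeighborhood L F N i)

/-- A fat tubular neighbourhood as a fibrewise isomorphic map over a local diffeomorphism. -/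
def toLocalIso (ν : NormalBundle F N i) :
    LineBundleLocalIso (𝓘(ℝ, ES).prod 𝓘(ℝ, F)) (footPoint ES F N *ᵖ (i *ᵖ L)) 𝓘(ℝ, EM) L where
  base := τ.base
  fib := τ.fib
  contMDiff_total := τ.contMDiff_total
  exists_inverse p := by
    obtain ⟨σ, h1, h2, h3⟩ := exists_local_inverse (τ.isSmoothEmbedding.isImmersion.isImmersionAt p)
      (ν.finrank_le p.1)
    refine ⟨σ, h1, h2, ?_⟩
    -- Injectivity of the embedding turns the local right inverse `σ` into a left inverse.
    filter_upwards [τ.base.contMDiff.continuous.continuousAt.eventually h2] with q hq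
    exact τ.isSmoothEmbedding.isEmbedding.injective hq

theorem t2Space_totalSpace (τ : FatTubularNeighborhood L F N i) : T2Space (TotalSpace F N) := .of_injective_continuous
  τ.isSmoothEmbedding.isEmbedding.injective τ.base.contMDiff.continuous

/-- The points `τ.base ⟨x, 0⟩` and `i x` agree only propositionally, so the two fibres are compared
through a free point `m`. -/
theorem eq_zero_at_zero_iff (x : S) (s : Cₛ^∞⟮𝓘(ℝ, EM); ℝ, L⟯) :
    s (τ.base ⟨x, 0⟩) = 0 ↔ s (i x) = 0 := by
  have : ∀ m, m = i x → (s m = 0 ↔ s (i x) = 0) := by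
    rintro _ rfl
    rfl
  exact this _ (τ.base_zero x)

/-- The pullback of the bracket of a Jacobi structure for which `S` is coisotropic preserves the
sections vanishing on the zero section. -/
theorem restrictZero_pullJacobi_eq_zero [T2Space (TotalSpace F N)] (ν : NormalBundle F N i)
    {J : JacobiStructure 𝓘(ℝ, EM) ℝ L} (hJ : J.IsCoisotropic i)
    {s t : PullbackSections ES F N (i *ᵖ L)} (hs : restrictZero s = 0) (ht : restrictZero t = 0) :
    restrictZero (((τ.toLocalIso ν).pullJacobi J).bracket ![s, t]) = 0 := by
  refine ContMDiffSection.ext fun x => ?_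
  obtain ⟨s₁, hs₁⟩ := (τ.toLocalIso ν).exists_relatedAt ⟨x, 0⟩ s
  obtain ⟨t₁, ht₁⟩ := (τ.toLocalIso ν).exists_relatedAt ⟨x, 0⟩ t
  have hc : ContinuousAt (fun y : S => (⟨y, 0⟩ : TotalSpace F N)) x :=
    (contMDiff_zeroSection ℝ N (IB := 𝓘(ℝ, ES)) (n := ∞)).continuous.continuousAt
  -- The local representatives on `M` vanish along `S` near `x`, so their derivatives at `i x` kill
  -- `T_xS`, as the coisotropy condition requires.
  have key : ∀ (r : Cₛ^∞⟮𝓘(ℝ, EM); ℝ, L⟯) (r' : PullbackSections ES F N (i *ᵖ L)),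
      (τ.toLocalIso ν).RelatedAt ⟨x, 0⟩ r r' → restrictZero r' = 0 →
      ∀ᶠ y in nhds x, r (i y) = 0 := fun r r' h h0 => by
    filter_upwards [hc.eventually h] with y hy
    rw [← τ.eq_zero_at_zero_iff]
    refine hy.symm.trans ?_
    have h1 : r' ⟨y, 0⟩ = 0 := congrArg (fun u => u y) h0
    rw [h1]
    exact map_zero _
  have hs₂ := key s₁ s hs₁ hs
  have ht₂ := key t₁ t ht₁ ht
  have hi : MDifferentiableAt 𝓘(ℝ, ES) 𝓘(ℝ, EM) i x := i.contMDiff.mdifferentiableAt (by simp)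
  have h0 := hJ x s₁ t₁ hs₂.self_of_nhds ht₂.self_of_nhds
    (sectionDeriv_mfderiv_eq_zero s₁ hi hs₂) (sectionDeriv_mfderiv_eq_zero t₁ hi ht₂)
  rw [← τ.eq_zero_at_zero_iff] at h0
  have h1 := (τ.toLocalIso ν).fib_pullBracketAt J (LineBundleLocalIso.relatedAt_vec hs₁ ht₁)
  exact ((τ.toLocalIso ν).fib _).map_eq_zero_iff.1 (h1.trans h0)

/-- The Jacobi structure induced on the normal bundle of a coisotropic submanifold. -/
theorem exists_isPullback [T2Space (TotalSpace F N)] (ν : NormalBundle F N i)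
    {J : JacobiStructure 𝓘(ℝ, EM) ℝ L} (hJ : J.IsCoisotropic i) :
    ∃ J' : JacobiStructure (𝓘(ℝ, ES).prod 𝓘(ℝ, F)) ℝ (footPoint ES F N *ᵖ (i *ᵖ L)),
      τ.IsPullback J J' ∧ (∀ J'', τ.IsPullback J J'' → J'' = J') ∧
      ∀ s t, restrictZero s = 0 → restrictZero t = 0 → restrictZero (J'.bracket ![s, t]) = 0 :=
  ⟨(τ.toLocalIso ν).pullJacobi J,
    fun _ _ _ _ hs ht => (τ.toLocalIso ν).pullJacobi_related J hs ht,
    fun _ h => (τ.toLocalIso ν).pullJacobi_unique J fun s t =>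
      h _ _ _ _ ((τ.toLocalIso ν).fib_pull s) ((τ.toLocalIso ν).fib_pull t),
    fun _ _ hs ht => τ.restrictZero_pullJacobi_eq_zero ν hJ hs ht⟩

end FatTubularNeighborhood

/-- Linear sections vanish on the zero section. Through this lemma coisotropy excludes a bracket
without entries. -/
theorem restrictConormal_eq_zero
    {ℓ : S → Type*} [∀ x, AddCommGroup (ℓ x)] [∀ x, Module ℝ (ℓ x)] [∀ x, TopologicalSpace (ℓ x)]
    [∀ x, IsTopologicalAddGroup (ℓ x)] [∀ x, ContinuousSMul ℝ (ℓ x)]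
    [TopologicalSpace (TotalSpace ℝ ℓ)] [FiberBundle ℝ ℓ] [VectorBundle ℝ ℝ ℓ]
    [ContMDiffVectorBundle ∞ ℝ ℓ 𝓘(ℝ, ES)] [T2Space S] [T2Space (TotalSpace F N)]
    {D : MultiOp (PullbackSections ES F N ℓ) 2}
    (hD : ∀ s t, restrictZero s = 0 → restrictZero t = 0 → restrictZero (D ![s, t]) = 0) :
    restrictConormal 2 D = 0 := by
  refine AlternatingMap.ext fun φ => ?_
  have h := hD (linLift (φ 0)) (linLift (φ 1)) (restrictZero_linLift _) (restrictZero_linLift _)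
  refine Eq.trans ?_ h
  change restrictZero (D fun j => linLift (φ j)) = _
  congr 2
  funext j
  fin_cases j <;> rfl

end Submanifold

/-! ### Jacobi brackets as bilinear maps, and symbols of their adjoint operators. -/

/-- A binary alternating map as a bilinear map. -/
def bilinOf {G H : Type*} [AddCommGroup G] [Module ℝ G] [AddCommGroup H] [Module ℝ H]
    (D : G [⋀^Fin 2]→ₗ[ℝ] H) : G →ₗ[ℝ] G →ₗ[ℝ] H :=
  LinearMap.mk₂ ℝ (fun s t => D ![s, t]) (fun s s' t => D.map_vecCons_add ![t] s s')
    (fun c s t => D.map_vecCons_smul ![t] c s)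
    (fun s t t' => by
      rw [map_vecCons_swap, map_vecCons_swap D s t, map_vecCons_swap D s t', D.map_vecCons_add,
        neg_add])
    (fun c s t => by
      rw [map_vecCons_swap, map_vecCons_swap D s t, D.map_vecCons_smul, smul_neg])

theorem bilinOf_flip {G H : Type*} [AddCommGroup G] [Module ℝ G] [AddCommGroup H] [Module ℝ H]
    (D : G [⋀^Fin 2]→ₗ[ℝ] H) (s t : G) : bilinOf D s t = -bilinOf D t s :=
  map_vecCons_swap D s t ![]

section Adjoint

variable {EX HX : Type*} [NormedAddCommGroup EX] [NormedSpace ℝ EX] [FiniteDimensional ℝ EX]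
  [TopologicalSpace HX] {IX : ModelWithCorners ℝ EX HX}
  {X : Type*} [TopologicalSpace X] [ChartedSpace HX X] [IsManifold IX ∞ X] [T2Space X]
  {V : X → Type*} [∀ x, AddCommGroup (V x)] [∀ x, Module ℝ (V x)] [∀ x, TopologicalSpace (V x)]
  [TopologicalSpace (TotalSpace ℝ V)] [FiberBundle ℝ V] [VectorBundle ℝ ℝ V]
  [ContMDiffVectorBundle ∞ ℝ V IX] (J : JacobiStructure IX ℝ V)

/-- The Jacobi bracket as a bilinear map. -/
def JacobiStructure.ad : Cₛ^∞⟮IX; ℝ, V⟯ →ₗ[ℝ] Cₛ^∞⟮IX; ℝ, V⟯ →ₗ[ℝ] Cₛ^∞⟮IX; ℝ, V⟯ :=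
  bilinOf J.bracket

theorem JacobiStructure.ad_swap (s t : Cₛ^∞⟮IX; ℝ, V⟯) : J.ad s t = -J.ad t s :=
  bilinOf_flip J.bracket s t

theorem JacobiStructure.isFirstOrder_ad_flip (t : Cₛ^∞⟮IX; ℝ, V⟯) : IsFirstOrder (J.ad.flip t) :=
  J.firstOrder t

theorem JacobiStructure.isFirstOrder_ad (s : Cₛ^∞⟮IX; ℝ, V⟯) : IsFirstOrder (J.ad s) := by
  have h : J.ad s = -J.ad.flip s := LinearMap.ext fun t => J.ad_swap s t
  rw [h]
  exact (firstOrderOps IX V).neg_mem (J.isFirstOrder_ad_flip s)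

theorem JacobiStructure.ad_ad (r s t : Cₛ^∞⟮IX; ℝ, V⟯) :
    J.ad (J.ad r s) t = J.ad r (J.ad s t) - J.ad s (J.ad r t) := by
  have h : J.ad r (J.ad s t) + J.ad s (J.ad t r) + J.ad t (J.ad r s) = 0 := J.jacobi r s t
  rw [J.ad_swap t r, map_neg, J.ad_swap t, ← sub_eq_add_neg, ← sub_eq_add_neg, sub_eq_zero] at h
  exact h.symm

/-- The symbol of a first order operator. -/
def IsFirstOrder.symbol {D : Cₛ^∞⟮IX; ℝ, V⟯ →ₗ[ℝ] Cₛ^∞⟮IX; ℝ, V⟯} (hD : IsFirstOrder D) :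
    Derivation ℝ C^∞⟮IX, X; ℝ⟯ C^∞⟮IX, X; ℝ⟯ := hD.exists_symbol.choose

theorem IsFirstOrder.apply_smul {D : Cₛ^∞⟮IX; ℝ, V⟯ →ₗ[ℝ] Cₛ^∞⟮IX; ℝ, V⟯} (hD : IsFirstOrder D)
    (f : C^∞⟮IX, X; ℝ⟯) (s : Cₛ^∞⟮IX; ℝ, V⟯) : D (f • s) = f • D s + hD.symbol f • s :=
  hD.exists_symbol.choose_spec f s

theorem IsFirstOrder.symbol_eq {D : Cₛ^∞⟮IX; ℝ, V⟯ →ₗ[ℝ] Cₛ^∞⟮IX; ℝ, V⟯} (hD : IsFirstOrder D)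
    {f c : C^∞⟮IX, X; ℝ⟯} (h : ∀ s, D (f • s) = f • D s + c • s) : hD.symbol f = c :=
  smul_section_injective (IX := IX) (V := V) fun s => by
    have h1 := h s
    rw [hD.apply_smul] at h1
    exact add_left_cancel h1

theorem section_smul_sub (f : C^∞⟮IX, X; ℝ⟯) (s t : Cₛ^∞⟮IX; ℝ, V⟯) :
    f • (s - t) = f • s - f • t := ContMDiffSection.ext fun x => smul_sub (f x) (s x) (t x)

theorem section_sub_smul (f g : C^∞⟮IX, X; ℝ⟯) (s : Cₛ^∞⟮IX; ℝ, V⟯) :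
    (f - g) • s = f • s - g • s := ContMDiffSection.ext fun x => sub_smul (f x) (g x) (s x)

theorem section_real_smul (c : ℝ) (f : C^∞⟮IX, X; ℝ⟯) (s : Cₛ^∞⟮IX; ℝ, V⟯) :
    (c • f) • s = c • f • s := ContMDiffSection.ext fun x => smul_assoc c (f x) (s x)

theorem section_smul_zero (f : C^∞⟮IX, X; ℝ⟯) : f • (0 : Cₛ^∞⟮IX; ℝ, V⟯) = 0 :=
  ContMDiffSection.ext fun x => smul_zero (f x)

end Adjoint

/-! ### The Jacobi algebroid of a coisotropic zero section. -/

section Algebroid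

variable {ES : Type*} [NormedAddCommGroup ES] [NormedSpace ℝ ES] [FiniteDimensional ℝ ES]
  {S : Type*} [TopologicalSpace S] [ChartedSpace ES S]
  [IsManifold 𝓘(ℝ, ES) ∞ S] [T2Space S]
  {F : Type*} [NormedAddCommGroup F] [NormedSpace ℝ F] [FiniteDimensional ℝ F]
  {N : S → Type*} [∀ x, AddCommGroup (N x)] [∀ x, Module ℝ (N x)] [∀ x, TopologicalSpace (N x)]
  [∀ x, IsTopologicalAddGroup (N x)] [∀ x, ContinuousSMul ℝ (N x)]
  [TopologicalSpace (TotalSpace F N)] [FiberBundle F N] [VectorBundle ℝ F N]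
  [ContMDiffVectorBundle ∞ F N 𝓘(ℝ, ES)] [T2Space (TotalSpace F N)]
  {ℓ : S → Type*} [∀ x, AddCommGroup (ℓ x)] [∀ x, Module ℝ (ℓ x)] [∀ x, TopologicalSpace (ℓ x)]
  [∀ x, IsTopologicalAddGroup (ℓ x)] [∀ x, ContinuousSMul ℝ (ℓ x)]
  [TopologicalSpace (TotalSpace ℝ ℓ)] [FiberBundle ℝ ℓ] [VectorBundle ℝ ℝ ℓ]
  [ContMDiffVectorBundle ∞ ℝ ℓ 𝓘(ℝ, ES)]
  (J : JacobiStructure (𝓘(ℝ, ES).prod 𝓘(ℝ, F)) ℝ (footPoint ES F N *ᵖ ℓ))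

-- The bundle data are given explicitly, since they are slow to infer.
local notation "resZ" => restrictZero (ES := ES) (F := F) (N := N) (ℓ := ℓ)
local notation "linZ" => linLift (ES := ES) (F := F) (N := N) (ℓ := ℓ)
local notation "jetZ" => conormalPart (ES := ES) (F := F) (N := N) (ℓ := ℓ)
local notation "basZ" => baseLift (ES := ES) (F := F) (N := N) (ℓ := ℓ)

theorem conormalPart_smul (f : C^∞⟮𝓘(ℝ, ES).prod 𝓘(ℝ, F), TotalSpace F N; ℝ⟯)
    {s : PullbackSections ES F N ℓ} (hs : resZ s = 0) :
    jetZ (f • s) = (f.comp zeroSectionMap : C^∞⟮𝓘(ℝ, ES), S; ℝ⟯) • jetZ s :=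
  ContMDiffSection.ext fun x =>
    vertDeriv_smul_of_eq_zero f s ⟨x, 0⟩ (congrArg (fun u => u x) hs)

theorem linLift_smul (f : C^∞⟮𝓘(ℝ, ES), S; ℝ⟯) (φ : ConormalSections ES F N ℓ) :
    linZ (f • φ) =
      (f.comp (footPoint ES F N) : C^∞⟮𝓘(ℝ, ES).prod 𝓘(ℝ, F), TotalSpace F N; ℝ⟯) • linZ φ :=
  rfl

theorem baseLift_smul (f : C^∞⟮𝓘(ℝ, ES), S; ℝ⟯) (u : Cₛ^∞⟮𝓘(ℝ, ES); ℝ, ℓ⟯) :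
    (basZ (f • u) : PullbackSections ES F N ℓ) =
      (f.comp (footPoint ES F N) : C^∞⟮𝓘(ℝ, ES).prod 𝓘(ℝ, F), TotalSpace F N; ℝ⟯) • basZ u :=
  rfl

/-- The connection `∇_φ u = {lin φ, π*u}|_S`. -/
def normalConn : ConormalSections ES F N ℓ →ₗ[ℝ] Cₛ^∞⟮𝓘(ℝ, ES); ℝ, ℓ⟯ →ₗ[ℝ]
    Cₛ^∞⟮𝓘(ℝ, ES); ℝ, ℓ⟯ :=
  (J.ad.compl₁₂ linZ basZ).compr₂ resZ

theorem normalConn_apply (φ : ConormalSections ES F N ℓ) (u : Cₛ^∞⟮𝓘(ℝ, ES); ℝ, ℓ⟯) :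
    normalConn J φ u = resZ (J.ad (linZ φ) (basZ u)) := rfl

/-- The symbol at the zero section of `{lin φ, -}`. -/
def linSymbol (φ : ConormalSections ES F N ℓ) (f : C^∞⟮𝓘(ℝ, ES), S; ℝ⟯) : C^∞⟮𝓘(ℝ, ES), S; ℝ⟯ :=
  ((J.isFirstOrder_ad (linZ φ)).symbol (f.comp (footPoint ES F N))).comp zeroSectionMap

theorem normalConn_smul_right (φ : ConormalSections ES F N ℓ) (f : C^∞⟮𝓘(ℝ, ES), S; ℝ⟯)
    (u : Cₛ^∞⟮𝓘(ℝ, ES); ℝ, ℓ⟯) :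
    normalConn J φ (f • u) = f • normalConn J φ u + linSymbol J φ f • u := by
  rw [normalConn_apply, baseLift_smul, (J.isFirstOrder_ad (linZ φ)).apply_smul, map_add,
    restrictZero_smul, restrictZero_smul]
  rfl

/-- The symbol term multiplies `lin φ`, which vanishes on the zero section; so the connection is
tensorial in `φ`. -/
theorem normalConn_smul_left (f : C^∞⟮𝓘(ℝ, ES), S; ℝ⟯) (φ : ConormalSections ES F N ℓ)
    (u : Cₛ^∞⟮𝓘(ℝ, ES); ℝ, ℓ⟯) : normalConn J (f • φ) u = f • normalConn J φ u := by
  have h := (J.isFirstOrder_ad_flip (basZ u)).apply_smul (f.comp (footPoint ES F N)) (linZ φ)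
  rw [normalConn_apply, linLift_smul, ← J.ad.flip_apply, h, map_add, restrictZero_smul,
    restrictZero_smul, restrictZero_linLift, section_smul_zero, add_zero]
  rfl

theorem isFirstOrder_normalConn (φ : ConormalSections ES F N ℓ) :
    IsFirstOrder (normalConn J φ) := isFirstOrder_of_symbol (normalConn_smul_right J φ)

/-- The anchor. -/
def normalAnchor : ConormalSections ES F N ℓ →ₗ[ℝ]
    Derivation ℝ C^∞⟮𝓘(ℝ, ES), S; ℝ⟯ C^∞⟮𝓘(ℝ, ES), S; ℝ⟯ where
  -- Taking the symbol of `∇_φ` as the anchor reduces the identities for the anchor to identities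
  -- for the connection, by uniqueness of symbols.
  toFun φ := (isFirstOrder_normalConn J φ).symbol
  map_add' φ ψ := Derivation.ext fun f => (isFirstOrder_normalConn J (φ + ψ)).symbol_eq fun u => by
    rw [map_add, LinearMap.add_apply, LinearMap.add_apply,
      (isFirstOrder_normalConn J φ).apply_smul, (isFirstOrder_normalConn J ψ).apply_smul,
      section_smul_add, Derivation.add_apply, section_add_smul]
    abel
  map_smul' c φ := Derivation.ext fun f => (isFirstOrder_normalConn J (c • φ)).symbol_eq fun u => by
    have h : ∀ v, normalConn J (c • φ) v = c • normalConn J φ v := fun v =>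
      (normalConn J).map_smul₂ c φ v
    rw [h, h, (isFirstOrder_normalConn J φ).apply_smul, smul_add, section_smul_real]
    exact congrArg (_ + ·) (section_real_smul c ((isFirstOrder_normalConn J φ).symbol f) u).symm

theorem normalConn_leibniz (φ : ConormalSections ES F N ℓ) (f : C^∞⟮𝓘(ℝ, ES), S; ℝ⟯)
    (u : Cₛ^∞⟮𝓘(ℝ, ES); ℝ, ℓ⟯) :
    normalConn J φ (f • u) = f • normalConn J φ u + normalAnchor J φ f • u :=
  (isFirstOrder_normalConn J φ).apply_smul f u

theorem normalAnchor_eq {φ : ConormalSections ES F N ℓ} {f c : C^∞⟮𝓘(ℝ, ES), S; ℝ⟯}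
    (h : ∀ u, normalConn J φ (f • u) = f • normalConn J φ u + c • u) : normalAnchor J φ f = c :=
  (isFirstOrder_normalConn J φ).symbol_eq h

/-- The bracket `[φ, ψ] = d^v{lin φ, lin ψ}|_S`. -/
def normalBracket : MultiOp (ConormalSections ES F N ℓ) 2 :=
  (conormalPart.compAlternatingMap J.bracket).compLinearMap linZ

theorem normalBracket_apply (φ ψ : ConormalSections ES F N ℓ) :
    normalBracket J ![φ, ψ] = jetZ (J.ad (linZ φ) (linZ ψ)) := by
  change jetZ (J.bracket fun j => linZ ((![φ, ψ] : Fin 2 → _) j)) =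
    jetZ (J.bracket ![linZ φ, linZ ψ])
  congr 2
  funext j
  fin_cases j <;> rfl

variable {J}

/-- First `t` is replaced by its affine part, then `s` by its linear part. The linear part of `t`
does not contribute, since it vanishes on the zero section together with `s`. -/
theorem restrictZero_ad {s : PullbackSections ES F N ℓ} (hs : resZ s = 0)
    (t : PullbackSections ES F N ℓ)
    (hJ : ∀ s t, resZ s = 0 → resZ t = 0 → resZ (J.ad s t) = 0) :
    resZ (J.ad s t) = normalConn J (jetZ s) (resZ t) := by
  rw [(J.isFirstOrder_ad s).restrictZero_apply, hJ _ _ hs (restrictZero_linLift _), add_zero,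
    ← J.ad.flip_apply, (J.isFirstOrder_ad_flip _).restrictZero_apply s, hs, map_zero, map_zero,
    map_zero, zero_add]
  rfl

/-- A section vanishing on the zero section differs from the linear section of its conormal part by
one with zero one-jet there. Brackets of the latter with sections vanishing on the zero section have
no conormal part. -/
theorem conormalPart_ad {s t : PullbackSections ES F N ℓ} (hs : resZ s = 0)
    (ht : resZ t = 0)
    (hJ : ∀ s t, resZ s = 0 → resZ t = 0 → resZ (J.ad s t) = 0) :
    jetZ (J.ad s t) = normalBracket J ![jetZ s, jetZ t] := by
  have h1 : ∀ r : PullbackSections ES F N ℓ, resZ r = 0 →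
      resZ (r - linZ (jetZ r)) = 0 := fun r hr => by
    rw [map_sub, hr, restrictZero_linLift, sub_zero]
  have h2 : ∀ r : PullbackSections ES F N ℓ,
      jetZ (r - linZ (jetZ r)) = 0 := fun r => by
    rw [map_sub, conormalPart_linLift, sub_self]
  have h3 := (J.isFirstOrder_ad s).conormalPart_eq_zero (fun r hr => hJ s r hs hr) (h1 t ht) (h2 t)
  have h4 := (J.isFirstOrder_ad_flip (linZ (jetZ t))).conormalPart_eq_zero
    (fun r hr => hJ r _ hr (restrictZero_linLift _)) (h1 s hs) (h2 s)
  rw [map_sub, map_sub, sub_eq_zero] at h3 h4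
  rw [normalBracket_apply]
  exact h3.trans h4

/-- This is the Jacobi identity for two linear sections and a pullback, restricted to the zero
section. -/
theorem normalConn_normalBracket (φ ψ : ConormalSections ES F N ℓ) (u : Cₛ^∞⟮𝓘(ℝ, ES); ℝ, ℓ⟯)
    (hJ : ∀ s t, resZ s = 0 → resZ t = 0 → resZ (J.ad s t) = 0) :
    normalConn J (normalBracket J ![φ, ψ]) u =
      normalConn J φ (normalConn J ψ u) - normalConn J ψ (normalConn J φ u) := by
  have h := restrictZero_ad (hJ _ _ (restrictZero_linLift φ) (restrictZero_linLift ψ))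
    (basZ u) hJ
  rw [restrictZero_baseLift, ← normalBracket_apply, J.ad_ad, map_sub,
    restrictZero_ad (restrictZero_linLift φ) (J.ad (linZ ψ) (basZ u)) hJ,
    restrictZero_ad (restrictZero_linLift ψ) (J.ad (linZ φ) (basZ u)) hJ,
    conormalPart_linLift, conormalPart_linLift] at h
  exact h.symm

/-- The Jacobi algebroid of the zero section, when it is coisotropic. -/
def normalAlgebroid
    (hJ : ∀ s t, resZ s = 0 → resZ t = 0 → resZ (J.ad s t) = 0) :
    JacobiAlgebroid ES F N ℓ where
  bracket := normalBracket J
  jacobi φ ψ χ := by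
    -- The inner bracket of linear sections is in general not linear, but only its conormal part
    -- matters; so the Jacobi identity of `J` is inherited.
    have h : ∀ φ ψ χ, normalBracket J ![φ, normalBracket J ![ψ, χ]] =
        jetZ (J.ad (linZ φ) (J.ad (linZ ψ) (linZ χ))) := fun φ ψ χ => by
      have h1 := conormalPart_ad (restrictZero_linLift φ)
        (hJ _ _ (restrictZero_linLift ψ) (restrictZero_linLift χ)) hJ
      rw [conormalPart_linLift, ← normalBracket_apply J ψ χ] at h1
      exact h1.symm
    rw [h, h, h, ← map_add, ← map_add]
    exact (congrArg jetZ (J.jacobi (linZ φ) (linZ ψ) (linZ χ))).trans (map_zero _)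
  anchor := normalAnchor J
  anchor_smul f φ g := normalAnchor_eq J fun u => by
    rw [normalConn_smul_left, normalConn_smul_left, normalConn_leibniz, section_smul_add,
      section_smul_comm f g, section_mul_smul]
  anchor_bracket φ ψ := Derivation.ext fun f => normalAnchor_eq J fun u => by
    rw [normalConn_normalBracket φ ψ _ hJ, normalConn_normalBracket φ ψ _ hJ,
      normalConn_leibniz J ψ, normalConn_leibniz J φ f, map_add, map_add, normalConn_leibniz,
      normalConn_leibniz, normalConn_leibniz, normalConn_leibniz, Derivation.commutator_apply,
      section_smul_sub, section_sub_smul]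
    abel
  leibniz φ f ψ := by
    -- The symbol of `∇_φ` is the restriction of the symbol of `{lin φ, -}`, and this is what the
    -- Leibniz rule of `J` produces.
    have h1 : normalAnchor J φ f = linSymbol J φ f :=
      normalAnchor_eq J fun u => normalConn_smul_right J φ f u
    rw [normalBracket_apply, linLift_smul, (J.isFirstOrder_ad (linZ φ)).apply_smul, map_add,
      conormalPart_smul _ (hJ _ _ (restrictZero_linLift _) (restrictZero_linLift _)),
      conormalPart_smul _ (restrictZero_linLift _), conormalPart_linLift, h1, normalBracket_apply]
    rfl
  conn := normalConn J
  conn_smul f φ u := normalConn_smul_left J f φ u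
  conn_leibniz := normalConn_leibniz J
  conn_flat φ ψ u := normalConn_normalBracket φ ψ u hJ

theorem normalAlgebroid_isInducedBy
    (hJ : ∀ s t, resZ s = 0 → resZ t = 0 → resZ (J.ad s t) = 0) :
    (normalAlgebroid hJ).IsInducedBy J zeroSectionMap resZ IsConormalJetAtZero := by
  have h0 : ∀ (s : PullbackSections ES F N ℓ) φ, IsConormalJetAtZero s φ → resZ s = 0 :=
    fun s φ h => ContMDiffSection.ext h.vanish
  have h1 : ∀ (s : PullbackSections ES F N ℓ) φ, IsConormalJetAtZero s φ → jetZ s = φ :=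
    fun s φ h => ContMDiffSection.ext h.deriv_eq
  have hconn : ∀ (s : PullbackSections ES F N ℓ) φ, IsConormalJetAtZero s φ → ∀ t,
      normalConn J φ (resZ t) = resZ (J.ad s t) := fun s φ h t => by
    rw [restrictZero_ad (h0 s φ h) t hJ, h1 s φ h]
  refine ⟨fun s φ h f t => ?_, hconn, fun s φ t ψ hs ht => ?_⟩
  · change normalAnchor J φ (f.comp zeroSectionMap) • resZ t =
      resZ (J.ad s (f • t) - f • J.ad s t)
    rw [map_sub, restrictZero_smul, ← hconn s φ h, ← hconn s φ h, restrictZero_smul,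
      normalConn_leibniz, add_sub_cancel_left]
  · have h2 := conormalPart_ad (h0 s φ hs) (h0 t ψ ht) hJ
    have h3 := hJ s t (h0 s φ hs) (h0 t ψ ht)
    rw [h1 s φ hs, h1 t ψ ht] at h2
    exact ⟨fun x => congrArg (fun u => u x) h3, fun x => congrArg (fun u => u x) h2⟩

end Algebroid

/-! ### Conormal derivatives on the normal bundle and on the ambient manifold. -/

section FibreCurve

variable {ES : Type*} [NormedAddCommGroup ES] [NormedSpace ℝ ES] [FiniteDimensional ℝ ES]
  {S : Type*} [TopologicalSpace S] [ChartedSpace ES S]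
  [IsManifold 𝓘(ℝ, ES) ∞ S] [T2Space S]
  {F : Type*} [NormedAddCommGroup F] [NormedSpace ℝ F] [FiniteDimensional ℝ F]
  {N : S → Type*} [∀ x, AddCommGroup (N x)] [∀ x, Module ℝ (N x)] [∀ x, TopologicalSpace (N x)]
  [∀ x, IsTopologicalAddGroup (N x)] [∀ x, ContinuousSMul ℝ (N x)]
  [TopologicalSpace (TotalSpace F N)] [FiberBundle F N] [VectorBundle ℝ F N]
  [ContMDiffVectorBundle ∞ F N 𝓘(ℝ, ES)] [T2Space (TotalSpace F N)]
  {ℓ : S → Type*} [∀ x, AddCommGroup (ℓ x)] [∀ x, Module ℝ (ℓ x)] [∀ x, TopologicalSpace (ℓ x)]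
  [∀ x, IsTopologicalAddGroup (ℓ x)] [∀ x, ContinuousSMul ℝ (ℓ x)]
  [TopologicalSpace (TotalSpace ℝ ℓ)] [FiberBundle ℝ ℓ] [VectorBundle ℝ ℝ ℓ]
  [ContMDiffVectorBundle ∞ ℝ ℓ 𝓘(ℝ, ES)]

theorem contMDiff_fibre_line (x : S) (w : N x) :
    ContMDiff 𝓘(ℝ, ℝ) (𝓘(ℝ, ES).prod 𝓘(ℝ, F)) ∞ fun t : ℝ => (⟨x, t • w⟩ : TotalSpace F N) := by
  let e := (trivializationAt F N x).continuousLinearEquivAt ℝ x (mem_baseSet_trivializationAt F N x)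
  have h1 : ContMDiff 𝓘(ℝ, ℝ) 𝓘(ℝ, F) ∞ fun t : ℝ => t • e w :=
    (contDiff_id.smul contDiff_const).contMDiff
  have h2 := (contMDiff_fibre_inclusion (ES := ES) (N := N) x).comp h1
  have h3 : (fun t : ℝ => (⟨x, t • w⟩ : TotalSpace F N)) =
      (fun v : F => (⟨x, (trivializationAt F N x).symm x v⟩ : TotalSpace F N)) ∘
        fun t : ℝ => t • e w := by
    funext t
    have h4 : (trivializationAt F N x).symm x (t • e w) = t • w := by
      change e.symm (t • e w) = t • w
      rw [map_smul, e.symm_apply_apply]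
    exact congrArg (TotalSpace.mk x) h4.symm
  rw [h3]
  exact h2

theorem hasDerivAt_fibreValue (s : PullbackSections ES F N ℓ) (x : S) (w : N x) (e' : ℓ x ≃L[ℝ] ℝ) :
    HasDerivAt (fun t : ℝ => e' (fibreValue s x (t • w))) (e' (vertDeriv s ⟨x, 0⟩ w)) 0 := by
  let e := (trivializationAt F N x).continuousLinearEquivAt ℝ x (mem_baseSet_trivializationAt F N x)
  have h1 : HasDerivAt (fun t : ℝ => t • e w) (e w) 0 := by
    simpa using (hasDerivAt_id (0 : ℝ)).smul_const (e w)
  have h2 := (differentiable_fibre s x e e' ((0 : ℝ) • e w)).hasFDerivAt.comp_hasDerivAt (0 : ℝ) h1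
  rw [vertDeriv_eq s ⟨x, 0⟩ e e']
  have h3 : (fun t : ℝ => e' (fibreValue s x (t • w))) =
      (fun w : F => e' (fibreValue s x (e.symm w))) ∘ fun t : ℝ => t • e w := by
    funext t
    change _ = e' (fibreValue s x (e.symm (t • e w)))
    rw [map_smul, e.symm_apply_apply]
  rw [h3]
  have h4 : (0 : ℝ) • e w = e 0 := by rw [zero_smul, map_zero]
  rw [h4] at h2
  exact h2.congr_deriv (e'.apply_symm_apply _).symm

end FibreCurve

section Submanifold

variable {EM : Type*} [NormedAddCommGroup EM] [NormedSpace ℝ EM] [FiniteDimensional ℝ EM]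
  {M : Type*} [TopologicalSpace M] [ChartedSpace EM M] [IsManifold 𝓘(ℝ, EM) ∞ M] [T2Space M]
  {L : M → Type*} [∀ x, AddCommGroup (L x)] [∀ x, Module ℝ (L x)] [∀ x, TopologicalSpace (L x)]
  [∀ x, IsTopologicalAddGroup (L x)] [∀ x, ContinuousSMul ℝ (L x)]
  [TopologicalSpace (TotalSpace ℝ L)] [FiberBundle ℝ L] [VectorBundle ℝ ℝ L]
  [ContMDiffVectorBundle ∞ ℝ L 𝓘(ℝ, EM)]
  {ES : Type*} [NormedAddCommGroup ES] [NormedSpace ℝ ES] [FiniteDimensional ℝ ES]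
  {S : Type*} [TopologicalSpace S] [ChartedSpace ES S] [IsManifold 𝓘(ℝ, ES) ∞ S]
  {F : Type*} [NormedAddCommGroup F] [NormedSpace ℝ F] [FiniteDimensional ℝ F]
  {N : S → Type*} [∀ x, AddCommGroup (N x)] [∀ x, Module ℝ (N x)] [∀ x, TopologicalSpace (N x)]
  [∀ x, IsTopologicalAddGroup (N x)] [∀ x, ContinuousSMul ℝ (N x)]
  [TopologicalSpace (TotalSpace F N)] [FiberBundle F N] [VectorBundle ℝ F N]
  [ContMDiffVectorBundle ∞ F N 𝓘(ℝ, ES)]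

/-- The point `m` is free, because a fibre line starts at `τ.base ⟨x, 0 • w⟩`, which equals `i x`
only propositionally. -/
theorem sectionDeriv_mfderiv_of_eq {EY HY : Type*} [NormedAddCommGroup EY] [NormedSpace ℝ EY]
    [TopologicalSpace HY] {IY : ModelWithCorners ℝ EY HY} {Y : Type*} [TopologicalSpace Y]
    [ChartedSpace HY Y] (s : Cₛ^∞⟮𝓘(ℝ, EM); ℝ, L⟯) {c : Y → M} {y : Y} {m : M} (hm : c y = m)
    (hc : MDifferentiableAt IY 𝓘(ℝ, EM) c y) (v : TangentSpace IY y) (u : TangentSpace 𝓘(ℝ, EM) m)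
    (hu : u = mfderiv IY 𝓘(ℝ, EM) c y v) :
    sectionDeriv s m u = (trivializationAt ℝ L m).symmL ℝ m
        (mfderiv IY 𝓘(ℝ, ℝ) (fun z => (trivializationAt ℝ L m ⟨c z, s (c z)⟩).2) y v) := by
  subst hm
  rw [hu]
  exact sectionDeriv_mfderiv s hc v

namespace FatTubularNeighborhood

variable {i : C^∞⟮𝓘(ℝ, ES), S; 𝓘(ℝ, EM), M⟯} {τ : FatTubularNeighborhood L F N i}

theorem restrictZero_eq_of_related {s : Cₛ^∞⟮𝓘(ℝ, EM); ℝ, L⟯} {s' : PullbackSections ES F N (i *ᵖ L)}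
    (h : τ.Related s s') : restrictZero s' = restrictSection i s := by
  refine ContMDiffSection.ext fun x => ?_
  have h1 : ∀ m, m = i x → (⟨m, s m⟩ : TotalSpace ℝ L) = ⟨i x, s (i x)⟩ := by
    rintro _ rfl
    rfl
  have h2 := (τ.fib_zero x (s' ⟨x, 0⟩)).symm.trans
    ((congrArg (TotalSpace.mk (F := ℝ) (τ.base ⟨x, 0⟩)) (h ⟨x, 0⟩)).trans (h1 _ (τ.base_zero x)))
  exact TotalSpace.mk_injective (F := ℝ) (i x) h2

/-- Along `t ↦ t w` the coordinate of `s` is the coordinate of `s'` times the coordinate `a` of a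
transported frame. As `s'` vanishes at `t = 0` and `a 0 = 1`, the derivative of `a` does not
contribute. -/
theorem vertDeriv_of_related [T2Space S] [T2Space (TotalSpace F N)] {s : Cₛ^∞⟮𝓘(ℝ, EM); ℝ, L⟯}
    {s' : PullbackSections ES F N (i *ᵖ L)} (h : τ.Related s s') (x : S) (hx : s' ⟨x, 0⟩ = 0)
    (w : N x) (u : TangentSpace 𝓘(ℝ, EM) (i x))
    (hu : u = mfderiv 𝓘(ℝ, ℝ) 𝓘(ℝ, EM) (fun t : ℝ => τ.base ⟨x, t • w⟩) 0 (1 : ℝ)) :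
    vertDeriv s' ⟨x, 0⟩ w = sectionDeriv s (i x) u := by
  have hb := mem_baseSet_trivializationAt ℝ L (i x)
  set T := trivializationAt ℝ L (i x)
  let e' : (i *ᵖ L) x ≃L[ℝ] ℝ := T.continuousLinearEquivAt ℝ (i x) hb
  have hc := τ.base.contMDiff.comp (contMDiff_fibre_line (ES := ES) x w)
  have h0 : τ.base ⟨x, (0 : ℝ) • w⟩ = i x := by rw [zero_smul, τ.base_zero]
  rw [sectionDeriv_mfderiv_of_eq (c := fun t : ℝ => τ.base ⟨x, t • w⟩) s h0 (hc.mdifferentiableAt (by simp)) (1 : ℝ) u hu]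
  obtain ⟨b, hbx, -⟩ := exists_section_apply (IX := 𝓘(ℝ, ES)) (K := ℝ) (V := i *ᵖ L) x (e'.symm 1)
  let a : ℝ → ℝ := fun t => (T ⟨τ.base ⟨x, t • w⟩,
    τ.fib ⟨x, t • w⟩ ((baseLift b : PullbackSections ES F N (i *ᵖ L)) ⟨x, t • w⟩)⟩).2
  have ha : ContMDiffAt 𝓘(ℝ, ℝ) 𝓘(ℝ, ℝ) ∞ a 0 := by
    have h1 := (τ.contMDiff_total.comp
      (baseLift b : PullbackSections ES F N (i *ᵖ L)).contMDiff).comp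
        (contMDiff_fibre_line (ES := ES) x w)
    refine ((T.contMDiffAt_iff (IB := 𝓘(ℝ, EM)) ?_).1 (h1 0)).2
    rw [Trivialization.mem_source]
    change τ.base ⟨x, (0 : ℝ) • w⟩ ∈ T.baseSet
    rwa [h0]
  have ha0 : a 0 = 1 := by
    have h1 : (⟨τ.base ⟨x, (0 : ℝ) • w⟩, τ.fib ⟨x, (0 : ℝ) • w⟩ (b x)⟩ : TotalSpace ℝ L) =
        ⟨i x, b x⟩ := by
      rw [zero_smul]
      exact τ.fib_zero x (b x)
    change (T ⟨τ.base ⟨x, (0 : ℝ) • w⟩, τ.fib ⟨x, (0 : ℝ) • w⟩ (b x)⟩).2 = 1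
    rw [h1]
    exact (congrArg e' hbx).trans (e'.apply_symm_apply 1)
  have hd := (ha.contDiffAt.differentiableAt (by simp)).hasDerivAt.mul
    (hasDerivAt_fibreValue s' x w e')
  have h2 : (fun t : ℝ => (T ⟨τ.base ⟨x, t • w⟩, s (τ.base ⟨x, t • w⟩)⟩).2) =ᶠ[nhds 0]
      fun t => a t * e' (fibreValue s' x (t • w)) := by
    have h3 : ∀ᶠ t in nhds (0 : ℝ), τ.base ⟨x, t • w⟩ ∈ T.baseSet :=
      hc.continuous.continuousAt.eventually_mem (T.open_baseSet.mem_nhds (by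
        change τ.base ⟨x, (0 : ℝ) • w⟩ ∈ T.baseSet
        rwa [h0]))
    filter_upwards [h3] with t ht
    have h4 : s' ⟨x, t • w⟩ = e' (fibreValue s' x (t • w)) • b x := by
      rw [hbx, ← map_smul, smul_eq_mul, mul_one]
      exact (e'.symm_apply_apply _).symm
    rw [← h ⟨x, t • w⟩, h4, mul_comm]
    have h5 := (T.linear ℝ ht).map_smul (e' (fibreValue s' x (t • w)))
      (τ.fib ⟨x, t • w⟩ (b x))
    exact (congrArg (fun z => (T ⟨τ.base ⟨x, t • w⟩, z⟩).2)
      ((τ.fib ⟨x, t • w⟩).map_smul (e' (fibreValue s' x (t • w))) (b x))).trans h5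
  rw [h2.mfderiv_eq, mfderiv_eq_fderiv]
  have h6 : fderiv ℝ (fun t => a t * e' (fibreValue s' x (t • w))) 0 (1 : ℝ) =
      e' (vertDeriv s' ⟨x, 0⟩ w) := by
    have h7 : e' (fibreValue s' x ((0 : ℝ) • w)) = 0 := by
      rw [zero_smul]
      exact (congrArg e' hx).trans e'.map_zero
    refine hd.deriv.trans ?_
    rw [h7, ha0, mul_zero, zero_add, one_mul]
  refine (e'.symm_apply_apply _).symm.trans ((congrArg e'.symm h6.symm).trans ?_)
  exact congrFun (T.symm_continuousLinearEquivAt_eq (R := ℝ) hb) _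

theorem Related.smul {s : Cₛ^∞⟮𝓘(ℝ, EM); ℝ, L⟯} {s' : PullbackSections ES F N (i *ᵖ L)}
    (h : τ.Related s s') (f : C^∞⟮𝓘(ℝ, EM), M; ℝ⟯) :
    τ.Related (f • s)
      ((f.comp τ.base : C^∞⟮𝓘(ℝ, ES).prod 𝓘(ℝ, F), TotalSpace F N; ℝ⟯) • s') := fun p =>
  ((τ.fib p).map_smul (f (τ.base p)) (s' p)).trans (congrArg (f (τ.base p) • ·) (h p))

theorem Related.sub {s t : Cₛ^∞⟮𝓘(ℝ, EM); ℝ, L⟯} {s' t' : PullbackSections ES F N (i *ᵖ L)}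
    (h : τ.Related s s') (h' : τ.Related t t') : τ.Related (s - t) (s' - t') := fun p =>
  ((τ.fib p).map_sub (s' p) (t' p)).trans (congrArg₂ (· - ·) (h p) (h' p))

theorem Related.apply_zero_eq_zero_iff {s : Cₛ^∞⟮𝓘(ℝ, EM); ℝ, L⟯}
    {s' : PullbackSections ES F N (i *ᵖ L)} (h : τ.Related s s') (x : S) :
    s' ⟨x, 0⟩ = 0 ↔ s (i x) = 0 := by
  rw [← τ.eq_zero_at_zero_iff, ← h ⟨x, 0⟩]
  exact (τ.fib ⟨x, 0⟩).map_eq_zero_iff.symm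

/-- A tangent vector at `i x` differs from the velocity of a fibre line by a vector tangent to `S`,
on which the derivative of a section vanishing along `S` is zero. Normalization identifies this
fibre line as that of the class of the vector in `N_x`. -/
theorem IsNormalized.isConormalJetAtZero_iff [T2Space S] [T2Space (TotalSpace F N)]
    {ν : NormalBundle F N i} (hτ : τ.IsNormalized ν) {s : Cₛ^∞⟮𝓘(ℝ, EM); ℝ, L⟯}
    {s' : PullbackSections ES F N (i *ᵖ L)} (h : τ.Related s s')
    (φ : ConormalSections ES F N (i *ᵖ L)) :
    IsConormalJetAtZero s' φ ↔ IsConormalJet ν s φ := by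
  let d : ∀ x, N x → TangentSpace 𝓘(ℝ, EM) (i x) := fun x w =>
    mfderiv 𝓘(ℝ, ℝ) 𝓘(ℝ, EM) (fun t : ℝ => τ.base ⟨x, t • w⟩) 0 (1 : ℝ)
  have hd : ∀ x w, ν.quot x (d x w) = w := hτ
  constructor
  · intro hs
    have h0 : ∀ x, s (i x) = 0 := fun x => (h.apply_zero_eq_zero_iff x).1 (hs.vanish x)
    refine ⟨h0, fun x v => ?_⟩
    have h1 : ν.quot x (v - d x (ν.quot x v)) = 0 :=
      ((ν.quot x).map_sub v (d x (ν.quot x v))).trans (sub_eq_zero.2 (hd x _).symm)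
    obtain ⟨u, hu⟩ := (ν.ker_eq x _).1 h1
    have h2 := sectionDeriv_mfderiv_eq_zero s (i.contMDiff.mdifferentiableAt (by simp))
      (Filter.Eventually.of_forall h0) u
    rw [hu, map_sub, sub_eq_zero] at h2
    rw [h2, ← hs.deriv_eq]
    exact vertDeriv_of_related h x (hs.vanish x) _ _ rfl
  · intro hs
    have h0 : ∀ x, s' ⟨x, 0⟩ = 0 := fun x => (h.apply_zero_eq_zero_iff x).2 (hs.vanish x)
    refine ⟨h0, fun x => ContinuousLinearMap.ext fun w => ?_⟩
    refine (vertDeriv_of_related h x (h0 x) w (d x w) rfl).trans ?_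
    rw [← hs.deriv_eq, hd]

/-- Sections of `L` are replaced by their pullbacks, which are compatible with restriction,
brackets, multiplication by functions and conormal jets. -/
theorem isInducedBy_of_isPullback [T2Space S] [T2Space (TotalSpace F N)]
    {ν : NormalBundle F N i} (hτ : τ.IsNormalized ν) {J : JacobiStructure 𝓘(ℝ, EM) ℝ L}
    {J' : JacobiStructure (𝓘(ℝ, ES).prod 𝓘(ℝ, F)) ℝ (footPoint ES F N *ᵖ (i *ᵖ L))}
    (hJ : τ.IsPullback J J') {𝒜 : JacobiAlgebroid ES F N (i *ᵖ L)}
    (h : 𝒜.IsInducedBy J' zeroSectionMap restrictZero IsConormalJetAtZero) :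
    𝒜.IsInducedBy J i (restrictSection i) (IsConormalJet ν) := by
  have hp : ∀ s, τ.Related s ((τ.toLocalIso ν).pull s) := (τ.toLocalIso ν).fib_pull
  refine ⟨fun s φ hs f t => ?_, fun s φ hs t => ?_, fun s φ t ψ hs ht => ?_⟩
  · have h1 := h.anchor_eq _ φ ((hτ.isConormalJetAtZero_iff (hp s) φ).2 hs) (f.comp τ.base)
      ((τ.toLocalIso ν).pull t)
    have h2 : (f.comp τ.base).comp zeroSectionMap = f.comp i :=
      ContMDiffMap.ext fun x => congrArg f (τ.base_zero x)
    have h3 := (hJ _ _ _ _ (hp s) ((hp t).smul f)).sub ((hJ _ _ _ _ (hp s) (hp t)).smul f)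
    rw [h2, restrictZero_eq_of_related (hp t), restrictZero_eq_of_related h3] at h1
    exact h1
  · have h1 := h.conn_eq _ φ ((hτ.isConormalJetAtZero_iff (hp s) φ).2 hs)
      ((τ.toLocalIso ν).pull t)
    rwa [restrictZero_eq_of_related (hp t),
      restrictZero_eq_of_related (hJ _ _ _ _ (hp s) (hp t))] at h1
  · exact (hτ.isConormalJetAtZero_iff (hJ _ _ _ _ (hp s) (hp t)) _).1 (h.bracket_eq _ φ _ ψ
      ((hτ.isConormalJetAtZero_iff (hp s) φ).2 hs) ((hτ.isConormalJetAtZero_iff (hp t) ψ).2 ht))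

end FatTubularNeighborhood

end Submanifold

/-! ### The bracket of a binary operator with an arbitrary one. -/

section BinaryBracket

variable {G : Type*} [AddCommGroup G] [Module ℝ G]

theorem exists_schoutenJacobi_binary {k : ℕ} (A : MultiOp G 2) (D : MultiOp G k) :
    ∃ E : MultiOp G (k + 1), schoutenJacobi G (opOf 2 A) (opOf k D) = opOf (k + 1) E := by
  have h := schoutenJacobi_mem (opOf_mem_opGrading (d := 1) (by norm_num) A)
    (opOf_mem_opGrading (d := k - 1) (by ring) D)
  rcases eq_opOf_of_mem h with h | ⟨n, E, hn, h⟩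
  · exact ⟨0, by rw [h, map_zero]⟩
  · obtain rfl : n = k + 1 := by omega
    exact ⟨E, h⟩

theorem schoutenJacobi_binary_nullary_apply (A : MultiOp G 2) (D : MultiOp G 0) (v : Fin 1 → G) :
    schoutenJacobi G (opOf 2 A) (opOf 0 D) 1 v = A ![v 0, D ![]] := by
  have h1 := comp_binary_apply A D v
  have h2 : schoutenJacobi G (opOf 2 A) (opOf 0 D) = -comp (opOf 2 A) (opOf 0 D) := by
    rw [schoutenJacobi_eq_comp, comp_opOf_zero, sub_zero]
    norm_num
    exact neg_one_smul ℝ (comp (opOf 2 A) (opOf 0 D))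
  rw [h2, map_vecCons_swap]
  refine congrArg Neg.neg (h1.trans ?_)
  rw [Fin.sum_univ_one, Subsingleton.elim (v ∘ Fin.succAbove 0) ![]]
  simp

theorem schoutenJacobi_binary_apply {k : ℕ} (A : MultiOp G 2) (D : MultiOp G (k + 1))
    (v : Fin (k + 2) → G) : schoutenJacobi G (opOf 2 A) (opOf (k + 1) D) (k + 2) v =
      ∑ a : Fin (k + 2), (-1 : ℝ) ^ (a : ℕ) • A ![v a, D (v ∘ a.succAbove)] +
      ∑ b : Fin (k + 2), ∑ a : Fin (k + 1), if a.castSucc < b then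
        (-1 : ℝ) ^ ((a : ℕ) + (b : ℕ)) • D (Matrix.vecCons (A ![v a.castSucc, v b])
          (v ∘ b.succAbove ∘ a.succAbove)) else 0 := by
  have h1 := comp_binary_apply A D v
  have h2 := comp_apply_binary D A v
  rw [schoutenJacobi_eq_comp]
  refine (congrArg₂ (fun a b => (-1 : ℝ) ^ (((2 : ℕ) - 1 : ℤ) * (((k + 1 : ℕ) : ℤ) - 1)) • a - b)
    h1 h2).trans ?_
  rw [sub_neg_eq_add, Finset.smul_sum]
  refine congrArg₂ (· + ·) (Finset.sum_congr rfl fun a _ => ?_) rfl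
  have h3 : (-1 : ℝ) ^ (((2 : ℕ) - 1 : ℤ) * (((k + 1 : ℕ) : ℤ) - 1)) = (-1) ^ k := by
    rw [show (((2 : ℕ) - 1 : ℤ) * (((k + 1 : ℕ) : ℤ) - 1)) = (k : ℤ) by push_cast; ring,
      zpow_natCast]
  -- The remaining minus sign cancels against the exchange of the two entries of `A`.
  have h4 : (-1 : ℝ) ^ k * (-1) ^ (k + 1 + (a : ℕ)) = -(-1) ^ (a : ℕ) := by
    rw [← pow_add, show k + (k + 1 + (a : ℕ)) = 2 * k + (a + 1) by ring, pow_add, pow_mul]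
    simp [pow_succ]
  rw [h3, smul_smul, h4, map_vecCons_swap, neg_smul, smul_neg, neg_neg]

/-- The derived bracket is characterized only after applying the injection `E`; here this is turned
into an equality of homogeneous forms. -/
theorem eq_lof_of_lmap_eq {A C : ℕ → Type*} [∀ k, AddCommGroup (A k)] [∀ k, Module ℝ (A k)]
    [∀ k, AddCommGroup (C k)] [∀ k, Module ℝ (C k)] {I : ∀ k, A k →ₗ[ℝ] MultiOp G k}
    {E : ∀ k, A k →ₗ[ℝ] C k} {R : ∀ k, MultiOp G k →ₗ[ℝ] C k}
    (hE : ∀ k, Function.Injective (E k)) {k l : ℕ} {ξ : A k} {Q : MultiOps G} {D : MultiOp G l}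
    (hD : schoutenJacobi G Q (opOf k (I k ξ)) = opOf l D) {η : A l} (hη : E l η = R l D)
    {x : ⨁ k, A k} (hx : DirectSum.lmap E x = DirectSum.lmap R
      (schoutenJacobi G Q (DirectSum.lmap I (DirectSum.lof ℝ ℕ A k ξ)))) :
    x = DirectSum.lof ℝ ℕ A l η := by
  refine lmap_injective hE (hx.trans ?_)
  rw [DirectSum.lmap_lof, hD, DirectSum.lmap_lof, DirectSum.lmap_lof, hη]

end BinaryBracket

/-! ### The unary bracket as the de Rham differential. -/

section DeRham

variable {ES : Type*} [NormedAddCommGroup ES] [NormedSpace ℝ ES] [FiniteDimensional ℝ ES]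
  {S : Type*} [TopologicalSpace S] [ChartedSpace ES S]
  [IsManifold 𝓘(ℝ, ES) ∞ S] [T2Space S]
  {F : Type*} [NormedAddCommGroup F] [NormedSpace ℝ F] [FiniteDimensional ℝ F]
  {N : S → Type*} [∀ x, AddCommGroup (N x)] [∀ x, Module ℝ (N x)] [∀ x, TopologicalSpace (N x)]
  [∀ x, IsTopologicalAddGroup (N x)] [∀ x, ContinuousSMul ℝ (N x)]
  [TopologicalSpace (TotalSpace F N)] [FiberBundle F N] [VectorBundle ℝ F N]
  [ContMDiffVectorBundle ∞ F N 𝓘(ℝ, ES)] [T2Space (TotalSpace F N)]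
  {ℓ : S → Type*} [∀ x, AddCommGroup (ℓ x)] [∀ x, Module ℝ (ℓ x)] [∀ x, TopologicalSpace (ℓ x)]
  [∀ x, IsTopologicalAddGroup (ℓ x)] [∀ x, ContinuousSMul ℝ (ℓ x)]
  [TopologicalSpace (TotalSpace ℝ ℓ)] [FiberBundle ℝ ℓ] [VectorBundle ℝ ℝ ℓ]
  [ContMDiffVectorBundle ∞ ℝ ℓ 𝓘(ℝ, ES)]

  {J : JacobiStructure (𝓘(ℝ, ES).prod 𝓘(ℝ, F)) ℝ (footPoint ES F N *ᵖ ℓ)}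

-- The bundle data are given explicitly, since they are slow to infer.
local notation "resZ" => restrictZero (ES := ES) (F := F) (N := N) (ℓ := ℓ)
local notation "linZ" => linLift (ES := ES) (F := F) (N := N) (ℓ := ℓ)
local notation "jetZ" => conormalPart (ES := ES) (F := F) (N := N) (ℓ := ℓ)
local notation "evF" => evalForm (ES := ES) (F := F) (N := N) (ℓ := ℓ)
local notation "verL" => vertLift (ES := ES) (F := F) (N := N) (ℓ := ℓ)
local notation "resC" => restrictConormal (ES := ES) (F := F) (N := N) (ℓ := ℓ)

theorem restrictZero_vertLift {k : ℕ} (ξ : NormalForms ES F N ℓ k)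
    (s : Fin k → PullbackSections ES F N ℓ) :
    resZ (verL k ξ s) = evF k ξ fun j => jetZ (s j) := rfl

theorem restrictZero_vertLift_linLift {k : ℕ} (ξ : NormalForms ES F N ℓ k)
    (φ : Fin k → ConormalSections ES F N ℓ) :
    resZ (verL k ξ fun j => linZ (φ j)) = evF k ξ φ := by
  rw [restrictZero_vertLift]
  congr 1
  funext j
  exact conormalPart_linLift (φ j)

theorem restrictZero_jacobi_linLift
    (hJ : ∀ s t, resZ s = 0 → resZ t = 0 → resZ (J.ad s t) = 0)
    (φ : ConormalSections ES F N ℓ) (t : PullbackSections ES F N ℓ) :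
    resZ (J.bracket ![linZ φ, t]) = normalConn J φ (resZ t) := by
  have h := restrictZero_ad (restrictZero_linLift φ) t hJ
  rwa [conormalPart_linLift] at h

-- On linear sections the formula for `[J, I(ξ)]` is the Koszul formula term by term: bracketing
-- with a linear section restricts to the connection, and a bracket of two linear sections enters
-- the lift through its conormal part, the algebroid bracket. For `k = 0` only the connection term
-- is present.
set_option maxHeartbeats 1000000 in
theorem restrictConormal_schoutenJacobi_eq_deRham
    (hJ : ∀ s t, resZ s = 0 → resZ t = 0 → resZ (J.ad s t) = 0) (k : ℕ)
    (ξ : NormalForms ES F N ℓ k) (φ : Fin (k + 1) → ConormalSections ES F N ℓ) :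
    resC (k + 1)
      (schoutenJacobi _ (opOf 2 J.bracket) (opOf k (verL k ξ)) (k + 1)) φ =
      (normalAlgebroid hJ).deRham k ξ φ := by
  rcases k with _ | k
  · have h1 := schoutenJacobi_binary_nullary_apply J.bracket (verL 0 ξ) fun j => linZ (φ j)
    refine (congrArg resZ h1).trans ?_
    rw [restrictZero_jacobi_linLift hJ]
    exact congrArg (normalConn J (φ 0))
      ((restrictZero_vertLift ξ ![]).trans (congrArg (evF 0 ξ) (Subsingleton.elim _ _)))
  · have h1 := schoutenJacobi_binary_apply J.bracket (verL (k + 1) ξ) fun j => linZ (φ j)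
    refine (congrArg resZ h1).trans ?_
    rw [map_add, map_sum, map_sum]
    refine congrArg₂ (· + ·) (Finset.sum_congr rfl fun a _ => ?_)
      (Finset.sum_congr rfl fun b _ => ?_)
    · rw [map_smul, restrictZero_jacobi_linLift hJ]
      exact congrArg (fun u => (-1 : ℝ) ^ (a : ℕ) • normalConn J (φ a) u)
        (restrictZero_vertLift_linLift ξ (φ ∘ a.succAbove))
    · rw [map_sum]
      refine Finset.sum_congr rfl fun a _ => ?_
      split_ifs with hab
      · rw [map_smul, restrictZero_vertLift]
        congr 2
        funext j
        refine Fin.cases ?_ (fun j => ?_) j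
        · exact (normalBracket_apply J (φ a.castSucc) (φ b)).symm
        · exact conormalPart_linLift _
      · exact map_zero _

/-- The de Rham differential is the unary derived bracket. -/
theorem exists_evalForm_eq_deRham
    (hJ : ∀ s t, resZ s = 0 → resZ t = 0 → resZ (J.ad s t) = 0)
    (k : ℕ) (ξ : NormalForms ES F N ℓ k) : ∃ (η : NormalForms ES F N ℓ (k + 1))
      (E : MultiOp (PullbackSections ES F N ℓ) (k + 1)),
      (∀ φ, evF (k + 1) η φ = (normalAlgebroid hJ).deRham k ξ φ) ∧
      schoutenJacobi _ (opOf 2 J.bracket) (opOf k (verL k ξ)) = opOf (k + 1) E ∧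
      evF (k + 1) η = resC (k + 1) E := by
  obtain ⟨E, hE⟩ := exists_schoutenJacobi_binary J.bracket (verL k ξ)
  have hmem : opOf (k + 1) E ∈ multiDer ES F N ℓ :=
    hE ▸ schoutenJacobi_mem_multiDer _ J.mem_multiDer _ (vertLift_mem ξ)
  obtain ⟨η, hη⟩ := exists_evalForm_eq hmem
  refine ⟨η, E, fun φ => ?_, hE, hη⟩
  rw [← restrictConormal_schoutenJacobi_eq_deRham hJ, hE, opOf_apply_same, hη]

end DeRham

end JacobiGeometry

end

/-! ### Coisotropic submanifolds with a fat tubular neighbourhood. -/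

set_option maxHeartbeats 4000000 in
theorem proposition3p6
    {EM : Type*} [NormedAddCommGroup EM] [NormedSpace ℝ EM] [FiniteDimensional ℝ EM]
    {M : Type*} [TopologicalSpace M] [ChartedSpace EM M] [IsManifold 𝓘(ℝ, EM) ∞ M]
    [T2Space M] [SigmaCompactSpace M]
    {L : M → Type*} [∀ x, AddCommGroup (L x)] [∀ x, Module ℝ (L x)]
    [∀ x, TopologicalSpace (L x)] [∀ x, IsTopologicalAddGroup (L x)]
    [∀ x, ContinuousSMul ℝ (L x)] [TopologicalSpace (TotalSpace ℝ L)] [FiberBundle ℝ L]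
    [VectorBundle ℝ ℝ L] [ContMDiffVectorBundle ∞ ℝ L 𝓘(ℝ, EM)]
    (J : JacobiStructure 𝓘(ℝ, EM) ℝ L)
    {ES : Type*} [NormedAddCommGroup ES] [NormedSpace ℝ ES] [FiniteDimensional ℝ ES]
    {S : Type*} [TopologicalSpace S] [ChartedSpace ES S] [IsManifold 𝓘(ℝ, ES) ∞ S]
    (i : C^∞⟮𝓘(ℝ, ES), S; 𝓘(ℝ, EM), M⟯)
    (hi : IsSmoothEmbedding 𝓘(ℝ, ES) 𝓘(ℝ, EM) ∞ i) (hclosed : IsClosed (Set.range i))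
    (hcoiso : J.IsCoisotropic i)
    {F : Type*} [NormedAddCommGroup F] [NormedSpace ℝ F] [FiniteDimensional ℝ F]
    {N : S → Type*} [∀ x, AddCommGroup (N x)] [∀ x, Module ℝ (N x)]
    [∀ x, TopologicalSpace (N x)] [∀ x, IsTopologicalAddGroup (N x)]
    [∀ x, ContinuousSMul ℝ (N x)] [TopologicalSpace (TotalSpace F N)] [FiberBundle F N]
    [VectorBundle ℝ F N] [ContMDiffVectorBundle ∞ F N 𝓘(ℝ, ES)]
    (ν : NormalBundle F N i) (τ : FatTubularNeighborhood L F N i) :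
    ∃ J' : JacobiStructure (𝓘(ℝ, ES).prod 𝓘(ℝ, F)) ℝ (footPoint ES F N *ᵖ (i *ᵖ L)),
      τ.IsPullback J J' ∧ (∀ J'', τ.IsPullback J J'' → J'' = J') ∧
      ∃ 𝔪 : LInfinityStructure (formGrading ES F N (i *ᵖ L)),
        (∀ (k : ℕ) (ξ : Fin k → FormSpace ES F N (i *ᵖ L)),
          totalEval (𝔪.bracket k ξ) = totalRestrict (iteratedBracket J' ξ)) ∧
        ∃ 𝒜 : JacobiAlgebroid ES F N (i *ᵖ L),
          𝒜.IsInducedBy J' zeroSectionMap restrictZero IsConormalJetAtZero ∧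
          (τ.IsNormalized ν → 𝒜.IsInducedBy J i (restrictSection i) (IsConormalJet ν)) ∧
          ∀ (k : ℕ) (ξ : NormalForms ES F N (i *ᵖ L) k),
            ∃ η : NormalForms ES F N (i *ᵖ L) (k + 1),
              (∀ φ, evalForm (k + 1) η φ = 𝒜.deRham k ξ φ) ∧
              𝔪.bracket 1 ![DirectSum.lof ℝ ℕ (fun k => NormalForms ES F N (i *ᵖ L) k) k ξ] =
                DirectSum.lof ℝ ℕ (fun k => NormalForms ES F N (i *ᵖ L) k) (k + 1) η := by
  -- Both `S` and the total space of `N` map injectively and continuously into the Hausdorff space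
  -- `M`.
  have hS : T2Space S := .of_injective_continuous hi.isEmbedding.injective i.contMDiff.continuous
  have hN : T2Space (TotalSpace F N) := τ.t2Space_totalSpace
  obtain ⟨J', hp, hu, hJ⟩ := τ.exists_isPullback ν hcoiso
  -- Coisotropy enters as `P J' = 0`, that is `m_0 = 0`.
  obtain ⟨𝔪, h𝔪⟩ := exists_normal_lInfinityStructure J' (restrictConormal_eq_zero hJ)
  refine ⟨J', hp, hu, 𝔪, h𝔪, normalAlgebroid hJ, normalAlgebroid_isInducedBy hJ, fun hτ =>
    FatTubularNeighborhood.isInducedBy_of_isPullback hτ hp (normalAlgebroid_isInducedBy hJ),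
    fun k ξ => ?_⟩
  obtain ⟨η, E, h, hE, hη⟩ := exists_evalForm_eq_deRham hJ k ξ
  exact ⟨η, h, eq_lof_of_lmap_eq evalForm_injective hE hη (h𝔪 1 _)⟩
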